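/- **Theorem 4.2.** *Model.* For $n\ge 1$ let $y_j=S(x_j)+\sigma_j(S)\,\xi_j$, $x_j=j/n$, $1\le j\le n$, where $\sigma_j(S)=g(x_j,S)$ with $g:[0,1]\times L_1[0,1]\to[0,\infty)$ and $\xi_1,\dots,\xi_n$ are i.i.d. with a density $p\in\mathcal P_*$; here $\mathcal P_*$ is the set of all probability densities on $\mathbb R$ with mean $0$, variance $1$ and fourth moment at most $\xi^*$, and $\xi^*\ge 3$ is fixed. For an integer $k\ge1$ and $r>0$ let $W_r^k$ be the set of 1-periodic, $k$ times differentiable functions $f:\mathbb R\to\mathbb R$ with $\sum_{i=0}^k\int_0^1 (f^{(i)}(t))^2dt\le r$. Write $(u,v)_n=\frac1n\sum_{l=1}^n u(x_l)v(x_l)$, $\|u\|_n^2=(u,u)_n$, and for an estimator $\hat S=\hat S(y_1,\dots,y_n)$ $$\mathcal R_n(\hat S,S)=\sup_{p\in\mathcal P_*}\mathbf E_{S,p}\|\hat S-S\|_n^2 .$$ *Assumptions.* $\mathbf H_1)$: for $S\in W_r^k$ the function $g(\cdot,S)$ is square integrable on $[0,1]$ and, with $\varsigma(S)=\int_0^1g^2(x,S)\,dx$,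 $$\lim_{n\to\infty}\sup_{S\in W_r^k}\Big|\frac1n\sum_{j=1}^n g^2(x_j,S)-\varsigma(S)\Big|=0,\qquad \inf_{0\le x\le1}\inf_{S\in W_r^k}g^2(x,S)>0,\qquad \sup_{S\in W_r^k}\varsigma(S)<\infty .$$ Moreover the scales are uniformly bounded: $\sup_{n\ge1}\max_{1\le j\le n}\sup_{S\in W_r^k}\sigma_j^2(S)<\infty$. *Estimator.* Let $[x]$ denote the integer part, $\phi_1=1$ and, for $j\ge2$, $\phi_j(x)=\sqrt2\cos(2\pi[j/2]x)$ for even $j$, $\phi_j(x)=\sqrt2\sin(2\pi[j/2]x)$ for odd $j$. Put $\hat\vartheta_j=\frac1n\sum_{l=1}^n y_l\phi_j(x_l)$ and $\hat S_\lambda=\sum_{j=1}^n\lambda(j)\hat\vartheta_j\phi_j$. For $n\ge3$ let $\varepsilon=1/\ln n$ and let $\Lambda$ be the set of weight vectors $\lambda_{(\beta,t)}$, $\beta\in\{1,\dots,[1/\sqrt\varepsilon]\}$, $t\in\{i\varepsilon:1\le i\le[1/\varepsilon^2]\}$, where $$\lambda_{(\beta,t)}(j)=\mathbf 1_{\{1\le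 j\le j_0\}}+\big(1-(j/\omega)^\beta\big)\mathbf 1_{\{j_0<j\le\omega\}},\quad \omega=(A_\beta\, t\,n)^{1/(2\beta+1)},\quad A_\beta=\frac{(\beta+1)(2\beta+1)}{\pi^{2\beta}\beta},\quad j_0=[\omega/\ln n].$$ Fix $\gamma>0$ and let $\rho=1/(3+(\ln n)^\gamma)$, $l_n=[n^{1/3}+1]$, $\hat\zeta_n=\sum_{j=l_n+1}^n\hat\vartheta_j^2$, $|\lambda|^2=\sum_{j=1}^n\lambda^2(j)$ and $$J_n(\lambda)=\sum_{j=1}^n\lambda^2(j)\hat\vartheta_j^2-2\sum_{j=1}^n\lambda(j)\Big(\hat\vartheta_j^2-\frac{\hat\zeta_n}{n}\Big)+\rho\,\frac{|\lambda|^2\hat\zeta_n}{n}.$$ Let $\hat S_*=\hat S_{\hat\lambda}$, where $\hat\lambda\in\operatorname{argmin}_{\lambda\in\Lambda}J_n(\lambda)$ is chosen measurably (ties being broken arbitrarily). *Conclusion.* With $$\gamma_k(S)=(2k+1)^{1/(2k+1)}\Big(\frac{k}{\pi(k+1)}\Big)^{2k/(2k+1)}r^{1/(2k+1)}\,\varsigma(S)^{2k/(2k+1)}$$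 one has $$\limsup_{n\to\infty}\; n^{2k/(2k+1)}\sup_{S\in W_r^k}\frac{\mathcal R_n(\hat S_*,S)}{\gamma_k(S)}\le 1 .$$ -/

import Mathlib

open MeasureTheory Filter Topology
open scoped NNReal ENNReal

namespace HeteroReg

noncomputable section

/-! ### The function class and the regression model -/

/-- The Sobolev-type class `W_r^k`: the 1-periodic, `k` times differentiable functions `f : ℝ → ℝ`
with `∑_{i=0}^k ‖f^{(i)}‖² ≤ r`, where `‖h‖² = ∫_0^1 h²`. The squared norms are computed in
`[0, ∞]`, so that a derivative which is not square integrable is excluded. -/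
def sobolevClass (k : ℕ) (r : ℝ) : Set (ℝ → ℝ) :=
  {f | Function.Periodic f 1 ∧ (∀ i < k, Differentiable ℝ (iteratedDeriv i f)) ∧
    ∑ i ∈ Finset.range (k + 1),
      ∫⁻ t in Set.Icc (0 : ℝ) 1, ENNReal.ofReal ((iteratedDeriv i f t) ^ 2) ≤ ENNReal.ofReal r}

/-- The space `L_1[0,1]`. -/
abbrev L1 : Type := Lp ℝ 1 (volume : Measure unitInterval)

open Classical in
/-- The element of `L_1[0,1]` given by the restriction of `S` to `[0,1]`
(`0` if the restriction is not integrable, which does not occur on `W_r^k` with `k ≥ 1`). -/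
def toL1 (S : ℝ → ℝ) : L1 :=
  if h : MemLp (fun x : unitInterval => S x) 1 volume then h.toLp _ else 0

lemma memLp_of_mem_sobolevClass {k : ℕ} (hk : 1 ≤ k) {r : ℝ} {S : ℝ → ℝ}
    (hS : S ∈ sobolevClass k r) : MemLp (fun x : unitInterval => S x) 1 volume := by
  have hd : Differentiable ℝ S := by
    have h := hS.2.1 0 (by omega)
    rwa [iteratedDeriv_zero] at h
  have hc : Continuous (fun x : unitInterval => S x) := hd.continuous.comp continuous_subtype_val
  obtain ⟨C, hC⟩ := isCompact_univ.exists_bound_of_continuousOn hc.continuousOn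
  exact MemLp.of_bound hc.aestronglyMeasurable C
    (Filter.Eventually.of_forall fun x => hC x (Set.mem_univ x))

lemma toL1_coeFn {k : ℕ} (hk : 1 ≤ k) {r : ℝ} {S : ℝ → ℝ} (hS : S ∈ sobolevClass k r) :
    (toL1 S : unitInterval → ℝ) =ᵐ[volume] fun x => S x := by
  rw [toL1, dif_pos (memLp_of_mem_sobolevClass hk hS)]
  exact MemLp.coeFn_toLp _

/-- The design point `x_j = j/n`, `1 ≤ j ≤ n`; the index `l : Fin n` stands for `j = l + 1`. -/
def design (n : ℕ) (l : Fin n) : unitInterval :=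
  ⟨((l : ℝ) + 1) / n, by
    have hn : (0 : ℝ) < n := by exact_mod_cast (Nat.zero_le _).trans_lt l.isLt
    have hl : ((l : ℝ) + 1) ≤ n := by exact_mod_cast l.isLt
    exact ⟨by positivity, (div_le_one hn).2 hl⟩⟩

/-- The scale coefficients `σ_j(S) = g(x_j, S)`. -/
def scale (g : unitInterval → L1 → ℝ≥0) (n : ℕ) (S : ℝ → ℝ) (l : Fin n) : ℝ :=
  g (design n l) (toL1 S)

/-- `ς(S) = ∫_0^1 g²(x, S) dx`. -/
def varsigma (g : unitInterval → L1 → ℝ≥0) (S : ℝ → ℝ) : ℝ :=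
  ∫ x : unitInterval, (g x (toL1 S) : ℝ) ^ 2

/-- Condition `H₁` on the scale functional `g`, relative to the class `W_r^k`. -/
structure ConditionH1 (k : ℕ) (r : ℝ) (g : unitInterval → L1 → ℝ≥0) : Prop where
  /-- `g(·, S)` is square integrable. -/
  square_integrable : ∀ S ∈ sobolevClass k r, MemLp (fun x => (g x (toL1 S) : ℝ)) 2 volume
  /-- `sup_{S ∈ W_r^k} |n⁻¹ ∑_j g²(x_j, S) - ς(S)| → 0`. -/
  riemann_sums : TendstoUniformlyOn
    (fun (n : ℕ) (S : ℝ → ℝ) => (n : ℝ)⁻¹ * ∑ l : Fin n, (scale g n S l) ^ 2)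
    (varsigma g) atTop (sobolevClass k r)
  /-- `inf_x inf_{S ∈ W_r^k} g²(x, S) > 0`. -/
  lower_bound : ∃ c : ℝ, 0 < c ∧ ∀ x : unitInterval, ∀ S ∈ sobolevClass k r,
    c ≤ (g x (toL1 S) : ℝ) ^ 2
  /-- `sup_{S ∈ W_r^k} ς(S) < ∞`. -/
  varsigma_bounded : BddAbove (varsigma g '' sobolevClass k r)

/-- The scale coefficients are bounded, uniformly in `n`, `j` and `S ∈ W_r^k`. -/
def BoundedScales (k : ℕ) (r : ℝ) (g : unitInterval → L1 → ℝ≥0) : Prop :=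
  ∃ M : ℝ, ∀ S ∈ sobolevClass k r, ∀ (n : ℕ) (l : Fin n), (scale g n S l) ^ 2 ≤ M

/-! ### Noise distributions and the risk -/

/-- The law with density `p` on the real line. -/
def noiseLaw (p : ℝ → ℝ) : Measure ℝ := volume.withDensity fun x => ENNReal.ofReal (p x)

/-- The family of noise densities: probability densities with mean zero, unit variance and fourth
moment at most `ξs`. -/
structure IsNoiseDensity (ξs : ℝ) (p : ℝ → ℝ) : Prop where
  measurable : Measurable p
  nonneg : ∀ x, 0 ≤ p x
  total_mass : noiseLaw p Set.univ = 1
  centered : ∫ x, x ∂(noiseLaw p) = 0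
  unit_variance : ∫ x, x ^ 2 ∂(noiseLaw p) = 1
  fourth_moment : ∫⁻ x, ENNReal.ofReal (x ^ 4) ∂(noiseLaw p) ≤ ENNReal.ofReal ξs

/-- `P_{S,p}`: the law of the observations `y_j = S(x_j) + σ_j(S) ξ_j`, `1 ≤ j ≤ n`, where the
`ξ_j` are i.i.d. with density `p`. -/
def obsLaw (g : unitInterval → L1 → ℝ≥0) (n : ℕ) (S p : ℝ → ℝ) : Measure (Fin n → ℝ) :=
  (Measure.pi fun _ : Fin n => noiseLaw p).map
    fun ξ l => S (design n l) + scale g n S l * ξ l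

/-- The empirical inner product with the vector `y`, `(y, f)_n = n⁻¹ ∑_l y_l f(x_l)`. -/
def empInner (n : ℕ) (y : Fin n → ℝ) (f : ℝ → ℝ) : ℝ :=
  (n : ℝ)⁻¹ * ∑ l : Fin n, y l * f (design n l)

/-- `‖f‖_n² = n⁻¹ ∑_l f(x_l)²`. -/
def empNormSq (n : ℕ) (f : ℝ → ℝ) : ℝ := (n : ℝ)⁻¹ * ∑ l : Fin n, (f (design n l)) ^ 2

/-- The robust quadratic risk `sup_p E_{S,p} ‖Ŝ - S‖_n²` of an estimator `Ŝ = Shat y`. -/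
def risk (g : unitInterval → L1 → ℝ≥0) (ξs : ℝ) (n : ℕ) (Shat : (Fin n → ℝ) → ℝ → ℝ)
    (S : ℝ → ℝ) : ℝ≥0∞ :=
  ⨆ p : {p : ℝ → ℝ // IsNoiseDensity ξs p},
    ∫⁻ y, ENNReal.ofReal (empNormSq n fun x => Shat y x - S x) ∂(obsLaw g n S p)

/-! ### The adaptive procedure -/

/-- The trigonometric basis `φ_j`, `j ≥ 1`. -/
def trigBasis (j : ℕ) (x : ℝ) : ℝ :=
  if j = 1 then 1
  else if Even j then √2 * Real.cos (2 * Real.pi * ((j / 2 : ℕ) : ℝ) * x)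
  else √2 * Real.sin (2 * Real.pi * ((j / 2 : ℕ) : ℝ) * x)

/-- The empirical Fourier coefficients `ϑ̂_{j,n} = (Y, φ_j)_n`. -/
def coeffHat (n : ℕ) (y : Fin n → ℝ) (j : ℕ) : ℝ := empInner n y (trigBasis j)

/-- The weighted least squares estimator `Ŝ_λ = ∑_{j=1}^n λ(j) ϑ̂_{j,n} φ_j`. -/
def wls (n : ℕ) (lam : ℕ → ℝ) (y : Fin n → ℝ) (x : ℝ) : ℝ :=
  ∑ j ∈ Finset.Icc 1 n, lam j * coeffHat n y j * trigBasis j x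

/-- `ε = 1 / ln n`. -/
def eps (n : ℕ) : ℝ := 1 / Real.log n

/-- `A_β = (β + 1)(2β + 1) / (π^{2β} β)`. -/
def aConst (β : ℕ) : ℝ := ((β : ℝ) + 1) * (2 * β + 1) / (Real.pi ^ (2 * β) * β)

/-- `ω(β, t) = (A_β t n)^{1/(2β+1)}`. -/
def omega (n β : ℕ) (t : ℝ) : ℝ := (aConst β * t * n) ^ (1 / (2 * (β : ℝ) + 1))

/-- `j_0 = [ω(β, t) / ln n]`. -/
def jZero (n β : ℕ) (t : ℝ) : ℕ := ⌊omega n β t / Real.log n⌋₊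

/-- The Pinsker-type weights
`λ_α(j) = 1_{1 ≤ j ≤ j_0} + (1 - (j/ω)^β) 1_{j_0 < j ≤ ω}`, where `α = (β, t)`. -/
def pinskerWeight (n β : ℕ) (t : ℝ) (j : ℕ) : ℝ :=
  (if 1 ≤ j ∧ j ≤ jZero n β t then 1 else 0) +
    (if jZero n β t < j ∧ (j : ℝ) ≤ omega n β t then 1 - ((j : ℝ) / omega n β t) ^ β else 0)

/-- The finite weight family `Λ = {λ_α : α ∈ {1, …, k_*} × {t_1, …, t_m}}`, with
`k_* = [1/√ε]`, `m = [1/ε²]`, `t_i = i ε`. -/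
def weightFamily (n : ℕ) : Set (ℕ → ℝ) :=
  {lam | ∃ β i : ℕ, 1 ≤ β ∧ β ≤ ⌊1 / √(eps n)⌋₊ ∧ 1 ≤ i ∧ i ≤ ⌊1 / (eps n) ^ 2⌋₊ ∧
    lam = pinskerWeight n β (i * eps n)}

/-- `l_n = [n^{1/3} + 1]`. -/
def lInt (n : ℕ) : ℕ := ⌊(n : ℝ) ^ (1 / 3 : ℝ) + 1⌋₊

/-- `ζ̂_n = ∑_{j = l_n + 1}^n ϑ̂_{j,n}²`. -/
def zetaHat (n : ℕ) (y : Fin n → ℝ) : ℝ :=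
  ∑ j ∈ Finset.Icc (lInt n + 1) n, (coeffHat n y j) ^ 2

/-- `ϑ̃_{j,n} = ϑ̂_{j,n}² - ζ̂_n / n`. -/
def coeffTilde (n : ℕ) (y : Fin n → ℝ) (j : ℕ) : ℝ :=
  (coeffHat n y j) ^ 2 - (1 / (n : ℝ)) * zetaHat n y

/-- `|λ|² = ∑_{j=1}^n λ(j)²`. -/
def weightSq (n : ℕ) (lam : ℕ → ℝ) : ℝ := ∑ j ∈ Finset.Icc 1 n, (lam j) ^ 2

/-- `ρ = 1 / (3 + ln^γ n)`. -/
def rho (γ : ℝ) (n : ℕ) : ℝ := 1 / (3 + (Real.log n) ^ γ)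

/-- The penalty `P̂_n(λ) = |λ|² ζ̂_n / n`. -/
def penalty (n : ℕ) (y : Fin n → ℝ) (lam : ℕ → ℝ) : ℝ := weightSq n lam * zetaHat n y / n

/-- The cost `J_n(λ) = ∑_j λ²(j) ϑ̂_{j,n}² - 2 ∑_j λ(j) ϑ̃_{j,n} + ρ P̂_n(λ)`. -/
def cost (γ : ℝ) (n : ℕ) (y : Fin n → ℝ) (lam : ℕ → ℝ) : ℝ :=
  ∑ j ∈ Finset.Icc 1 n, (lam j) ^ 2 * (coeffHat n y j) ^ 2
    - 2 * ∑ j ∈ Finset.Icc 1 n, lam j * coeffTilde n y j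
    + rho γ n * penalty n y lam

/-- `Shat` is the adaptive estimator `Ŝ_* = Ŝ_{λ̂}` with `λ̂ ∈ argmin_{λ ∈ Λ} J_n(λ)`; ties are
broken by an arbitrary measurable rule. -/
def IsAdaptiveEstimator (γ : ℝ) (n : ℕ) (Shat : (Fin n → ℝ) → ℝ → ℝ) : Prop :=
  ∃ lamHat : (Fin n → ℝ) → (ℕ → ℝ), Measurable lamHat ∧
    ∀ y, lamHat y ∈ weightFamily n ∧ (∀ lam ∈ weightFamily n, cost γ n y (lamHat y) ≤ cost γ n y lam) ∧
      Shat y = wls n (lamHat y) y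

/-! ### The Pinsker constant -/

/-- `γ_k(S) = Γ_k^* r^{1/(2k+1)} ς(S)^{2k/(2k+1)}` with
`Γ_k^* = (2k+1)^{1/(2k+1)} (k/(π(k+1)))^{2k/(2k+1)}`. -/
def pinskerConst (k : ℕ) (r : ℝ) (g : unitInterval → L1 → ℝ≥0) (S : ℝ → ℝ) : ℝ :=
  (2 * (k : ℝ) + 1) ^ (1 / (2 * (k : ℝ) + 1)) *
    ((k : ℝ) / (Real.pi * ((k : ℝ) + 1))) ^ (2 * (k : ℝ) / (2 * (k : ℝ) + 1)) *
    r ^ (1 / (2 * (k : ℝ) + 1)) * (varsigma g S) ^ (2 * (k : ℝ) / (2 * (k : ℝ) + 1))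

end

end HeteroReg

open HeteroReg

namespace HeteroReg
noncomputable section

/-! ### The discrete inner product and the trigonometric system on the grid -/

/-! The data-driven weight is compared with one deterministic weight, the Pinsker weight with β = k
and t just below r/ς(S). The risk of that weight is computed sharply, and the price of the selection
is of lower order.

Selection. In sequence form the data are ϑ̂_j = θ_j + η_j, with θ_j the empirical coefficients of S
and η_j those of the noise. Up to the constant ‖S‖_n², the cost J_n(λ) is the loss of Ŝ_λ plus the
penalty, minus twice the sum of four terms: a cross term in θ_j η_j, a centered quadratic form in
the noise, the deviation of Var η_j from its average, and the error of the variance estimator. In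
`oracle_pointwise` the cross term is charged to a small fraction of the two losses and the quadratic
form at the selected weight to the penalty. What remains are squares divided by their own size.
Their means are O(1/n) up to the factor 1/ρ, uniformly in λ (`IsNoiseLaw.integral_cross_sq_le`,
`IsNoiseLaw.integral_quadDev_sq_le`), so the random index is handled by summing over the whole
family, which has at most (ln n)³ members.

Unequal variances cost only O(1/n): the weights decrease and φ_{2m}² + φ_{2m+1}² = 2, so Abel
summation applies (`abs_sum_mul_noiseVar_sub_le`). The variance estimator errs by O(n^{-1/3}) in
mean, which is multiplied by a bandwidth of at most (n ln n)^{1/3}. The total remainder in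
`oracle_inequality` is O((ln n)^{3+γ}/n), negligible against n^{-2k/(2k+1)}. The noise law enters
only through its fourth moment bound, so the estimate is uniform over the densities.

Sharp constant. Integration by parts puts the Fourier coefficients of S in an ellipsoid, and
`biasSq_le` transfers this to the grid with error O(1/n). For bandwidth ω the squared bias is at
most about r(πω)^{-2k}, and the variance at most about (ως/n)·2k²/((k+1)(2k+1)). At ω^{2k+1} = A_k r
n/ς the two stand in ratio 1 : 2k, and their sum is exactly γ_k(S) n^{-2k/(2k+1)} (`bias_main_eq`,
`pinskerConst_eq`). Since ς(S) stays between positive constants, the grid of values t approximates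
r/ς(S) uniformly over the class. All relative errors are collected in `excess k δ`, which tends to 1
as δ → 0. -/

lemma sum_exp_grid {n m : ℕ} (hm : 0 < m) (hmn : m < n) :
    ∑ l : Fin n, Complex.exp (((2 * Real.pi * m * (((l : ℝ) + 1) / n) : ℝ) : ℂ) * Complex.I) = 0 := by
  have hn : n ≠ 0 := by omega
  have hnC : (n : ℂ) ≠ 0 := by exact_mod_cast hn
  have hprim := Complex.isPrimitiveRoot_exp n hn
  set z := Complex.exp (2 * Real.pi * Complex.I / n) with hz
  have hterm : ∀ l : Fin n,
      Complex.exp (((2 * Real.pi * m * (((l : ℝ) + 1) / n) : ℝ) : ℂ) * Complex.I)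
        = z ^ m * (z ^ m) ^ (l : ℕ) := by
    intro l
    rw [← pow_succ', hz, ← Complex.exp_nat_mul, ← Complex.exp_nat_mul]
    congr 1
    push_cast
    field_simp
  simp_rw [hterm]
  rw [← Finset.mul_sum, Fin.sum_univ_eq_sum_range (fun i => (z ^ m) ^ i) n]
  have h1 : z ^ m ≠ 1 := by
    intro h
    have := (hprim.pow_eq_one_iff_dvd m).1 h
    exact absurd (Nat.le_of_dvd hm this) (by omega)
  rw [geom_sum_eq h1, ← pow_mul, mul_comm m n, pow_mul, hprim.pow_eq_one]
  simp

lemma sum_cos_grid {n m : ℕ} (hm : 0 < m) (hmn : m < n) :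
    ∑ l : Fin n, Real.cos (2 * Real.pi * m * (design n l : ℝ)) = 0 := by
  have h := congrArg Complex.re (sum_exp_grid hm hmn)
  rw [Complex.re_sum] at h
  simpa only [Complex.exp_ofReal_mul_I_re, Complex.zero_re, design] using h

lemma sum_sin_grid {n m : ℕ} (hm : 0 < m) (hmn : m < n) :
    ∑ l : Fin n, Real.sin (2 * Real.pi * m * (design n l : ℝ)) = 0 := by
  have h := congrArg Complex.im (sum_exp_grid hm hmn)
  rw [Complex.im_sum] at h
  simpa only [Complex.exp_ofReal_mul_I_im, Complex.zero_im, design] using h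

lemma sum_sin_grid_le {n m : ℕ} (hmn : m < n) :
    ∑ l : Fin n, Real.sin (2 * Real.pi * m * (design n l : ℝ)) = 0 := by
  rcases Nat.eq_zero_or_pos m with rfl | hm
  · simp
  · exact sum_sin_grid hm hmn

lemma trigBasis_one (x : ℝ) : trigBasis 1 x = 1 := by simp [trigBasis]

lemma trigBasis_even {m : ℕ} (x : ℝ) :
    trigBasis (2 * m) x = √2 * Real.cos (2 * Real.pi * m * x) := by
  have h1 : 2 * m ≠ 1 := by omega
  simp [trigBasis, h1]

lemma trigBasis_odd {m : ℕ} (hm : 1 ≤ m) (x : ℝ) :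
    trigBasis (2 * m + 1) x = √2 * Real.sin (2 * Real.pi * m * x) := by
  have h1 : m ≠ 0 := by omega
  have h3 : (2 * m + 1) / 2 = m := by omega
  simp [trigBasis, h1, h3]

lemma index_cases {j : ℕ} (hj : 1 ≤ j) :
    j = 1 ∨ (∃ m, 1 ≤ m ∧ j = 2 * m) ∨ (∃ m, 1 ≤ m ∧ j = 2 * m + 1) := by
  rcases Nat.even_or_odd' j with ⟨m, h | h⟩
  · exact Or.inr (Or.inl ⟨m, by omega, h⟩)
  · rcases Nat.eq_zero_or_pos m with h0 | h0
    · left; omega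
    · exact Or.inr (Or.inr ⟨m, h0, h⟩)

lemma trigBasis_sq_le (j : ℕ) (x : ℝ) : (trigBasis j x) ^ 2 ≤ 2 := by
  unfold trigBasis
  split_ifs
  · norm_num
  · rw [mul_pow, Real.sq_sqrt (by norm_num)]
    nlinarith [Real.cos_sq_le_one (2 * Real.pi * ((j / 2 : ℕ) : ℝ) * x)]
  · rw [mul_pow, Real.sq_sqrt (by norm_num)]
    nlinarith [Real.sin_sq_le_one (2 * Real.pi * ((j / 2 : ℕ) : ℝ) * x)]

lemma two_cos_mul_cos (a b x : ℝ) : (√2 * Real.cos (2 * Real.pi * a * x)) *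
    (√2 * Real.cos (2 * Real.pi * b * x)) =
    Real.cos (2 * Real.pi * (a + b) * x) + Real.cos (2 * Real.pi * (a - b) * x) := by
  rw [show 2 * Real.pi * (a + b) * x = 2 * Real.pi * a * x + 2 * Real.pi * b * x by ring,
    show 2 * Real.pi * (a - b) * x = 2 * Real.pi * a * x - 2 * Real.pi * b * x by ring,
    Real.cos_add, Real.cos_sub]
  have := Real.mul_self_sqrt (show (0 : ℝ) ≤ 2 by norm_num)
  linear_combination (Real.cos (2 * Real.pi * a * x) * Real.cos (2 * Real.pi * b * x)) * this

lemma two_sin_mul_sin (a b x : ℝ) : (√2 * Real.sin (2 * Real.pi * a * x)) *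
    (√2 * Real.sin (2 * Real.pi * b * x)) =
    Real.cos (2 * Real.pi * (a - b) * x) - Real.cos (2 * Real.pi * (a + b) * x) := by
  rw [show 2 * Real.pi * (a + b) * x = 2 * Real.pi * a * x + 2 * Real.pi * b * x by ring,
    show 2 * Real.pi * (a - b) * x = 2 * Real.pi * a * x - 2 * Real.pi * b * x by ring,
    Real.cos_add, Real.cos_sub]
  have := Real.mul_self_sqrt (show (0 : ℝ) ≤ 2 by norm_num)
  linear_combination (Real.sin (2 * Real.pi * a * x) * Real.sin (2 * Real.pi * b * x)) * this

lemma two_cos_mul_sin (a b x : ℝ) : (√2 * Real.cos (2 * Real.pi * a * x)) *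
    (√2 * Real.sin (2 * Real.pi * b * x)) =
    Real.sin (2 * Real.pi * (a + b) * x) - Real.sin (2 * Real.pi * (a - b) * x) := by
  rw [show 2 * Real.pi * (a + b) * x = 2 * Real.pi * a * x + 2 * Real.pi * b * x by ring,
    show 2 * Real.pi * (a - b) * x = 2 * Real.pi * a * x - 2 * Real.pi * b * x by ring,
    Real.sin_add, Real.sin_sub]
  have := Real.mul_self_sqrt (show (0 : ℝ) ≤ 2 by norm_num)
  linear_combination (Real.cos (2 * Real.pi * a * x) * Real.sin (2 * Real.pi * b * x)) * this

/-- `∑_l cos(2π(a-b)x_l) = 0` for distinct frequencies. -/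
lemma sum_cos_sub_grid {n a b : ℕ} (hab : a < b) (hb : b < n) :
    ∑ l : Fin n, Real.cos (2 * Real.pi * ((a : ℝ) - b) * (design n l : ℝ)) = 0 := by
  have := sum_cos_grid (n := n) (m := b - a) (by omega) (by omega)
  rw [← this]
  refine Finset.sum_congr rfl fun l _ => ?_
  rw [← Real.cos_neg, Nat.cast_sub hab.le]
  congr 1; ring

lemma sum_cos_add_grid {n a b : ℕ} (hab : 0 < a + b) (hb : a + b < n) :
    ∑ l : Fin n, Real.cos (2 * Real.pi * ((a : ℝ) + b) * (design n l : ℝ)) = 0 := by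
  have := sum_cos_grid (n := n) (m := a + b) hab hb
  rw [← this]
  push_cast; rfl

lemma sum_sin_add_grid {n a b : ℕ} (hb : a + b < n) :
    ∑ l : Fin n, Real.sin (2 * Real.pi * ((a : ℝ) + b) * (design n l : ℝ)) = 0 := by
  have := sum_sin_grid_le (n := n) (m := a + b) hb
  rw [← this]
  push_cast; rfl

lemma sum_sin_sub_grid {n a b : ℕ} (ha : a < n) (hb : b < n) :
    ∑ l : Fin n, Real.sin (2 * Real.pi * ((a : ℝ) - b) * (design n l : ℝ)) = 0 := by
  rcases le_total a b with h | h
  · have := sum_sin_grid_le (n := n) (m := b - a) (by omega)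
    rw [← neg_eq_zero, ← Finset.sum_neg_distrib, ← this]
    refine Finset.sum_congr rfl fun l _ => ?_
    rw [← Real.sin_neg, Nat.cast_sub h]
    congr 1; ring
  · have := sum_sin_grid_le (n := n) (m := a - b) (by omega)
    rw [← this]
    refine Finset.sum_congr rfl fun l _ => ?_
    rw [Nat.cast_sub h]

/-- The discrete inner product `(u, v)_n = n⁻¹ ∑_l u_l v_l`. -/
def dip (n : ℕ) (u v : Fin n → ℝ) : ℝ := (n : ℝ)⁻¹ * ∑ l, u l * v l

/-- The restriction of `φ_j` to the design points. -/
def phi (n j : ℕ) (l : Fin n) : ℝ := trigBasis j (design n l)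

lemma coeffHat_eq_dip (n : ℕ) (y : Fin n → ℝ) (j : ℕ) : coeffHat n y j = dip n y (phi n j) := rfl

lemma dip_comm (n : ℕ) (u v : Fin n → ℝ) : dip n u v = dip n v u := by
  simp only [dip, mul_comm]

lemma dip_self_nonneg (n : ℕ) (u : Fin n → ℝ) : 0 ≤ dip n u u :=
  mul_nonneg (by positivity) (Finset.sum_nonneg fun l _ => mul_self_nonneg _)

lemma dip_add_left (n : ℕ) (u v w : Fin n → ℝ) : dip n (u + v) w = dip n u w + dip n v w := by
  simp only [dip, Pi.add_apply, add_mul, Finset.sum_add_distrib, mul_add]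

lemma dip_add_right (n : ℕ) (u v w : Fin n → ℝ) : dip n w (u + v) = dip n w u + dip n w v := by
  rw [dip_comm, dip_add_left, dip_comm, dip_comm n v]

lemma dip_smul_left (n : ℕ) (c : ℝ) (u v : Fin n → ℝ) : dip n (c • u) v = c * dip n u v := by
  simp only [dip, Pi.smul_apply, smul_eq_mul, mul_assoc, ← Finset.mul_sum]; ring

lemma dip_smul_right (n : ℕ) (c : ℝ) (u v : Fin n → ℝ) : dip n u (c • v) = c * dip n u v := by
  rw [dip_comm, dip_smul_left, dip_comm]

lemma dip_sub_left (n : ℕ) (u v w : Fin n → ℝ) : dip n (u - v) w = dip n u w - dip n v w := by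
  simp only [dip, Pi.sub_apply, sub_mul, Finset.sum_sub_distrib, mul_sub]

lemma dip_sub_right (n : ℕ) (u v w : Fin n → ℝ) : dip n w (u - v) = dip n w u - dip n w v := by
  rw [dip_comm, dip_sub_left, dip_comm, dip_comm n v]

lemma dip_sum_left {ι : Type*} (n : ℕ) (s : Finset ι) (u : ι → Fin n → ℝ) (v : Fin n → ℝ) :
    dip n (∑ i ∈ s, u i) v = ∑ i ∈ s, dip n (u i) v := by
  simp only [dip, Finset.sum_apply, Finset.sum_mul]
  rw [Finset.sum_comm, Finset.mul_sum]

lemma dip_sum_right {ι : Type*} (n : ℕ) (s : Finset ι) (u : ι → Fin n → ℝ) (v : Fin n → ℝ) :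
    dip n v (∑ i ∈ s, u i) = ∑ i ∈ s, dip n v (u i) := by
  rw [dip_comm, dip_sum_left]
  exact Finset.sum_congr rfl fun i _ => dip_comm _ _ _

/-- Product formulas turn the sum into sums of cosines or sines at the sum and difference of the two
frequencies. Since i < j ≤ n, both stay strictly below n in absolute value, so no aliasing occurs,
even at j = n. -/
lemma dip_phi_phi_of_lt {n i j : ℕ} (hi : 1 ≤ i) (hij : i < j) (hj : j ≤ n) :
    dip n (phi n i) (phi n j) = 0 := by
  unfold dip phi
  refine mul_eq_zero_of_right _ ?_
  rcases index_cases hi with rfl | ⟨a, ha, rfl⟩ | ⟨a, ha, rfl⟩ <;>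
  rcases index_cases (show 1 ≤ j by omega) with rfl | ⟨b, hb, rfl⟩ | ⟨b, hb, rfl⟩
  · omega
  · simp only [trigBasis_one, trigBasis_even, one_mul, ← Finset.mul_sum]
    rw [sum_cos_grid (by omega) (by omega), mul_zero]
  · simp only [trigBasis_one, trigBasis_odd hb, one_mul, ← Finset.mul_sum]
    rw [sum_sin_grid (by omega) (by omega), mul_zero]
  · omega
  · simp only [trigBasis_even, two_cos_mul_cos, Finset.sum_add_distrib]
    rw [sum_cos_add_grid (by omega) (by omega), sum_cos_sub_grid (by omega) (by omega), add_zero]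
  · simp only [trigBasis_even, trigBasis_odd hb, two_cos_mul_sin, Finset.sum_sub_distrib]
    rw [sum_sin_add_grid (by omega), sum_sin_sub_grid (by omega) (by omega), sub_zero]
  · omega
  · simp only [trigBasis_even, trigBasis_odd ha]
    simp_rw [mul_comm (√2 * Real.sin _), two_cos_mul_sin, Finset.sum_sub_distrib]
    rw [sum_sin_add_grid (by omega), sum_sin_sub_grid (by omega) (by omega), sub_zero]
  · simp only [trigBasis_odd ha, trigBasis_odd hb, two_sin_mul_sin, Finset.sum_sub_distrib]
    rw [sum_cos_add_grid (by omega) (by omega), sum_cos_sub_grid (by omega) (by omega), sub_zero]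

lemma dip_phi_phi_of_ne {n i j : ℕ} (hi : i ∈ Finset.Icc 1 n) (hj : j ∈ Finset.Icc 1 n)
    (hij : i ≠ j) : dip n (phi n i) (phi n j) = 0 := by
  rw [Finset.mem_Icc] at hi hj
  rcases lt_or_gt_of_ne hij with h | h
  · exact dip_phi_phi_of_lt hi.1 h hj.2
  · rw [dip_comm]; exact dip_phi_phi_of_lt hj.1 h hi.2

lemma dip_phi_self {n j : ℕ} (hj : 1 ≤ j) (hjn : j < n) : dip n (phi n j) (phi n j) = 1 := by
  have hn : (n : ℝ) ≠ 0 := by exact_mod_cast (show n ≠ 0 by omega)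
  unfold dip phi
  rcases index_cases hj with rfl | ⟨b, hb, rfl⟩ | ⟨b, hb, rfl⟩
  · simp [trigBasis_one, hn]
  · simp only [trigBasis_even, two_cos_mul_cos, Finset.sum_add_distrib]
    rw [sum_cos_add_grid (by omega) (by omega)]
    simp [hn]
  · simp only [trigBasis_odd hb, two_sin_mul_sin, Finset.sum_sub_distrib]
    rw [sum_cos_add_grid (by omega) (by omega)]
    simp [hn]

/-- At j = n exact normalisation can fail: for even n, `phi n n` takes only the values ±√2 and its
squared norm is 2. The factors 2 in the Parseval and Bessel bounds below come from this index. -/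
lemma dip_phi_self_le (n j : ℕ) : dip n (phi n j) (phi n j) ≤ 2 := by
  rcases Nat.eq_zero_or_pos n with rfl | hn
  · simp [dip]
  · have hn' : (0 : ℝ) < n := by exact_mod_cast hn
    unfold dip
    rw [inv_mul_le_iff₀ hn']
    calc ∑ l, phi n j l * phi n j l ≤ ∑ _l : Fin n, (2 : ℝ) :=
          Finset.sum_le_sum fun l _ => by
            have := trigBasis_sq_le j (design n l); unfold phi; nlinarith
      _ = n * 2 := by simp

/-- Parseval's identity for combinations of the `φ_j` on the grid. -/
lemma dip_sum_phi {n : ℕ} {s : Finset ℕ} (hs : s ⊆ Finset.Icc 1 n) (a b : ℕ → ℝ) :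
    dip n (∑ j ∈ s, a j • phi n j) (∑ j ∈ s, b j • phi n j)
      = ∑ j ∈ s, a j * b j * dip n (phi n j) (phi n j) := by
  rw [dip_sum_left]
  refine Finset.sum_congr rfl fun i hi => ?_
  rw [dip_sum_right, Finset.sum_eq_single i]
  · rw [dip_smul_left, dip_smul_right]; ring
  · intro j hj hji
    rw [dip_smul_left, dip_smul_right, dip_phi_phi_of_ne (hs hi) (hs hj) hji.symm]; ring
  · exact fun h => absurd hi h

lemma dip_sum_phi_le {n : ℕ} {s : Finset ℕ} (hs : s ⊆ Finset.Icc 1 n) (a : ℕ → ℝ) :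
    dip n (∑ j ∈ s, a j • phi n j) (∑ j ∈ s, a j • phi n j) ≤ 2 * ∑ j ∈ s, (a j) ^ 2 := by
  rw [dip_sum_phi hs, Finset.mul_sum]
  refine Finset.sum_le_sum fun j _ => ?_
  nlinarith [dip_phi_self_le n j, sq_nonneg (a j)]

/-- Bessel's inequality on the grid. -/
lemma sum_sq_dip_phi_le {n : ℕ} {s : Finset ℕ} (hs : s ⊆ Finset.Icc 1 n) (v : Fin n → ℝ) :
    ∑ j ∈ s, (dip n v (phi n j)) ^ 2 ≤ 2 * dip n v v := by
  set a : ℕ → ℝ := fun j => dip n v (phi n j) with ha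
  set w := ∑ j ∈ s, a j • phi n j with hw
  have h1 : dip n v w = ∑ j ∈ s, (a j) ^ 2 := by
    rw [hw, dip_sum_right]
    refine Finset.sum_congr rfl fun j _ => ?_
    rw [dip_smul_right, sq]
  have h2 : dip n w w ≤ 2 * ∑ j ∈ s, (a j) ^ 2 := dip_sum_phi_le hs a
  -- The coefficient 1/2 matches the constant 2 in `h2`: the square equals ‖v‖² − Σa² + ‖w‖²/4,
  -- which is at most ‖v‖² − Σa²/2.
  have h3 := dip_self_nonneg n (v - (1 / 2 : ℝ) • w)
  rw [dip_sub_left, dip_sub_right, dip_sub_right, dip_smul_left, dip_smul_right, dip_smul_left,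
    dip_smul_right, dip_comm n w v, h1] at h3
  linarith

lemma empNormSq_eq_dip (n : ℕ) (f : ℝ → ℝ) :
    empNormSq n f = dip n (fun l => f (design n l)) (fun l => f (design n l)) := by
  simp [empNormSq, dip, sq]

lemma dip_add_self_le (n : ℕ) (u v : Fin n → ℝ) {δ : ℝ} (hδ : 0 < δ) :
    dip n (u + v) (u + v) ≤ (1 + δ) * dip n u u + (1 + 1 / δ) * dip n v v := by
  have h := dip_self_nonneg n (δ • u - v)
  rw [dip_sub_left, dip_sub_right, dip_sub_right, dip_smul_left, dip_smul_right, dip_smul_left,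
    dip_smul_right, dip_comm n v u] at h
  rw [dip_add_left, dip_add_right, dip_add_right, dip_comm n v u]
  have h2 : 2 * dip n u v ≤ δ * dip n u u + 1 / δ * dip n v v := by
    have : 0 ≤ (1 / δ) * (δ * (δ * dip n u u) - δ * dip n u v - (δ * dip n u v - dip n v v)) :=
      mul_nonneg (by positivity) (by linarith)
    have e : (1 / δ) * (δ * (δ * dip n u u) - δ * dip n u v - (δ * dip n u v - dip n v v))
      = δ * dip n u u - 2 * dip n u v + 1 / δ * dip n v v := by field_simp; ring
    linarith
  linarith

/-! ### Squares of the basis functions and summation by parts. -/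

lemma trigBasis_sq_even {m : ℕ} (x : ℝ) :
    trigBasis (2 * m) x ^ 2 = 1 + Real.cos (2 * Real.pi * (m + m) * x) := by
  rw [trigBasis_even, sq, two_cos_mul_cos]; simp [add_comm]

lemma trigBasis_sq_odd {m : ℕ} (hm : 1 ≤ m) (x : ℝ) :
    trigBasis (2 * m + 1) x ^ 2 = 1 - Real.cos (2 * Real.pi * (m + m) * x) := by
  rw [trigBasis_odd hm, sq, two_sin_mul_sin]; simp

/-- A cosine and the sine of the same frequency have squares adding up to 2, so the terms cancel in
pairs. -/
lemma sum_trigBasis_sq_sub_one_odd (m : ℕ) (x : ℝ) :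
    ∑ j ∈ Finset.Icc 1 (2 * m + 1), (trigBasis j x ^ 2 - 1) = 0 := by
  induction m with
  | zero => simp [trigBasis_one]
  | succ m ih =>
    rw [show 2 * (m + 1) + 1 = (2 * m + 1) + 1 + 1 by ring, Finset.sum_Icc_succ_top (by omega),
      Finset.sum_Icc_succ_top (by omega), ih,
      show 2 * m + 1 + 1 + 1 = 2 * (m + 1) + 1 by ring, show 2 * m + 1 + 1 = 2 * (m + 1) by ring,
      trigBasis_sq_odd (by omega), trigBasis_sq_even]
    ring

/-- The partial sums of `φ_j² - 1` are bounded by one. -/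
lemma abs_sum_trigBasis_sq_sub_one_le (m : ℕ) (x : ℝ) :
    |∑ j ∈ Finset.Icc 1 m, (trigBasis j x ^ 2 - 1)| ≤ 1 := by
  rcases Nat.eq_zero_or_pos m with rfl | hm
  · simp
  rcases index_cases hm with rfl | ⟨a, ha, rfl⟩ | ⟨a, ha, rfl⟩
  · simp [trigBasis_one]
  · obtain ⟨b, rfl⟩ : ∃ b, a = b + 1 := ⟨a - 1, by omega⟩
    rw [show 2 * (b + 1) = 2 * b + 1 + 1 by ring, Finset.sum_Icc_succ_top (by omega),
      sum_trigBasis_sq_sub_one_odd, show 2 * b + 1 + 1 = 2 * (b + 1) by ring, trigBasis_sq_even]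
    simpa using Real.abs_cos_le_one _
  · rw [sum_trigBasis_sq_sub_one_odd]; simp

/-- Abel's inequality. -/
lemma abs_sum_mul_le_of_antitone {n : ℕ} {lam d : ℕ → ℝ} {C : ℝ}
    (hd : ∀ m, |∑ j ∈ Finset.Icc 1 m, d j| ≤ C)
    (hanti : ∀ i j, 1 ≤ i → i ≤ j → lam j ≤ lam i) (hpos : ∀ j, 0 ≤ lam j) :
    |∑ j ∈ Finset.Icc 1 n, lam j * d j| ≤ C * lam 1 := by
  -- Summation by parts. Monotonicity makes the increments nonnegative, and they telescope, so the
  -- bound C on partial sums is multiplied by `lam 1` in total.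
  have key : ∀ n, ∑ j ∈ Finset.Icc 1 n, lam j * d j =
      lam (n + 1) * ∑ j ∈ Finset.Icc 1 n, d j
      + ∑ m ∈ Finset.Icc 1 n, (lam m - lam (m + 1)) * ∑ j ∈ Finset.Icc 1 m, d j := by
    intro n
    induction n with
    | zero => simp
    | succ n ih =>
      rw [Finset.sum_Icc_succ_top (by omega), ih, Finset.sum_Icc_succ_top (by omega),
        Finset.sum_Icc_succ_top (by omega) (fun m => (lam m - lam (m + 1)) * _),
        Finset.sum_Icc_succ_top (by omega)]
      ring
  have tel : ∀ n, ∑ m ∈ Finset.Icc 1 n, (lam m - lam (m + 1)) = lam 1 - lam (n + 1) := by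
    intro n
    induction n with
    | zero => simp
    | succ n ih => rw [Finset.sum_Icc_succ_top (by omega), ih]; ring
  rw [key]
  have h1 : |lam (n + 1) * ∑ j ∈ Finset.Icc 1 n, d j| ≤ lam (n + 1) * C := by
    rw [abs_mul, abs_of_nonneg (hpos _)]
    exact mul_le_mul_of_nonneg_left (hd n) (hpos _)
  have h2 : |∑ m ∈ Finset.Icc 1 n, (lam m - lam (m + 1)) * ∑ j ∈ Finset.Icc 1 m, d j|
      ≤ (lam 1 - lam (n + 1)) * C := by
    rw [← tel, Finset.sum_mul]
    refine (Finset.abs_sum_le_sum_abs _ _).trans (Finset.sum_le_sum fun m hm => ?_)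
    have h0 : 0 ≤ lam m - lam (m + 1) :=
      sub_nonneg.2 (hanti m (m + 1) (Finset.mem_Icc.1 hm).1 (by omega))
    rw [abs_mul, abs_of_nonneg h0]
    exact mul_le_mul_of_nonneg_left (hd m) h0
  calc _ ≤ _ := abs_add_le _ _
    _ ≤ lam (n + 1) * C + (lam 1 - lam (n + 1)) * C := add_le_add h1 h2
    _ = C * lam 1 := by ring

/-! ### Moments of linear and quadratic forms in i.i.d. variables -/

/-- A centered law with unit variance and fourth moment at most `ξs`. -/
structure IsNoiseLaw (ξs : ℝ) (μ : Measure ℝ) : Prop where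
  isProb : IsProbabilityMeasure μ
  integrable_four : Integrable (fun x : ℝ => x ^ 4) μ
  centered : ∫ x, x ∂μ = 0
  unit_variance : ∫ x, x ^ 2 ∂μ = 1
  fourth_moment : ∫ x, x ^ 4 ∂μ ≤ ξs

lemma IsNoiseDensity.isNoiseLaw {ξs : ℝ} (hξ : 0 ≤ ξs) {p : ℝ → ℝ} (hp : IsNoiseDensity ξs p) :
    IsNoiseLaw ξs (noiseLaw p) where
  isProb := ⟨hp.total_mass⟩
  integrable_four := by
    refine ⟨(measurable_id.pow_const 4).aestronglyMeasurable, ?_⟩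
    rw [hasFiniteIntegral_iff_ofReal (Eventually.of_forall fun x => by positivity)]
    exact hp.fourth_moment.trans_lt ENNReal.ofReal_lt_top
  centered := hp.centered
  unit_variance := hp.unit_variance
  fourth_moment := by
    rw [integral_eq_lintegral_of_nonneg_ae (f := fun x : ℝ => x ^ 4)
      (Eventually.of_forall fun x => by positivity)
      (measurable_id.pow_const 4).aestronglyMeasurable]
    exact ENNReal.toReal_le_of_le_ofReal hξ hp.fourth_moment

namespace IsNoiseLaw
variable {ξs : ℝ} {μ : Measure ℝ}

lemma integrable_pow (h : IsNoiseLaw ξs μ) {i : ℕ} (hi : i ≤ 4) :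
    Integrable (fun x : ℝ => x ^ i) μ := by
  have := h.isProb
  refine Integrable.mono' ((integrable_const (1 : ℝ)).add h.integrable_four)
    (measurable_id.pow_const i).aestronglyMeasurable (Eventually.of_forall fun x => ?_)
  simp only [Pi.add_apply, Real.norm_eq_abs, abs_pow]
  rcases le_total |x| 1 with hx | hx
  · have h1 : |x| ^ i ≤ 1 := pow_le_one₀ (abs_nonneg x) hx
    have h2 : 0 ≤ x ^ 4 := by positivity
    linarith
  · have h1 : |x| ^ i ≤ |x| ^ 4 := pow_le_pow_right₀ hx hi
    have h2 : |x| ^ 4 = x ^ 4 := by rw [← abs_pow]; exact abs_of_nonneg (by positivity)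
    linarith

lemma integrable_monomial (h : IsNoiseLaw ξs μ) {n : ℕ} (e : Fin n → ℕ) (he : ∀ i, e i ≤ 4) :
    Integrable (fun ξ : Fin n → ℝ => ∏ i, ξ i ^ e i) (Measure.pi fun _ => μ) := by
  have := h.isProb
  exact Integrable.fintype_prod (f := fun i (x : ℝ) => x ^ e i) fun i => h.integrable_pow (he i)

lemma integral_monomial (h : IsNoiseLaw ξs μ) {n : ℕ} (e : Fin n → ℕ) :
    ∫ ξ : Fin n → ℝ, ∏ i, ξ i ^ e i ∂(Measure.pi fun _ => μ) = ∏ i, ∫ x, x ^ e i ∂μ := by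
  have := h.isProb
  exact integral_fintype_prod_eq_prod (fun i (x : ℝ) => x ^ e i)

lemma prod_eq_zero_of_one (h : IsNoiseLaw ξs μ) {n : ℕ} {e : Fin n → ℕ} (i : Fin n)
    (hi : e i = 1) : ∏ i, ∫ x, x ^ e i ∂μ = 0 := by
  refine Finset.prod_eq_zero (Finset.mem_univ i) ?_
  rw [hi]; simpa using h.centered

lemma prod_eq_one_of_even (h : IsNoiseLaw ξs μ) {n : ℕ} {e : Fin n → ℕ}
    (he : ∀ i, e i = 0 ∨ e i = 2) : ∏ i, ∫ x, x ^ e i ∂μ = 1 := by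
  have := h.isProb
  refine Finset.prod_eq_one fun i _ => ?_
  rcases he i with hi | hi
  · simp [hi]
  · rw [hi]; exact h.unit_variance

/-- The exponent vector of `ξ_a ξ_b`. -/
def expTwo {n : ℕ} (a b : Fin n) (i : Fin n) : ℕ := (if i = a then 1 else 0) + (if i = b then 1 else 0)

/-- The exponent vector of `ξ_a ξ_b ξ_c ξ_d`. -/
def expFour {n : ℕ} (a b c d : Fin n) (i : Fin n) : ℕ := expTwo a b i + expTwo c d i

lemma expTwo_le {n : ℕ} (a b i : Fin n) : expTwo a b i ≤ 2 := by
  unfold expTwo; split_ifs <;> omega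

lemma prod_expTwo {n : ℕ} (a b : Fin n) (ξ : Fin n → ℝ) :
    ∏ i, ξ i ^ expTwo a b i = ξ a * ξ b := by
  simp only [expTwo, pow_add, Finset.prod_mul_distrib]
  simp [pow_ite]

lemma prod_expFour {n : ℕ} (a b c d : Fin n) (ξ : Fin n → ℝ) :
    ∏ i, ξ i ^ expFour a b c d i = ξ a * ξ b * (ξ c * ξ d) := by
  simp only [expFour, pow_add, Finset.prod_mul_distrib, prod_expTwo]

lemma integrable_mul (h : IsNoiseLaw ξs μ) {n : ℕ} (a b : Fin n) :
    Integrable (fun ξ : Fin n → ℝ => ξ a * ξ b) (Measure.pi fun _ => μ) := by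
  have := h.integrable_monomial (expTwo a b) fun i => by have := expTwo_le a b i; omega
  simpa only [prod_expTwo] using this

lemma integrable_mul_mul (h : IsNoiseLaw ξs μ) {n : ℕ} (a b c d : Fin n) :
    Integrable (fun ξ : Fin n → ℝ => ξ a * ξ b * (ξ c * ξ d)) (Measure.pi fun _ => μ) := by
  have := h.integrable_monomial (expFour a b c d) fun i => by
    have h1 := expTwo_le a b i
    have h2 := expTwo_le c d i
    unfold expFour; omega
  simpa only [prod_expFour] using this

lemma integrable_coord (h : IsNoiseLaw ξs μ) {n : ℕ} (a : Fin n) :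
    Integrable (fun ξ : Fin n → ℝ => ξ a) (Measure.pi fun _ => μ) := by
  have := h.integrable_monomial (fun i => if i = a then 1 else 0) fun i => by split_ifs <;> omega
  simpa [pow_ite] using this

lemma integral_coord (h : IsNoiseLaw ξs μ) {n : ℕ} (a : Fin n) :
    ∫ ξ : Fin n → ℝ, ξ a ∂(Measure.pi fun _ => μ) = 0 := by
  have := h.integral_monomial (fun i => if i = a then 1 else 0)
  rw [h.prod_eq_zero_of_one a (by simp)] at this
  simpa [pow_ite] using this

/-- The covariance matrix of the noise is the identity. -/
lemma integral_mul (h : IsNoiseLaw ξs μ) {n : ℕ} (a b : Fin n) :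
    ∫ ξ : Fin n → ℝ, ξ a * ξ b ∂(Measure.pi fun _ => μ) = if a = b then 1 else 0 := by
  have := h.integral_monomial (expTwo a b)
  simp only [prod_expTwo] at this
  rw [this]
  split_ifs with hab
  · subst hab
    refine h.prod_eq_one_of_even fun i => ?_
    unfold expTwo; split_ifs <;> simp
  · refine h.prod_eq_zero_of_one a ?_
    simp [expTwo, hab]

/-- Expand E(ξ² − 1)² ≥ 0. The resulting bound 1 ≤ `ξs` absorbs the pairings with value 1 in the
fourth-moment estimates. -/
lemma one_le_fourth (h : IsNoiseLaw ξs μ) : 1 ≤ ∫ x, x ^ 4 ∂μ := by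
  have := h.isProb
  have h1 : 0 ≤ ∫ x, (x ^ 2 - 1) ^ 2 ∂μ := integral_nonneg fun x => sq_nonneg _
  have h2 : ∫ x, (x ^ 2 - 1) ^ 2 ∂μ = ∫ x, x ^ 4 ∂μ - 2 * ∫ x, x ^ 2 ∂μ + 1 := by
    have e : (fun x : ℝ => (x ^ 2 - 1) ^ 2) = fun x => (x ^ 4 - 2 * x ^ 2) + 1 := by
      funext x; ring
    have i2 : Integrable (fun x : ℝ => 2 * x ^ 2) μ :=
      (h.integrable_pow (by norm_num)).const_mul 2
    have i3 : Integrable (fun x : ℝ => x ^ 4 - 2 * x ^ 2) μ := h.integrable_four.sub i2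
    rw [e, integral_add i3 (integrable_const _), integral_sub h.integrable_four i2,
      integral_const_mul]
    simp
  rw [h.unit_variance] at h2
  linarith

/-- By independence the mean factorises, and it vanishes as soon as some index occurs exactly once.
Only the three pairings survive. The pairing a = b, c = d is subtracted, the other two have value 1,
and on the full diagonal the difference Eξ⁴ − 1 is below `ξs`. -/
lemma abs_integral_four_sub_le (h : IsNoiseLaw ξs μ) {n : ℕ} (a b c d : Fin n) :
    |∫ ξ : Fin n → ℝ, ξ a * ξ b * (ξ c * ξ d) ∂(Measure.pi fun _ => μ)
        - (if a = b then 1 else 0) * (if c = d then 1 else 0)|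
      ≤ ξs * ((if c = a then if d = b then 1 else 0 else 0)
          + (if d = a then if c = b then 1 else 0 else 0)) := by
  have hξ : 1 ≤ ξs := h.one_le_fourth.trans h.fourth_moment
  have key := h.integral_monomial (expFour a b c d)
  simp only [prod_expFour] at key
  rw [key]
  have zero : ∀ i, expFour a b c d i = 1 → ∏ i, ∫ x, x ^ expFour a b c d i ∂μ = 0 :=
    fun i hi => h.prod_eq_zero_of_one i hi
  have even : (∀ i, expFour a b c d i = 0 ∨ expFour a b c d i = 2) →
      ∏ i, ∫ x, x ^ expFour a b c d i ∂μ = 1 := fun hi => h.prod_eq_one_of_even hi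
  by_cases hab : a = b
  · subst hab
    by_cases hcd : c = d
    · subst hcd
      by_cases hca : c = a
      · subst hca
        have e : ∏ i, ∫ x, x ^ expFour c c c c i ∂μ = ∫ x, x ^ 4 ∂μ := by
          rw [Finset.prod_eq_single c]
          · simp [expFour, expTwo]
          · intro i _ hi
            have := h.isProb
            simp [expFour, expTwo, hi]
          · simp
        have h1 := h.one_le_fourth
        have h4 := h.fourth_moment
        rw [e]
        simp only [if_true]
        rw [abs_of_nonneg (by linarith)]
        linarith
      · rw [even]
        · simp [hca]
        · intro i
          unfold expFour expTwo
          by_cases h1 : i = a <;> by_cases h2 : i = c <;> simp [h1, h2]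
          · exact absurd (h2.symm.trans h1) hca
          · intro h3; exact absurd h3.symm hca
          · exact hca
    · by_cases hca : c = a
      · subst hca
        rw [zero d]
        · simp [hcd, Ne.symm hcd]
        · simp [expFour, expTwo, Ne.symm hcd]
      · rw [zero c]
        · simp [hcd, hca]
        · simp [expFour, expTwo, hcd, hca]
  · by_cases hcd : c = d
    · subst hcd
      by_cases hca : c = a
      · subst hca
        rw [zero b]
        · simp [hab]
        · simp [expFour, expTwo, Ne.symm hab]
      · rw [zero a]
        · simp [hab, hca]
        · simp [expFour, expTwo, hab, Ne.symm hca]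
    · by_cases hca : c = a
      · subst hca
        by_cases hdb : d = b
        · subst hdb
          rw [even]
          · simp [hcd, Ne.symm hcd, hξ, abs_of_nonneg]
          · intro i
            unfold expFour expTwo
            by_cases h1 : i = c <;> by_cases h2 : i = d <;> simp [h1, h2, hcd, Ne.symm hcd]
        · rw [zero b]
          · simp [hcd, hdb, Ne.symm hcd]
          · simp [expFour, expTwo, Ne.symm hdb, Ne.symm hab]
      · by_cases hda : d = a
        · subst hda
          by_cases hcb : c = b
          · subst hcb
            rw [even]
            · simp [hcd, Ne.symm hcd, hξ, abs_of_nonneg]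
            · intro i
              unfold expFour expTwo
              by_cases h1 : i = c <;> by_cases h2 : i = d <;> simp [h1, h2, hcd, Ne.symm hcd]
          · rw [zero c]
            · simp [hcd, hcb]
            · simp [expFour, expTwo, hcd, hcb]
        · rw [zero a]
          · simp [hab, hca, hda]
          · simp [expFour, expTwo, hab, Ne.symm hca, Ne.symm hda]

/-- Linear forms are square integrable. -/
lemma integrable_linear (h : IsNoiseLaw ξs μ) {n : ℕ} (v : Fin n → ℝ) :
    Integrable (fun ξ : Fin n → ℝ => ∑ a, v a * ξ a) (Measure.pi fun _ => μ) :=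
  integrable_finsetSum _ fun a _ => (h.integrable_coord a).const_mul _

lemma integral_linear (h : IsNoiseLaw ξs μ) {n : ℕ} (v : Fin n → ℝ) :
    ∫ ξ : Fin n → ℝ, ∑ a, v a * ξ a ∂(Measure.pi fun _ => μ) = 0 := by
  rw [integral_finsetSum _ fun a _ => (h.integrable_coord a).const_mul _]
  simp [integral_const_mul, h.integral_coord]

lemma sq_linear_eq {n : ℕ} (v ξ : Fin n → ℝ) :
    (∑ a, v a * ξ a) ^ 2 = ∑ a, ∑ b, v a * v b * (ξ a * ξ b) := by
  rw [sq, Finset.sum_mul_sum]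
  exact Finset.sum_congr rfl fun a _ => Finset.sum_congr rfl fun b _ => by ring

lemma integrable_linear_sq (h : IsNoiseLaw ξs μ) {n : ℕ} (v : Fin n → ℝ) :
    Integrable (fun ξ : Fin n → ℝ => (∑ a, v a * ξ a) ^ 2) (Measure.pi fun _ => μ) := by
  simp_rw [sq_linear_eq]
  exact integrable_finsetSum _ fun a _ => integrable_finsetSum _ fun b _ =>
    (h.integrable_mul a b).const_mul _

lemma integral_linear_sq (h : IsNoiseLaw ξs μ) {n : ℕ} (v : Fin n → ℝ) :
    ∫ ξ : Fin n → ℝ, (∑ a, v a * ξ a) ^ 2 ∂(Measure.pi fun _ => μ) = ∑ a, (v a) ^ 2 := by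
  simp_rw [sq_linear_eq]
  rw [integral_finsetSum _ fun a _ => integrable_finsetSum _ fun b _ =>
    (h.integrable_mul a b).const_mul _]
  refine Finset.sum_congr rfl fun a _ => ?_
  rw [integral_finsetSum _ fun b _ => (h.integrable_mul a b).const_mul _]
  simp only [integral_const_mul, h.integral_mul]
  simp [sq]

/-- The centered quadratic form `∑ A_ab (ξ_a ξ_b - 1_{a = b})`. -/
def quadForm {n : ℕ} (A : Fin n → Fin n → ℝ) (ξ : Fin n → ℝ) : ℝ :=
  ∑ a, ∑ b, A a b * (ξ a * ξ b - if a = b then 1 else 0)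

lemma integrable_centered (h : IsNoiseLaw ξs μ) {n : ℕ} (a b : Fin n) :
    Integrable (fun ξ : Fin n → ℝ => ξ a * ξ b - if a = b then 1 else 0)
      (Measure.pi fun _ => μ) := by
  have := h.isProb
  exact (h.integrable_mul a b).sub (integrable_const _)

lemma integral_centered (h : IsNoiseLaw ξs μ) {n : ℕ} (a b : Fin n) :
    ∫ ξ : Fin n → ℝ, (ξ a * ξ b - if a = b then 1 else 0) ∂(Measure.pi fun _ => μ) = 0 := by
  have := h.isProb
  rw [integral_sub (h.integrable_mul a b) (integrable_const _), h.integral_mul]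
  simp

lemma integrable_quadForm (h : IsNoiseLaw ξs μ) {n : ℕ} (A : Fin n → Fin n → ℝ) :
    Integrable (quadForm A) (Measure.pi fun _ => μ) :=
  integrable_finsetSum _ fun a _ => integrable_finsetSum _ fun b _ =>
    (h.integrable_centered a b).const_mul _

lemma integral_quadForm (h : IsNoiseLaw ξs μ) {n : ℕ} (A : Fin n → Fin n → ℝ) :
    ∫ ξ, quadForm A ξ ∂(Measure.pi fun _ => μ) = 0 := by
  unfold quadForm
  rw [integral_finsetSum _ fun a _ => integrable_finsetSum _ fun b _ =>
    (h.integrable_centered a b).const_mul _]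
  refine Finset.sum_eq_zero fun a _ => ?_
  rw [integral_finsetSum _ fun b _ => (h.integrable_centered a b).const_mul _]
  simp [integral_const_mul, h.integral_centered]

lemma integrable_centered_mul (h : IsNoiseLaw ξs μ) {n : ℕ} (a b c d : Fin n) :
    Integrable (fun ξ : Fin n → ℝ => (ξ a * ξ b - if a = b then 1 else 0) *
      (ξ c * ξ d - if c = d then 1 else 0)) (Measure.pi fun _ => μ) := by
  have := h.isProb
  have := (((h.integrable_mul_mul a b c d).sub
    ((h.integrable_mul a b).const_mul (if c = d then 1 else 0))).sub
    ((h.integrable_mul c d).const_mul (if a = b then 1 else 0))).add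
    (integrable_const ((if a = b then (1 : ℝ) else 0) * (if c = d then 1 else 0)))
  refine this.congr (Eventually.of_forall fun ξ => ?_)
  simp only [Pi.add_apply, Pi.sub_apply]
  ring

/-- Centering both factors removes exactly the product of the two means, so this covariance is the
quantity estimated in `abs_integral_four_sub_le`. -/
lemma abs_integral_centered_mul_le (h : IsNoiseLaw ξs μ) {n : ℕ} (a b c d : Fin n) :
    |∫ ξ : Fin n → ℝ, (ξ a * ξ b - if a = b then 1 else 0) *
      (ξ c * ξ d - if c = d then 1 else 0) ∂(Measure.pi fun _ => μ)|
      ≤ ξs * ((if c = a then if d = b then 1 else 0 else 0)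
          + (if d = a then if c = b then 1 else 0 else 0)) := by
  have := h.isProb
  refine le_trans (le_of_eq ?_) (h.abs_integral_four_sub_le a b c d)
  congr 1
  have e : (fun ξ : Fin n → ℝ => (ξ a * ξ b - if a = b then 1 else 0) *
      (ξ c * ξ d - if c = d then 1 else 0)) = fun ξ => ξ a * ξ b * (ξ c * ξ d)
      - (if c = d then 1 else 0) * (ξ a * ξ b - if a = b then 1 else 0)
      - (if a = b then 1 else 0) * (ξ c * ξ d - if c = d then 1 else 0)
      - (if a = b then (1 : ℝ) else 0) * (if c = d then 1 else 0) := by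
    funext ξ; ring
  have i1 : Integrable (fun ξ : Fin n → ℝ => (if c = d then (1 : ℝ) else 0) *
      (ξ a * ξ b - if a = b then 1 else 0)) (Measure.pi fun _ => μ) :=
    (h.integrable_centered a b).const_mul _
  have i2 : Integrable (fun ξ : Fin n → ℝ => (if a = b then (1 : ℝ) else 0) *
      (ξ c * ξ d - if c = d then 1 else 0)) (Measure.pi fun _ => μ) :=
    (h.integrable_centered c d).const_mul _
  have i3 : Integrable (fun ξ : Fin n → ℝ => ξ a * ξ b * (ξ c * ξ d) -
      (if c = d then (1 : ℝ) else 0) * (ξ a * ξ b - if a = b then 1 else 0))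
      (Measure.pi fun _ => μ) := (h.integrable_mul_mul a b c d).sub i1
  have i4 : Integrable (fun ξ : Fin n → ℝ => ξ a * ξ b * (ξ c * ξ d) -
      (if c = d then (1 : ℝ) else 0) * (ξ a * ξ b - if a = b then 1 else 0) -
      (if a = b then (1 : ℝ) else 0) * (ξ c * ξ d - if c = d then 1 else 0))
      (Measure.pi fun _ => μ) := i3.sub i2
  rw [e, integral_sub i4 (integrable_const _), integral_sub i3 i2,
    integral_sub (h.integrable_mul_mul a b c d) i1,
    integral_const_mul, integral_const_mul, h.integral_centered, h.integral_centered]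
  simp

lemma quadForm_sq_eq {n : ℕ} (A : Fin n → Fin n → ℝ) (ξ : Fin n → ℝ) :
    (quadForm A ξ) ^ 2 = ∑ a, ∑ b, ∑ c, ∑ d, A a b * A c d *
      ((ξ a * ξ b - if a = b then 1 else 0) * (ξ c * ξ d - if c = d then 1 else 0)) := by
  rw [sq, quadForm, Finset.sum_mul]
  refine Finset.sum_congr rfl fun a _ => ?_
  rw [Finset.sum_mul]
  refine Finset.sum_congr rfl fun b _ => ?_
  rw [Finset.mul_sum]
  refine Finset.sum_congr rfl fun c _ => ?_
  rw [Finset.mul_sum]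
  exact Finset.sum_congr rfl fun d _ => by ring

lemma integrable_quadForm_sq (h : IsNoiseLaw ξs μ) {n : ℕ} (A : Fin n → Fin n → ℝ) :
    Integrable (fun ξ => (quadForm A ξ) ^ 2) (Measure.pi fun _ => μ) := by
  simp_rw [quadForm_sq_eq]
  exact integrable_finsetSum _ fun a _ => integrable_finsetSum _ fun b _ =>
    integrable_finsetSum _ fun c _ => integrable_finsetSum _ fun d _ =>
    (h.integrable_centered_mul a b c d).const_mul _

/-- The second moment of a centered quadratic form. -/
lemma integral_quadForm_sq_le (h : IsNoiseLaw ξs μ) {n : ℕ} (A : Fin n → Fin n → ℝ) :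
    ∫ ξ, (quadForm A ξ) ^ 2 ∂(Measure.pi fun _ => μ) ≤ 2 * ξs * ∑ a, ∑ b, (A a b) ^ 2 := by
  have hξ : 1 ≤ ξs := h.one_le_fourth.trans h.fourth_moment
  have e : ∫ ξ, (quadForm A ξ) ^ 2 ∂(Measure.pi fun _ => μ) = ∑ a, ∑ b, ∑ c, ∑ d, A a b * A c d *
      ∫ ξ : Fin n → ℝ, ((ξ a * ξ b - if a = b then 1 else 0) *
        (ξ c * ξ d - if c = d then 1 else 0)) ∂(Measure.pi fun _ => μ) := by
    simp_rw [quadForm_sq_eq]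
    rw [integral_finsetSum _ fun a _ => integrable_finsetSum _ fun b _ =>
      integrable_finsetSum _ fun c _ => integrable_finsetSum _ fun d _ =>
      (h.integrable_centered_mul a b c d).const_mul _]
    refine Finset.sum_congr rfl fun a _ => ?_
    rw [integral_finsetSum _ fun b _ =>
      integrable_finsetSum _ fun c _ => integrable_finsetSum _ fun d _ =>
      (h.integrable_centered_mul a b c d).const_mul _]
    refine Finset.sum_congr rfl fun b _ => ?_
    rw [integral_finsetSum _ fun c _ => integrable_finsetSum _ fun d _ =>
      (h.integrable_centered_mul a b c d).const_mul _]
    refine Finset.sum_congr rfl fun c _ => ?_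
    rw [integral_finsetSum _ fun d _ => (h.integrable_centered_mul a b c d).const_mul _]
    exact Finset.sum_congr rfl fun d _ => integral_const_mul _ _
  rw [e]
  have bound : ∀ a b c d, A a b * A c d *
      ∫ ξ : Fin n → ℝ, ((ξ a * ξ b - if a = b then 1 else 0) *
        (ξ c * ξ d - if c = d then 1 else 0)) ∂(Measure.pi fun _ => μ)
      ≤ ((if c = a then if d = b then ξs * |A a b * A c d| else 0 else 0)
          + (if d = a then if c = b then ξs * |A a b * A c d| else 0 else 0)) := by
    intro a b c d
    refine (le_abs_self _).trans ?_
    rw [abs_mul]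
    refine (mul_le_mul_of_nonneg_left (h.abs_integral_centered_mul_le a b c d)
      (abs_nonneg _)).trans (le_of_eq ?_)
    split_ifs <;> ring
  calc _ ≤ ∑ a, ∑ b, ∑ c, ∑ d,
          ((if c = a then if d = b then ξs * |A a b * A c d| else 0 else 0)
          + (if d = a then if c = b then ξs * |A a b * A c d| else 0 else 0)) :=
        Finset.sum_le_sum fun a _ => Finset.sum_le_sum fun b _ => Finset.sum_le_sum fun c _ =>
          Finset.sum_le_sum fun d _ => bound a b c d
    _ = ∑ a, ∑ b, (ξs * |A a b * A a b| + ξs * |A a b * A b a|) := by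
        refine Finset.sum_congr rfl fun a _ => Finset.sum_congr rfl fun b _ => ?_
        simp only [Finset.sum_add_distrib]
        congr 1
        · rw [Finset.sum_eq_single a (by intro c _ hc; simp [hc]) (by simp),
            Finset.sum_eq_single b (by intro c _ hc; simp [hc]) (by simp)]
          simp
        · rw [Finset.sum_eq_single b (by intro c _ hc; simp [hc]) (by simp),
            Finset.sum_eq_single a (by intro c _ hc; simp [hc]) (by simp)]
          simp
    -- No symmetry of `A` is assumed: |A_ab A_ba| is at most half the sum of the squares, and
    -- exchanging a and b afterwards gives 3/2 + 1/2 = 2.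
    _ ≤ ∑ a, ∑ b, (ξs * (3 / 2 * (A a b) ^ 2 + 1 / 2 * (A b a) ^ 2)) := by
        refine Finset.sum_le_sum fun a _ => Finset.sum_le_sum fun b _ => ?_
        rw [← mul_add]
        refine mul_le_mul_of_nonneg_left ?_ (by linarith)
        rw [abs_mul_self, abs_mul]
        nlinarith [sq_nonneg (|A a b| - |A b a|), sq_abs (A a b), sq_abs (A b a)]
    _ = 2 * ξs * ∑ a, ∑ b, (A a b) ^ 2 := by
        simp_rw [mul_add, Finset.sum_add_distrib]
        rw [Finset.sum_comm (f := fun a b => ξs * (1 / 2 * (A b a) ^ 2))]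
        simp_rw [← Finset.mul_sum]
        ring

end IsNoiseLaw

/-! ### Fourier coefficients on the unit interval -/

/-- The trigonometric Fourier coefficients `∫_0^1 f φ_j`. -/
def trigCoeff (f : ℝ → ℝ) (j : ℕ) : ℝ := ∫ x in (0 : ℝ)..1, f x * trigBasis j x

lemma continuous_trigBasis (j : ℕ) : Continuous (trigBasis j) := by
  unfold trigBasis
  by_cases h1 : j = 1
  · simp only [h1, if_true]; fun_prop
  · by_cases h2 : Even j
    · simp only [h1, h2, if_true, if_false]; fun_prop
    · simp only [h1, h2, if_false]; fun_prop

lemma integral_cos_unit {m : ℝ} (hm : m ≠ 0) :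
    ∫ x in (0 : ℝ)..1, Real.cos (2 * Real.pi * m * x) = Real.sin (2 * Real.pi * m) / (2 * Real.pi * m) := by
  have h : 2 * Real.pi * m ≠ 0 := by have := Real.pi_ne_zero; positivity
  rw [intervalIntegral.integral_comp_mul_left _ h, integral_cos]
  simp; field_simp

lemma integral_sin_unit {m : ℝ} (hm : m ≠ 0) :
    ∫ x in (0 : ℝ)..1, Real.sin (2 * Real.pi * m * x)
      = (1 - Real.cos (2 * Real.pi * m)) / (2 * Real.pi * m) := by
  have h : 2 * Real.pi * m ≠ 0 := by have := Real.pi_ne_zero; positivity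
  rw [intervalIntegral.integral_comp_mul_left _ h, integral_sin]
  simp; field_simp

lemma integral_cos_int {m : ℤ} (hm : m ≠ 0) :
    ∫ x in (0 : ℝ)..1, Real.cos (2 * Real.pi * m * x) = 0 := by
  rw [integral_cos_unit (by exact_mod_cast hm)]
  have : Real.sin (2 * Real.pi * m) = 0 := by
    rw [show 2 * Real.pi * (m : ℝ) = ((2 * m : ℤ) : ℝ) * Real.pi by push_cast; ring]
    exact Real.sin_int_mul_pi _
  simp [this]

lemma integral_sin_int (m : ℤ) :
    ∫ x in (0 : ℝ)..1, Real.sin (2 * Real.pi * m * x) = 0 := by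
  by_cases hm : m = 0
  · simp [hm]
  rw [integral_sin_unit (by exact_mod_cast hm)]
  have : Real.cos (2 * Real.pi * m) = 1 := by
    rw [show 2 * Real.pi * (m : ℝ) = (m : ℝ) * (2 * Real.pi) by ring]
    exact Real.cos_int_mul_two_pi _
  simp [this]

lemma integral_trigBasis_mul_of_lt {i j : ℕ} (hi : 1 ≤ i) (hij : i < j) :
    ∫ x in (0 : ℝ)..1, trigBasis i x * trigBasis j x = 0 := by
  have C : ∀ z : ℤ, z ≠ 0 → ∫ x in (0 : ℝ)..1, Real.cos (2 * Real.pi * z * x) = 0 :=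
    fun z hz => integral_cos_int hz
  have S := integral_sin_int
  have ic : ∀ c : ℝ, IntervalIntegrable (fun x => Real.cos (2 * Real.pi * c * x)) volume 0 1 :=
    fun c => Continuous.intervalIntegrable (by fun_prop) _ _
  have is : ∀ c : ℝ, IntervalIntegrable (fun x => Real.sin (2 * Real.pi * c * x)) volume 0 1 :=
    fun c => Continuous.intervalIntegrable (by fun_prop) _ _
  rcases index_cases hi with rfl | ⟨a, ha, rfl⟩ | ⟨a, ha, rfl⟩ <;>
  rcases index_cases (show 1 ≤ j by omega) with rfl | ⟨b, hb, rfl⟩ | ⟨b, hb, rfl⟩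
  · omega
  · simp only [trigBasis_one, trigBasis_even, one_mul, intervalIntegral.integral_const_mul]
    have := C b (by omega)
    push_cast at this
    rw [this, mul_zero]
  · simp only [trigBasis_one, trigBasis_odd hb, one_mul, intervalIntegral.integral_const_mul]
    have := S b
    push_cast at this
    rw [this, mul_zero]
  · omega
  · simp only [trigBasis_even, two_cos_mul_cos]
    rw [intervalIntegral.integral_add (ic _) (ic _)]
    have h1 := C (a + b) (by omega)
    have h2 := C (a - b) (by omega)
    push_cast at h1 h2
    rw [h1, h2, add_zero]
  · simp only [trigBasis_even, trigBasis_odd hb, two_cos_mul_sin]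
    rw [intervalIntegral.integral_sub (is _) (is _)]
    have h1 := S (a + b)
    have h2 := S (a - b)
    push_cast at h1 h2
    rw [h1, h2, sub_zero]
  · omega
  · simp only [trigBasis_even, trigBasis_odd ha]
    simp_rw [mul_comm (√2 * Real.sin _), two_cos_mul_sin]
    rw [intervalIntegral.integral_sub (is _) (is _)]
    have h1 := S (b + a)
    have h2 := S (b - a)
    push_cast at h1 h2
    rw [h1, h2, sub_zero]
  · simp only [trigBasis_odd ha, trigBasis_odd hb, two_sin_mul_sin]
    rw [intervalIntegral.integral_sub (ic _) (ic _)]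
    have h1 := C (a + b) (by omega)
    have h2 := C (a - b) (by omega)
    push_cast at h1 h2
    rw [h1, h2, sub_zero]

lemma integral_trigBasis_self {j : ℕ} (hj : 1 ≤ j) :
    ∫ x in (0 : ℝ)..1, trigBasis j x * trigBasis j x = 1 := by
  have ic : ∀ c : ℝ, IntervalIntegrable (fun x => Real.cos (2 * Real.pi * c * x)) volume 0 1 :=
    fun c => Continuous.intervalIntegrable (by fun_prop) _ _
  rcases index_cases hj with rfl | ⟨b, hb, rfl⟩ | ⟨b, hb, rfl⟩
  · simp [trigBasis_one]
  · simp only [trigBasis_even, two_cos_mul_cos]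
    rw [intervalIntegral.integral_add (ic _) (ic _)]
    have h1 := integral_cos_int (m := b + b) (by omega)
    push_cast at h1
    rw [h1]; simp
  · simp only [trigBasis_odd hb, two_sin_mul_sin]
    rw [intervalIntegral.integral_sub (ic _) (ic _)]
    have h1 := integral_cos_int (m := b + b) (by omega)
    push_cast at h1
    rw [h1]; simp

lemma integral_trigBasis_mul {i j : ℕ} (hi : 1 ≤ i) (hj : 1 ≤ j) :
    ∫ x in (0 : ℝ)..1, trigBasis i x * trigBasis j x = if i = j then 1 else 0 := by
  split_ifs with h
  · subst h; exact integral_trigBasis_self hi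
  · rcases lt_or_gt_of_ne h with h | h
    · exact integral_trigBasis_mul_of_lt hi h
    · simp_rw [mul_comm (trigBasis i _)]
      exact integral_trigBasis_mul_of_lt hj h

lemma intervalIntegrable_mul_continuous {f g : ℝ → ℝ} (hf : IntervalIntegrable f volume 0 1)
    (hg : Continuous g) : IntervalIntegrable (fun x => f x * g x) volume 0 1 :=
  hf.mul_continuousOn hg.continuousOn

/-- Bessel's inequality on the unit interval. -/
lemma sum_trigCoeff_sq_le {f : ℝ → ℝ} (hf : IntervalIntegrable f volume 0 1)
    (hf2 : IntervalIntegrable (fun x => f x ^ 2) volume 0 1) {s : Finset ℕ}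
    (hs : ∀ j ∈ s, 1 ≤ j) :
    ∑ j ∈ s, trigCoeff f j ^ 2 ≤ ∫ x in (0 : ℝ)..1, f x ^ 2 := by
  set c := trigCoeff f with hc
  set T : ℝ → ℝ := fun x => ∑ j ∈ s, c j * trigBasis j x with hT
  have hTc : Continuous T :=
    continuous_finsetSum _ fun j _ => (continuous_const.mul (continuous_trigBasis j))
  have h1 : ∫ x in (0 : ℝ)..1, f x * T x = ∑ j ∈ s, c j ^ 2 := by
    simp only [hT, Finset.mul_sum]
    have hi : ∀ j ∈ s, IntervalIntegrable (fun x => f x * (c j * trigBasis j x)) volume 0 1 :=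
      fun j _ => intervalIntegrable_mul_continuous hf
        (continuous_const.mul (continuous_trigBasis j))
    rw [intervalIntegral.integral_finsetSum hi]
    refine Finset.sum_congr rfl fun j _ => ?_
    rw [sq, hc]
    conv_rhs => rw [show trigCoeff f j * trigCoeff f j
      = trigCoeff f j * ∫ x in (0 : ℝ)..1, f x * trigBasis j x from rfl]
    rw [← intervalIntegral.integral_const_mul]
    congr 1; funext x; ring
  have h2 : ∫ x in (0 : ℝ)..1, T x * T x = ∑ j ∈ s, c j ^ 2 := by
    have : ∀ x, T x * T x = ∑ i ∈ s, ∑ j ∈ s, c i * c j * (trigBasis i x * trigBasis j x) := by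
      intro x
      simp only [hT, Finset.sum_mul_sum]
      exact Finset.sum_congr rfl fun i _ => Finset.sum_congr rfl fun j _ => by ring
    simp_rw [this]
    have hcont : ∀ i j, Continuous fun x => c i * c j * (trigBasis i x * trigBasis j x) :=
      fun i j => continuous_const.mul ((continuous_trigBasis i).mul (continuous_trigBasis j))
    rw [intervalIntegral.integral_finsetSum fun i _ => Continuous.intervalIntegrable
      (continuous_finsetSum _ fun j _ => hcont i j) _ _]
    refine Finset.sum_congr rfl fun i hi => ?_
    rw [intervalIntegral.integral_finsetSum fun j _ => (hcont i j).intervalIntegrable _ _]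
    rw [Finset.sum_eq_single i]
    · rw [intervalIntegral.integral_const_mul, integral_trigBasis_mul (hs i hi) (hs i hi)]
      simp [sq]
    · intro j hj hji
      rw [intervalIntegral.integral_const_mul, integral_trigBasis_mul (hs i hi) (hs j hj)]
      simp [hji.symm]
    · exact fun h => absurd hi h
  have h3 : 0 ≤ ∫ x in (0 : ℝ)..1, (f x - T x) ^ 2 :=
    intervalIntegral.integral_nonneg (by norm_num) fun x _ => sq_nonneg _
  have i1 := intervalIntegrable_mul_continuous hf hTc
  have i2 : IntervalIntegrable (fun x => T x * T x) volume 0 1 :=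
    (hTc.mul hTc).intervalIntegrable _ _
  have h4 : ∫ x in (0 : ℝ)..1, (f x - T x) ^ 2
      = (∫ x in (0 : ℝ)..1, f x ^ 2) - 2 * (∫ x in (0 : ℝ)..1, f x * T x)
        + ∫ x in (0 : ℝ)..1, T x * T x := by
    rw [← intervalIntegral.integral_const_mul, ← intervalIntegral.integral_sub hf2 (i1.const_mul 2),
      ← intervalIntegral.integral_add (hf2.sub (i1.const_mul 2)) i2]
    congr 1; funext x; ring
  rw [h4, h1, h2] at h3
  linarith

/-- Periodicity cancels the boundary terms. Only integrability of `f'` is required, so the lemma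
covers the top derivative of a Sobolev function, which need not be continuous. -/
lemma trigCoeff_deriv_aux {f f' φ φ' : ℝ → ℝ} (hper : f 1 = f 0)
    (hφ : φ 1 = φ 0)
    (hf : ∀ x, HasDerivAt f (f' x) x) (hφ' : ∀ x, HasDerivAt φ (φ' x) x) (hc : Continuous φ')
    (hf' : IntervalIntegrable f' volume 0 1) :
    ∫ x in (0 : ℝ)..1, f' x * φ x = - ∫ x in (0 : ℝ)..1, f x * φ' x := by
  have := intervalIntegral.integral_mul_deriv_eq_deriv_mul (a := 0) (b := 1)
    (fun x _ => hf x) (fun x _ => hφ' x) hf' (hc.intervalIntegrable _ _)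
  rw [this, hper, hφ]; ring

/-- Integration by parts for the cosine coefficients. -/
lemma trigCoeff_even_deriv {f f' : ℝ → ℝ} (hper : f 1 = f 0) (hf : ∀ x, HasDerivAt f (f' x) x)
    (hf' : IntervalIntegrable f' volume 0 1) {m : ℕ} (hm : 1 ≤ m) :
    trigCoeff f' (2 * m) = (2 * Real.pi * m) * trigCoeff f (2 * m + 1) := by
  have h := trigCoeff_deriv_aux (φ := fun x => √2 * Real.cos (2 * Real.pi * m * x))
    (φ' := fun x => √2 * (-Real.sin (2 * Real.pi * m * x) * (2 * Real.pi * m))) hper (by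
      have : Real.cos (2 * Real.pi * m * 1) = 1 := by
        rw [show 2 * Real.pi * (m : ℝ) * 1 = (m : ℝ) * (2 * Real.pi) by ring]
        exact Real.cos_nat_mul_two_pi _
      simp only [this]; simp) hf (fun x => by
      have h1 : HasDerivAt (fun x : ℝ => 2 * Real.pi * m * x) (2 * Real.pi * m) x := by
        simpa using (hasDerivAt_id x).const_mul (2 * Real.pi * (m : ℝ))
      exact (h1.cos).const_mul _) (by fun_prop) hf'
  simp only [trigCoeff, trigBasis_even, trigBasis_odd hm]
  rw [h, ← intervalIntegral.integral_neg, ← intervalIntegral.integral_const_mul]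
  congr 1; funext x; ring

/-- Integration by parts for the sine coefficients. -/
lemma trigCoeff_odd_deriv {f f' : ℝ → ℝ} (hper : f 1 = f 0) (hf : ∀ x, HasDerivAt f (f' x) x)
    (hf' : IntervalIntegrable f' volume 0 1) {m : ℕ} (hm : 1 ≤ m) :
    trigCoeff f' (2 * m + 1) = -((2 * Real.pi * m) * trigCoeff f (2 * m)) := by
  have h := trigCoeff_deriv_aux (φ := fun x => √2 * Real.sin (2 * Real.pi * m * x))
    (φ' := fun x => √2 * (Real.cos (2 * Real.pi * m * x) * (2 * Real.pi * m))) hper (by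
      have : Real.sin (2 * Real.pi * m * 1) = 0 := by
        rw [show 2 * Real.pi * (m : ℝ) * 1 = ((2 * m : ℕ) : ℝ) * Real.pi by push_cast; ring]
        exact Real.sin_nat_mul_pi _
      simp only [this]; simp) hf (fun x => by
      have h1 : HasDerivAt (fun x : ℝ => 2 * Real.pi * m * x) (2 * Real.pi * m) x := by
        simpa using (hasDerivAt_id x).const_mul (2 * Real.pi * (m : ℝ))
      exact (h1.sin).const_mul _) (by fun_prop) hf'
  simp only [trigCoeff, trigBasis_even, trigBasis_odd hm]
  rw [h, neg_inj, ← intervalIntegral.integral_const_mul]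
  congr 1; funext x; ring

/-- The energy of `f` at frequency `m`. -/
def pairEnergy (f : ℝ → ℝ) (m : ℕ) : ℝ := trigCoeff f (2 * m) ^ 2 + trigCoeff f (2 * m + 1) ^ 2

/-- Differentiation rotates the cosine–sine pair at frequency m and scales it by 2πm. The single
coefficients get mixed, but the energy of the pair is merely multiplied. -/
lemma pairEnergy_deriv {f f' : ℝ → ℝ} (hper : f 1 = f 0) (hf : ∀ x, HasDerivAt f (f' x) x)
    (hf' : IntervalIntegrable f' volume 0 1) {m : ℕ} (hm : 1 ≤ m) :
    pairEnergy f' m = (2 * Real.pi * m) ^ 2 * pairEnergy f m := by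
  unfold pairEnergy
  rw [trigCoeff_even_deriv hper hf hf' hm, trigCoeff_odd_deriv hper hf hf' hm]
  ring

lemma sum_Icc_pairs (u : ℕ → ℝ) (L : ℕ) :
    ∑ j ∈ Finset.Icc 1 (2 * L + 1), u j = u 1 + ∑ m ∈ Finset.Icc 1 L, (u (2 * m) + u (2 * m + 1)) := by
  induction L with
  | zero => simp
  | succ L ih =>
    rw [show 2 * (L + 1) + 1 = (2 * L + 1) + 1 + 1 by ring, Finset.sum_Icc_succ_top (by omega),
      Finset.sum_Icc_succ_top (by omega), ih, Finset.sum_Icc_succ_top (by omega)]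
    rw [show 2 * L + 1 + 1 + 1 = 2 * (L + 1) + 1 by ring, show 2 * L + 1 + 1 = 2 * (L + 1) by ring]
    ring

lemma sum_Icc_one_eq_sum_range (u : ℕ → ℝ) (L : ℕ) :
    ∑ m ∈ Finset.Icc 1 L, u m = ∑ m ∈ Finset.range L, u (m + 1) := by
  induction L with
  | zero => simp
  | succ L ih => rw [Finset.sum_Icc_succ_top (by omega), Finset.sum_range_succ, ih]

/-! ### The Sobolev class -/

section Sobolev
variable {k : ℕ} {r : ℝ} {S : ℝ → ℝ}

lemma iteratedDeriv_periodic (hS : S ∈ sobolevClass k r) (i : ℕ) :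
    Function.Periodic (iteratedDeriv i S) 1 := by
  intro x
  have : (fun z => S (z + 1)) = S := funext hS.1
  have h := congrFun (iteratedDeriv_comp_add_const i S 1) x
  rw [this] at h
  exact h.symm

lemma hasDerivAt_iteratedDeriv (hS : S ∈ sobolevClass k r) {i : ℕ} (hi : i < k) (x : ℝ) :
    HasDerivAt (iteratedDeriv i S) (iteratedDeriv (i + 1) S x) x := by
  rw [iteratedDeriv_succ]
  exact (hS.2.1 i hi x).hasDerivAt

lemma measurable_iteratedDeriv (hS : S ∈ sobolevClass k r) (hk : 1 ≤ k) (i : ℕ) :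
    Measurable (iteratedDeriv i S) := by
  cases i with
  | zero => exact (hS.2.1 0 (by omega)).continuous.measurable
  | succ i => rw [iteratedDeriv_succ]; exact measurable_deriv _

lemma lintegral_iteratedDeriv_sq_le (hS : S ∈ sobolevClass k r) {i : ℕ} (hi : i ≤ k) :
    ∫⁻ t in Set.Ioc (0 : ℝ) 1, ENNReal.ofReal ((iteratedDeriv i S t) ^ 2) ≤ ENNReal.ofReal r := by
  refine le_trans (lintegral_mono_set Set.Ioc_subset_Icc_self) (le_trans ?_ hS.2.2)
  exact Finset.single_le_sum (f := fun i => ∫⁻ t in Set.Icc (0 : ℝ) 1,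
    ENNReal.ofReal ((iteratedDeriv i S t) ^ 2)) (fun _ _ => zero_le) (Finset.mem_range.2 (by omega))

lemma intervalIntegrable_iteratedDeriv_sq (hS : S ∈ sobolevClass k r) (hk : 1 ≤ k) {i : ℕ}
    (hi : i ≤ k) : IntervalIntegrable (fun x => (iteratedDeriv i S x) ^ 2) volume 0 1 := by
  rw [intervalIntegrable_iff_integrableOn_Ioc_of_le zero_le_one]
  refine ⟨((measurable_iteratedDeriv hS hk i).pow_const 2).aestronglyMeasurable, ?_⟩
  rw [hasFiniteIntegral_iff_ofReal (Eventually.of_forall fun x => by positivity)]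
  exact (lintegral_iteratedDeriv_sq_le hS hi).trans_lt ENNReal.ofReal_lt_top

lemma intervalIntegrable_iteratedDeriv (hS : S ∈ sobolevClass k r) (hk : 1 ≤ k) {i : ℕ}
    (hi : i ≤ k) : IntervalIntegrable (iteratedDeriv i S) volume 0 1 := by
  refine IntervalIntegrable.mono_fun'
    ((intervalIntegrable_const (c := (1 : ℝ))).add (intervalIntegrable_iteratedDeriv_sq hS hk hi))
    (measurable_iteratedDeriv hS hk i).aestronglyMeasurable (Eventually.of_forall fun x => ?_)
  simp only [Real.norm_eq_abs]
  nlinarith [sq_nonneg (|iteratedDeriv i S x| - 1), sq_abs (iteratedDeriv i S x)]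

lemma integral_iteratedDeriv_sq_le (hS : S ∈ sobolevClass k r) (hk : 1 ≤ k) (hr : 0 ≤ r) {i : ℕ}
    (hi : i ≤ k) : ∫ x in (0 : ℝ)..1, (iteratedDeriv i S x) ^ 2 ≤ r := by
  rw [intervalIntegral.integral_of_le zero_le_one,
    integral_eq_lintegral_of_nonneg_ae (Eventually.of_forall fun x => by positivity)
      ((measurable_iteratedDeriv hS hk i).pow_const 2).aestronglyMeasurable]
  exact ENNReal.toReal_le_of_le_ofReal hr (lintegral_iteratedDeriv_sq_le hS hi)

lemma pairEnergy_iteratedDeriv (hS : S ∈ sobolevClass k r) (hk : 1 ≤ k) {i : ℕ} (hi : i ≤ k)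
    {m : ℕ} (hm : 1 ≤ m) :
    pairEnergy (iteratedDeriv i S) m = (2 * Real.pi * m) ^ (2 * i) * pairEnergy S m := by
  induction i with
  | zero => simp
  | succ i ih =>
    rw [pairEnergy_deriv (by simpa using iteratedDeriv_periodic hS i 0)
      (hasDerivAt_iteratedDeriv hS (by omega)) (intervalIntegrable_iteratedDeriv hS hk hi) hm,
      ih (by omega)]
    ring

/-- The ellipsoid condition for the Fourier coefficients of `S ∈ W_r^k`. -/
lemma sum_pow_mul_trigCoeff_sq_le (hS : S ∈ sobolevClass k r) (hk : 1 ≤ k) (hr : 0 ≤ r) {i : ℕ}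
    (hi1 : 1 ≤ i) (hi : i ≤ k) (K : ℕ) :
    ∑ j ∈ Finset.Icc 1 K, (2 * Real.pi * ((j / 2 : ℕ) : ℝ)) ^ (2 * i) * trigCoeff S j ^ 2 ≤ r := by
  -- The range is extended to an odd endpoint, so that every cosine is accompanied by its sine.
  have h0 : ∑ j ∈ Finset.Icc 1 K, (2 * Real.pi * ((j / 2 : ℕ) : ℝ)) ^ (2 * i) * trigCoeff S j ^ 2
      ≤ ∑ j ∈ Finset.Icc 1 (2 * K + 1),
        (2 * Real.pi * ((j / 2 : ℕ) : ℝ)) ^ (2 * i) * trigCoeff S j ^ 2 :=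
    Finset.sum_le_sum_of_subset_of_nonneg (Finset.Icc_subset_Icc_right (by omega))
      fun j _ _ => by positivity
  have h1 : ∑ j ∈ Finset.Icc 1 (2 * K + 1),
        (2 * Real.pi * ((j / 2 : ℕ) : ℝ)) ^ (2 * i) * trigCoeff S j ^ 2
      = ∑ m ∈ Finset.Icc 1 K, pairEnergy (iteratedDeriv i S) m := by
    rw [sum_Icc_pairs]
    -- Here 1 / 2 is natural division, so the constant function has weight 0; this uses i ≥ 1.
    have : (2 * Real.pi * ((1 / 2 : ℕ) : ℝ)) ^ (2 * i) = 0 := by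
      norm_num; omega
    rw [this, zero_mul, zero_add]
    refine Finset.sum_congr rfl fun m hm => ?_
    rw [pairEnergy_iteratedDeriv hS hk hi (Finset.mem_Icc.1 hm).1, pairEnergy,
      show 2 * m / 2 = m by omega, show (2 * m + 1) / 2 = m by omega]
    ring
  have h2 : ∑ m ∈ Finset.Icc 1 K, pairEnergy (iteratedDeriv i S) m
      ≤ ∑ j ∈ Finset.Icc 1 (2 * K + 1), trigCoeff (iteratedDeriv i S) j ^ 2 := by
    rw [sum_Icc_pairs]
    unfold pairEnergy
    linarith [sq_nonneg (trigCoeff (iteratedDeriv i S) 1)]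
  have h3 := sum_trigCoeff_sq_le (intervalIntegrable_iteratedDeriv hS hk hi)
    (intervalIntegrable_iteratedDeriv_sq hS hk hi) (s := Finset.Icc 1 (2 * K + 1))
    fun j hj => (Finset.mem_Icc.1 hj).1
  linarith [integral_iteratedDeriv_sq_le hS hk hr hi]

end Sobolev

/-! ### Uniform convergence of Fourier series -/

/-- The partial sum `∑_{j ≤ K} (∫ f φ_j) φ_j`. -/
def partialSum (f : ℝ → ℝ) (K : ℕ) (x : ℝ) : ℝ := ∑ j ∈ Finset.Icc 1 K, trigCoeff f j * trigBasis j x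

lemma fourierCoeff_ofReal {S : ℝ → ℝ} (hc : Continuous S) (F : AddCircle (1 : ℝ) → ℂ)
    (hF : ∀ x : ℝ, F x = (S x : ℂ)) (m : ℤ) :
    fourierCoeff F m = ((∫ x in (0 : ℝ)..1, S x * Real.cos (2 * Real.pi * m * x) : ℝ) : ℂ)
      - ((∫ x in (0 : ℝ)..1, S x * Real.sin (2 * Real.pi * m * x) : ℝ) : ℂ) * Complex.I := by
  rw [fourierCoeff_eq_intervalIntegral F m 0]
  have e : ∀ x : ℝ, @fourier 1 (-m) (x : AddCircle (1 : ℝ)) • F x =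
      ((S x * Real.cos (2 * Real.pi * m * x) : ℝ) : ℂ)
        - ((S x * Real.sin (2 * Real.pi * m * x) : ℝ) : ℂ) * Complex.I := by
    intro x
    rw [hF, fourier_coe_apply, smul_eq_mul]
    rw [show 2 * (Real.pi : ℂ) * Complex.I * ((-m : ℤ) : ℂ) * (x : ℂ) / ((1 : ℝ) : ℂ)
      = ((-(2 * Real.pi * m * x) : ℝ) : ℂ) * Complex.I by push_cast; ring]
    rw [Complex.exp_mul_I, ← Complex.ofReal_cos, ← Complex.ofReal_sin, Real.cos_neg, Real.sin_neg]
    push_cast; ring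
  simp_rw [e]
  rw [intervalIntegral.integral_sub, intervalIntegral.integral_mul_const,
    intervalIntegral.integral_ofReal, intervalIntegral.integral_ofReal]
  · simp
  · exact Continuous.intervalIntegrable (by fun_prop) _ _
  · exact Continuous.intervalIntegrable (by fun_prop) _ _

lemma trigCoeff_mul_trigBasis_pair {S : ℝ → ℝ} {m : ℕ} (hm : 1 ≤ m) (x : ℝ) :
    trigCoeff S (2 * m) * trigBasis (2 * m) x + trigCoeff S (2 * m + 1) * trigBasis (2 * m + 1) x
      = 2 * ((∫ t in (0 : ℝ)..1, S t * Real.cos (2 * Real.pi * m * t)) * Real.cos (2 * Real.pi * m * x)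
        + (∫ t in (0 : ℝ)..1, S t * Real.sin (2 * Real.pi * m * t))
          * Real.sin (2 * Real.pi * m * x)) := by
  have h1 : trigCoeff S (2 * m) = √2 * ∫ t in (0 : ℝ)..1, S t * Real.cos (2 * Real.pi * m * t) := by
    rw [trigCoeff, ← intervalIntegral.integral_const_mul]
    congr 1; funext t; rw [trigBasis_even]; ring
  have h2 : trigCoeff S (2 * m + 1)
      = √2 * ∫ t in (0 : ℝ)..1, S t * Real.sin (2 * Real.pi * m * t) := by
    rw [trigCoeff, ← intervalIntegral.integral_const_mul]
    congr 1; funext t; rw [trigBasis_odd hm]; ring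
  rw [h1, h2, trigBasis_even, trigBasis_odd hm]
  have := Real.mul_self_sqrt (show (0 : ℝ) ≤ 2 by norm_num)
  linear_combination ((∫ t in (0 : ℝ)..1, S t * Real.cos (2 * Real.pi * m * t)) *
    Real.cos (2 * Real.pi * m * x) + (∫ t in (0 : ℝ)..1, S t * Real.sin (2 * Real.pi * m * t))
      * Real.sin (2 * Real.pi * m * x)) * this

lemma pairEnergy_eq {S : ℝ → ℝ} {m : ℕ} (hm : 1 ≤ m) :
    pairEnergy S m = 2 * ((∫ t in (0 : ℝ)..1, S t * Real.cos (2 * Real.pi * m * t)) ^ 2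
        + (∫ t in (0 : ℝ)..1, S t * Real.sin (2 * Real.pi * m * t)) ^ 2) := by
  have h1 : trigCoeff S (2 * m) = √2 * ∫ t in (0 : ℝ)..1, S t * Real.cos (2 * Real.pi * m * t) := by
    rw [trigCoeff, ← intervalIntegral.integral_const_mul]
    congr 1; funext t; rw [trigBasis_even]; ring
  have h2 : trigCoeff S (2 * m + 1)
      = √2 * ∫ t in (0 : ℝ)..1, S t * Real.sin (2 * Real.pi * m * t) := by
    rw [trigCoeff, ← intervalIntegral.integral_const_mul]
    congr 1; funext t; rw [trigBasis_odd hm]; ring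
  rw [pairEnergy, h1, h2, mul_pow, mul_pow, Real.sq_sqrt (by norm_num)]
  ring

/-- Pointwise convergence of the Fourier series of a Sobolev function. -/
lemma tendsto_partialSum {k : ℕ} {r : ℝ} {S : ℝ → ℝ} (hS : S ∈ sobolevClass k r) (hk : 1 ≤ k)
    (hr : 0 ≤ r) (x : ℝ) :
    Tendsto (fun L : ℕ => partialSum S (2 * L + 1) x) atTop (𝓝 (S x)) := by
  have hSc : Continuous S := (hS.2.1 0 (by omega)).continuous
  set A : ℤ → ℝ := fun m => ∫ t in (0 : ℝ)..1, S t * Real.cos (2 * Real.pi * m * t) with hA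
  set B : ℤ → ℝ := fun m => ∫ t in (0 : ℝ)..1, S t * Real.sin (2 * Real.pi * m * t) with hB
  have hAneg : ∀ m, A (-m) = A m := fun m => by
    simp only [hA]; congr 1; funext t
    rw [← Real.cos_neg]; congr 2; push_cast; ring
  have hBneg : ∀ m, B (-m) = - B m := fun m => by
    simp only [hB]; rw [← intervalIntegral.integral_neg]; congr 1; funext t
    rw [← mul_neg, ← Real.sin_neg]; congr 2; push_cast; ring
  have hcont : Continuous (fun x : ℝ => (S x : ℂ)) := Complex.continuous_ofReal.comp hSc
  have hper : Function.Periodic (fun x : ℝ => (S x : ℂ)) 1 := fun x => by simp [hS.1 x]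
  let F : C(AddCircle (1 : ℝ), ℂ) := ⟨hper.lift, by
    exact isQuotientMap_quotient_mk'.continuous_iff.2 hcont⟩
  have hF : ∀ x : ℝ, F x = (S x : ℂ) := fun x => hper.lift_coe x
  have hcoef : ∀ m, fourierCoeff F m = (A m : ℂ) - (B m : ℂ) * Complex.I :=
    fun m => fourierCoeff_ofReal hSc F hF m
  have hnorm : ∀ m, ‖fourierCoeff F m‖ ^ 2 = A m ^ 2 + B m ^ 2 := fun m => by
    rw [hcoef, Complex.sq_norm, Complex.normSq_apply]; simp; ring
  -- summability of the coefficients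
  have hE : Summable fun m : ℕ => ((m : ℝ) + 1) ^ 2 * (A (m + 1 : ℕ) ^ 2 + B (m + 1 : ℕ) ^ 2) := by
    refine summable_of_sum_range_le (c := r) (fun m => by positivity) fun L => ?_
    have h1 := sum_pow_mul_trigCoeff_sq_le hS hk hr (i := 1) le_rfl hk (2 * L + 1)
    rw [sum_Icc_pairs] at h1
    have h2 : ∑ m ∈ Finset.Icc 1 L, ((2 * Real.pi * ((2 * m / 2 : ℕ) : ℝ)) ^ (2 * 1) *
        trigCoeff S (2 * m) ^ 2 + (2 * Real.pi * (((2 * m + 1) / 2 : ℕ) : ℝ)) ^ (2 * 1) *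
        trigCoeff S (2 * m + 1) ^ 2) =
        ∑ m ∈ Finset.Icc 1 L, (2 * Real.pi * m) ^ 2 * pairEnergy S m := by
      refine Finset.sum_congr rfl fun m hm => ?_
      rw [show 2 * m / 2 = m by omega, show (2 * m + 1) / 2 = m by omega, pairEnergy]; ring
    rw [h2] at h1
    have h3 : ∑ m ∈ Finset.range L, ((m : ℝ) + 1) ^ 2 * (A (m + 1 : ℕ) ^ 2 + B (m + 1 : ℕ) ^ 2)
        = ∑ m ∈ Finset.Icc 1 L, (m : ℝ) ^ 2 * (A m ^ 2 + B m ^ 2) := by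
      rw [sum_Icc_one_eq_sum_range]
      refine Finset.sum_congr rfl fun m _ => ?_
      push_cast; rfl
    have h4 : ∑ m ∈ Finset.Icc 1 L, (m : ℝ) ^ 2 * (A m ^ 2 + B m ^ 2)
        ≤ ∑ m ∈ Finset.Icc 1 L, (2 * Real.pi * m) ^ 2 * pairEnergy S m := by
      refine Finset.sum_le_sum fun m hm => ?_
      have e : pairEnergy S m = 2 * (A m ^ 2 + B m ^ 2) := by
        rw [pairEnergy_eq (Finset.mem_Icc.1 hm).1]; simp [hA, hB]
      rw [e]
      have h5 : 0 ≤ (m : ℝ) ^ 2 * (A m ^ 2 + B m ^ 2) := by positivity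
      have h6 : 1 ≤ Real.pi ^ 2 := by nlinarith [Real.pi_gt_three]
      nlinarith
    have h7 : 0 ≤ (2 * Real.pi * ((1 / 2 : ℕ) : ℝ)) ^ (2 * 1) * trigCoeff S 1 ^ 2 := by positivity
    rw [h3]; linarith
  -- With z the norm of the coefficient at m + 1, 2z ≤ (m+1)²z² + (m+1)⁻². A square integrable first
  -- derivative therefore gives absolute summability.
  have hpos : Summable fun m : ℕ => ‖fourierCoeff F (m + 1 : ℕ)‖ := by
    have h2 : Summable fun m : ℕ => 1 / ((m : ℝ) + 1) ^ 2 := by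
      have := (summable_nat_add_iff 1).2 (Real.summable_one_div_nat_pow.2 (show 1 < 2 by norm_num))
      simpa using this
    refine Summable.of_nonneg_of_le (fun m => norm_nonneg _) (fun m => ?_) (hE.add h2)
    have hm : (0 : ℝ) < (m : ℝ) + 1 := by positivity
    rw [← hnorm]
    set z := ‖fourierCoeff F (m + 1 : ℕ)‖
    have h3 : 0 ≤ (((m : ℝ) + 1) * z - 1 / ((m : ℝ) + 1)) ^ 2 := sq_nonneg _
    have h4 : (((m : ℝ) + 1) * z - 1 / ((m : ℝ) + 1)) ^ 2
      = ((m : ℝ) + 1) ^ 2 * z ^ 2 + 1 / ((m : ℝ) + 1) ^ 2 - 2 * z := by field_simp; ring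
    have h5 : 0 ≤ z := norm_nonneg _
    linarith
  have hsum : Summable (fourierCoeff F) := by
    refine Summable.of_norm ?_
    have hneg : ∀ m, ‖fourierCoeff F (-m)‖ = ‖fourierCoeff F m‖ := fun m => by
      rw [← sq_eq_sq₀ (norm_nonneg _) (norm_nonneg _), hnorm, hnorm, hAneg, hBneg]; ring
    have h1 : Summable fun m : ℕ => ‖fourierCoeff F m‖ := by
      rw [← summable_nat_add_iff 1]; exact_mod_cast hpos
    refine Summable.of_nat_of_neg h1 ?_
    simpa only [hneg] using h1
  have hs := (has_pointwise_sum_fourier_series_of_summable hsum (x : AddCircle (1 : ℝ))).nat_add_neg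
  have hs2 := Complex.hasSum_re hs
  have hterm : ∀ m : ℤ, (fourierCoeff F m • @fourier 1 m (x : AddCircle (1 : ℝ))).re
      = A m * Real.cos (2 * Real.pi * m * x) + B m * Real.sin (2 * Real.pi * m * x) := by
    intro m
    rw [hcoef, fourier_coe_apply, smul_eq_mul]
    rw [show 2 * (Real.pi : ℂ) * Complex.I * (m : ℂ) * (x : ℂ) / ((1 : ℝ) : ℂ)
      = ((2 * Real.pi * m * x : ℝ) : ℂ) * Complex.I by push_cast; ring]
    rw [Complex.exp_mul_I, ← Complex.ofReal_cos, ← Complex.ofReal_sin]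
    simp only [Complex.mul_re, Complex.sub_re, Complex.sub_im, Complex.mul_im, Complex.ofReal_re,
      Complex.ofReal_im, Complex.I_re, Complex.I_im, Complex.add_re, Complex.add_im]
    ring
  have hlim := hs2.tendsto_sum_nat.comp (tendsto_add_atTop_nat 1)
  -- Summing the terms of index m and −m over m ≥ 0 counts frequency 0 twice, hence the extra `A 0`,
  -- which is subtracted afterwards.
  have hval : ((F (x : AddCircle (1 : ℝ))) +
      fourierCoeff F 0 • @fourier 1 0 (x : AddCircle (1 : ℝ))).re = S x + A 0 := by
    rw [Complex.add_re, hF, hterm]; simp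
  rw [hval] at hlim
  have hlim2 := hlim.sub_const (A 0)
  rw [add_sub_cancel_right] at hlim2
  refine hlim2.congr fun L => ?_
  simp only [Function.comp]
  rw [partialSum, sum_Icc_pairs, Finset.sum_range_succ']
  have h0 : trigCoeff S 1 = A 0 := by simp [trigCoeff, trigBasis_one, hA]
  have hre : ∀ m : ℕ, (fourierCoeff F m • @fourier 1 m (x : AddCircle (1 : ℝ)) +
      fourierCoeff F (-m) • @fourier 1 (-m) (x : AddCircle (1 : ℝ))).re
      = 2 * (A m * Real.cos (2 * Real.pi * m * x) + B m * Real.sin (2 * Real.pi * m * x)) := by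
    intro m
    rw [Complex.add_re, hterm, hterm, hAneg, hBneg]
    push_cast
    rw [show 2 * Real.pi * -(m : ℝ) * x = -(2 * Real.pi * m * x) by ring, Real.cos_neg, Real.sin_neg]
    ring
  have hsumeq : ∑ m ∈ Finset.Icc 1 L, (trigCoeff S (2 * m) * trigBasis (2 * m) x +
      trigCoeff S (2 * m + 1) * trigBasis (2 * m + 1) x)
      = ∑ m ∈ Finset.range L, 2 * (A (m + 1 : ℕ) * Real.cos (2 * Real.pi * (m + 1 : ℕ) * x)
        + B (m + 1 : ℕ) * Real.sin (2 * Real.pi * (m + 1 : ℕ) * x)) := by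
    rw [sum_Icc_one_eq_sum_range]
    refine Finset.sum_congr rfl fun m _ => ?_
    rw [trigCoeff_mul_trigBasis_pair (by omega)]
    simp [hA, hB]
  rw [hsumeq, h0, trigBasis_one]
  simp_rw [hre]
  simp
  ring

/-- The worst case is j = 3. Combined with π > 3 this replaces the frequency weight 2π[j/2] by j. -/
lemma three_mul_half_ge {j : ℕ} (hj : 2 ≤ j) : (j : ℝ) ≤ 3 * ((j / 2 : ℕ) : ℝ) := by
  have : j ≤ 3 * (j / 2) := by omega
  exact_mod_cast this

/-- Uniform approximation of a Sobolev function by its Fourier partial sums. -/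
lemma sq_sub_partialSum_le {k : ℕ} {r : ℝ} {S : ℝ → ℝ} (hS : S ∈ sobolevClass k r) (hk : 1 ≤ k)
    (hr : 0 ≤ r) {K : ℕ} (hK : 1 ≤ K) (x : ℝ) :
    (S x - partialSum S K x) ^ 2 ≤ 2 * r / K := by
  have hlim : Tendsto (fun L : ℕ => (partialSum S (2 * L + 1) x - partialSum S K x) ^ 2) atTop
      (𝓝 ((S x - partialSum S K x) ^ 2)) :=
    ((tendsto_partialSum hS hk hr x).sub_const _).pow 2
  refine le_of_tendsto hlim ((eventually_ge_atTop K).mono fun L hL => ?_)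
  have hsplit : partialSum S (2 * L + 1) x - partialSum S K x
      = ∑ j ∈ Finset.Ioc K (2 * L + 1), trigCoeff S j * trigBasis j x := by
    have hd : Finset.Icc 1 (2 * L + 1) = Finset.Icc 1 K ∪ Finset.Ioc K (2 * L + 1) := by
      ext j; simp only [Finset.mem_union, Finset.mem_Icc, Finset.mem_Ioc]; omega
    rw [partialSum, partialSum, hd, Finset.sum_union, add_sub_cancel_left]
    exact Finset.disjoint_left.2 fun j h1 h2 => by
      simp only [Finset.mem_Icc, Finset.mem_Ioc] at h1 h2; omega
  rw [hsplit]
  -- Cauchy–Schwarz with weights j and 1/j: the first factor is at most r by the ellipsoid condition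
  -- for the first derivative, the second at most 2Σ_{j>K} j⁻² ≤ 2/K.
  have hcs := Finset.sum_mul_sq_le_sq_mul_sq (Finset.Ioc K (2 * L + 1))
    (fun j => (j : ℝ) * trigCoeff S j) (fun j => trigBasis j x / j)
  have e : ∑ j ∈ Finset.Ioc K (2 * L + 1), trigCoeff S j * trigBasis j x
      = ∑ j ∈ Finset.Ioc K (2 * L + 1), (j : ℝ) * trigCoeff S j * (trigBasis j x / j) := by
    refine Finset.sum_congr rfl fun j hj => ?_
    have : (j : ℝ) ≠ 0 := by
      have := (Finset.mem_Ioc.1 hj).1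
      exact_mod_cast (show j ≠ 0 by omega)
    field_simp
  rw [e]
  refine hcs.trans ?_
  have h1 : ∑ j ∈ Finset.Ioc K (2 * L + 1), ((j : ℝ) * trigCoeff S j) ^ 2 ≤ r := by
    refine le_trans ?_ (sum_pow_mul_trigCoeff_sq_le hS hk hr (i := 1) le_rfl hk (2 * L + 1))
    refine le_trans (Finset.sum_le_sum fun j hj => ?_)
      (Finset.sum_le_sum_of_subset_of_nonneg (s := Finset.Ioc K (2 * L + 1)) ?_
        fun j _ _ => by positivity)
    · have hj2 : 2 ≤ j := by have := (Finset.mem_Ioc.1 hj).1; omega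
      rw [mul_pow]
      refine mul_le_mul_of_nonneg_right ?_ (sq_nonneg _)
      rw [mul_one]
      have := three_mul_half_ge hj2
      have h3 := Real.pi_gt_three
      refine pow_le_pow_left₀ (by positivity) (this.trans ?_) 2
      exact mul_le_mul_of_nonneg_right (by linarith) (by positivity)
    · intro j hj
      simp only [Finset.mem_Icc, Finset.mem_Ioc] at hj ⊢; omega
  have h2 : ∑ j ∈ Finset.Ioc K (2 * L + 1), (trigBasis j x / j) ^ 2 ≤ 2 / K := by
    have h3 : ∑ j ∈ Finset.Ioc K (2 * L + 1), (trigBasis j x / j) ^ 2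
        ≤ 2 * ∑ j ∈ Finset.Ioc K (2 * L + 1), ((j : ℝ) ^ 2)⁻¹ := by
      rw [Finset.mul_sum]
      refine Finset.sum_le_sum fun j _ => ?_
      rw [div_pow, div_eq_mul_inv]
      exact mul_le_mul_of_nonneg_right (trigBasis_sq_le j x) (by positivity)
    have h4 := sum_Ioc_inv_sq_le_sub (α := ℝ) (k := K) (n := 2 * L + 1) (by omega) (by omega)
    have h5 : (0 : ℝ) ≤ ((2 * L + 1 : ℕ) : ℝ)⁻¹ := by positivity
    have : (2 : ℝ) / K = 2 * (K : ℝ)⁻¹ := div_eq_mul_inv _ _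
    rw [this]; linarith
  calc _ ≤ r * (2 / K) := mul_le_mul h1 h2 (Finset.sum_nonneg fun _ _ => sq_nonneg _) hr
    _ = 2 * r / K := by ring

/-! ### Empirical coefficients of signal and noise -/

/-- The empirical Fourier coefficients of the noise vector `(σ_l ξ_l)`. -/
def noiseCoeff (n : ℕ) (σ ξ : Fin n → ℝ) (j : ℕ) : ℝ := dip n (fun l => σ l * ξ l) (phi n j)

/-- The variance of the noise coefficient of index `j`. -/
def noiseVar (n : ℕ) (σ : Fin n → ℝ) (j : ℕ) : ℝ := ((n : ℝ) ^ 2)⁻¹ * ∑ l, σ l ^ 2 * phi n j l ^ 2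

/-- `n⁻¹ ∑_l σ_l²`. -/
def meanVar (n : ℕ) (σ : Fin n → ℝ) : ℝ := (n : ℝ)⁻¹ * ∑ l, σ l ^ 2

/-- The cross term `∑_j x_j θ_j η_j`. -/
def cross (n : ℕ) (θ η x : ℕ → ℝ) : ℝ := ∑ j ∈ Finset.Icc 1 n, x j * θ j * η j

/-- The energy `∑_j x_j² θ_j²`. -/
def energy (n : ℕ) (θ x : ℕ → ℝ) : ℝ := ∑ j ∈ Finset.Icc 1 n, x j ^ 2 * θ j ^ 2

/-- The centered quadratic term `∑_j λ_j (η_j² - v_j)`. -/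
def quadDev (n : ℕ) (η v lam : ℕ → ℝ) : ℝ := ∑ j ∈ Finset.Icc 1 n, lam j * (η j ^ 2 - v j)

/-- The squared bias of the weighted least squares estimator. -/
def biasSq (n : ℕ) (s : Fin n → ℝ) (lam : ℕ → ℝ) : ℝ :=
  ∑ j ∈ Finset.Icc 1 n, lam j ^ 2 * dip n s (phi n j) ^ 2
    - 2 * ∑ j ∈ Finset.Icc 1 n, lam j * dip n s (phi n j) ^ 2 + dip n s s

lemma energy_nonneg (n : ℕ) (θ x : ℕ → ℝ) : 0 ≤ energy n θ x :=
  Finset.sum_nonneg fun j _ => by positivity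

lemma cross_eq_linear (n : ℕ) (σ ξ : Fin n → ℝ) (θ x : ℕ → ℝ) :
    cross n θ (noiseCoeff n σ ξ) x =
      ∑ a, ((n : ℝ)⁻¹ * σ a * (∑ j ∈ Finset.Icc 1 n, (x j * θ j) • phi n j) a) * ξ a := by
  simp only [cross, noiseCoeff, dip, Finset.sum_apply, Pi.smul_apply, smul_eq_mul, Finset.mul_sum,
    Finset.sum_mul]
  rw [Finset.sum_comm]
  exact Finset.sum_congr rfl fun a _ => Finset.sum_congr rfl fun j _ => by ring

/-- The matrix of the quadratic form `∑_j λ_j η_j²` in the noise variables. -/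
def quadMatrix (n : ℕ) (σ : Fin n → ℝ) (lam : ℕ → ℝ) (a b : Fin n) : ℝ :=
  ((n : ℝ) ^ 2)⁻¹ * (σ a * σ b) * ∑ j ∈ Finset.Icc 1 n, lam j * (phi n j a * phi n j b)

/-- `noiseVar` is the exact mean of η_j² when the ξ_l are uncorrelated with unit variance, so
subtracting it amounts to subtracting the diagonal indicator inside the quadratic form. -/
lemma quadDev_eq_quadForm (n : ℕ) (σ ξ : Fin n → ℝ) (lam : ℕ → ℝ) :
    quadDev n (noiseCoeff n σ ξ) (noiseVar n σ) lam
      = IsNoiseLaw.quadForm (quadMatrix n σ lam) ξ := by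
  have h1 : ∀ j, noiseCoeff n σ ξ j ^ 2 - noiseVar n σ j = ((n : ℝ) ^ 2)⁻¹ * ∑ a, ∑ b,
      (σ a * σ b) * (phi n j a * phi n j b) * (ξ a * ξ b - if a = b then 1 else 0) := by
    intro j
    simp only [mul_sub, Finset.sum_sub_distrib]
    congr 1
    · rw [noiseCoeff, dip, mul_pow, inv_pow, sq (∑ l, _), Finset.sum_mul_sum]
      congr 1
      exact Finset.sum_congr rfl fun a _ => Finset.sum_congr rfl fun b _ => by ring
    · rw [noiseVar]
      congr 1
      refine Finset.sum_congr rfl fun a _ => ?_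
      simp [sq]
  simp only [quadDev, h1, IsNoiseLaw.quadForm, quadMatrix, Finset.mul_sum, Finset.sum_mul]
  rw [Finset.sum_comm]
  refine Finset.sum_congr rfl fun a _ => ?_
  rw [Finset.sum_comm]
  exact Finset.sum_congr rfl fun b _ => Finset.sum_congr rfl fun j _ => by ring

/-- Without the scales this is the Hilbert–Schmidt norm of Σ λ_j φ_j ⊗ φ_j, which grid orthogonality
reduces to Σ λ_j² ‖φ_j‖⁴. The scales contribute M² and the squared norms at most 2 each. -/
lemma sum_quadMatrix_sq_le {n : ℕ} (hn : 0 < n) {σ : Fin n → ℝ} {M : ℝ} (hσ : ∀ l, σ l ^ 2 ≤ M)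
    (lam : ℕ → ℝ) : ∑ a, ∑ b, quadMatrix n σ lam a b ^ 2
      ≤ 4 * M ^ 2 * ((n : ℝ) ^ 2)⁻¹ * ∑ j ∈ Finset.Icc 1 n, lam j ^ 2 := by
  have hn' : (0 : ℝ) < n := by exact_mod_cast hn
  have hM : 0 ≤ M := (sq_nonneg _).trans (hσ ⟨0, hn⟩)
  set K : Fin n → Fin n → ℝ := fun a b => ∑ j ∈ Finset.Icc 1 n, lam j * (phi n j a * phi n j b)
  have hK : ∑ a, ∑ b, K a b ^ 2 ≤ 4 * (n : ℝ) ^ 2 * ∑ j ∈ Finset.Icc 1 n, lam j ^ 2 := by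
    have hrow : ∀ a, ∑ b, K a b ^ 2 = n * ∑ j ∈ Finset.Icc 1 n,
        (lam j * phi n j a) * (lam j * phi n j a) * dip n (phi n j) (phi n j) := by
      intro a
      rw [← dip_sum_phi (Finset.Subset.refl _), dip, ← mul_assoc, mul_inv_cancel₀ hn'.ne', one_mul]
      refine Finset.sum_congr rfl fun b _ => ?_
      simp only [K, Finset.sum_apply, Pi.smul_apply, smul_eq_mul, sq, mul_assoc]
    simp_rw [hrow]
    rw [← Finset.mul_sum, Finset.sum_comm]
    have hcol : ∀ j, ∑ a, (lam j * phi n j a) * (lam j * phi n j a) * dip n (phi n j) (phi n j)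
        = n * (lam j ^ 2 * dip n (phi n j) (phi n j) ^ 2) := by
      intro j
      rw [← Finset.sum_mul]
      have : ∑ a, (lam j * phi n j a) * (lam j * phi n j a)
          = lam j ^ 2 * (n * dip n (phi n j) (phi n j)) := by
        rw [dip, ← mul_assoc (n : ℝ), mul_inv_cancel₀ hn'.ne', one_mul, Finset.mul_sum]
        exact Finset.sum_congr rfl fun a _ => by ring
      rw [this]; ring
    simp_rw [hcol]
    rw [← Finset.mul_sum, ← mul_assoc, ← sq, mul_comm (4 : ℝ), mul_assoc]
    refine mul_le_mul_of_nonneg_left ?_ (by positivity)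
    rw [Finset.mul_sum]
    refine Finset.sum_le_sum fun j _ => ?_
    have h1 := dip_phi_self_le n j
    have h0 := dip_self_nonneg n (phi n j)
    have : dip n (phi n j) (phi n j) ^ 2 ≤ 4 := by nlinarith
    nlinarith [sq_nonneg (lam j)]
  have hb : ∀ a b, quadMatrix n σ lam a b ^ 2 ≤ (((n : ℝ) ^ 2)⁻¹) ^ 2 * M ^ 2 * K a b ^ 2 := by
    intro a b
    rw [quadMatrix, mul_pow, mul_pow]
    refine mul_le_mul_of_nonneg_right (mul_le_mul_of_nonneg_left ?_ (by positivity)) (sq_nonneg _)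
    rw [mul_pow, sq M]
    exact mul_le_mul (hσ a) (hσ b) (sq_nonneg _) hM
  calc _ ≤ ∑ a, ∑ b, (((n : ℝ) ^ 2)⁻¹) ^ 2 * M ^ 2 * K a b ^ 2 :=
        Finset.sum_le_sum fun a _ => Finset.sum_le_sum fun b _ => hb a b
    _ = (((n : ℝ) ^ 2)⁻¹) ^ 2 * M ^ 2 * ∑ a, ∑ b, K a b ^ 2 := by simp only [Finset.mul_sum]
    _ ≤ (((n : ℝ) ^ 2)⁻¹) ^ 2 * M ^ 2 * (4 * (n : ℝ) ^ 2 * ∑ j ∈ Finset.Icc 1 n, lam j ^ 2) :=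
        mul_le_mul_of_nonneg_left hK (by positivity)
    _ = _ := by field_simp

/-! ### Moments of the cross and quadratic noise terms. -/

section Moments
variable {ξs : ℝ} {μ : Measure ℝ} {n : ℕ}

lemma IsNoiseLaw.integrable_cross (h : IsNoiseLaw ξs μ) (σ : Fin n → ℝ) (θ x : ℕ → ℝ) :
    Integrable (fun ξ => cross n θ (noiseCoeff n σ ξ) x) (Measure.pi fun _ => μ) := by
  simp_rw [cross_eq_linear]; exact h.integrable_linear _

lemma IsNoiseLaw.integral_cross (h : IsNoiseLaw ξs μ) (σ : Fin n → ℝ) (θ x : ℕ → ℝ) :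
    ∫ ξ, cross n θ (noiseCoeff n σ ξ) x ∂(Measure.pi fun _ => μ) = 0 := by
  simp_rw [cross_eq_linear]; exact h.integral_linear _

lemma IsNoiseLaw.integrable_cross_sq (h : IsNoiseLaw ξs μ) (σ : Fin n → ℝ) (θ x : ℕ → ℝ) :
    Integrable (fun ξ => cross n θ (noiseCoeff n σ ξ) x ^ 2) (Measure.pi fun _ => μ) := by
  simp_rw [cross_eq_linear]; exact h.integrable_linear_sq _

/-- The bound is proportional to the energy for the same weights, so the squared cross term divided
by that energy has mean O(1/n) whatever the weights are. -/
lemma IsNoiseLaw.integral_cross_sq_le (h : IsNoiseLaw ξs μ) (hn : 0 < n) {σ : Fin n → ℝ} {M : ℝ}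
    (hσ : ∀ l, σ l ^ 2 ≤ M) (θ x : ℕ → ℝ) :
    ∫ ξ, cross n θ (noiseCoeff n σ ξ) x ^ 2 ∂(Measure.pi fun _ => μ)
      ≤ 2 * M / n * energy n θ x := by
  have hn' : (0 : ℝ) < n := by exact_mod_cast hn
  have hM : 0 ≤ M := (sq_nonneg _).trans (hσ ⟨0, hn⟩)
  simp_rw [cross_eq_linear]
  rw [h.integral_linear_sq]
  set H := ∑ j ∈ Finset.Icc 1 n, (x j * θ j) • phi n j
  have h1 : dip n H H ≤ 2 * energy n θ x := by
    refine (dip_sum_phi_le (Finset.Subset.refl _) _).trans (le_of_eq ?_)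
    simp only [energy, mul_pow]
  calc ∑ a, ((n : ℝ)⁻¹ * σ a * H a) ^ 2 ≤ ∑ a, ((n : ℝ)⁻¹) ^ 2 * M * (H a * H a) := by
        refine Finset.sum_le_sum fun a _ => ?_
        rw [mul_pow, mul_pow, sq (H a)]
        exact mul_le_mul_of_nonneg_right (mul_le_mul_of_nonneg_left (hσ a) (by positivity))
          (mul_self_nonneg _)
    _ = M / n * dip n H H := by
        rw [← Finset.mul_sum, dip]; ring
    _ ≤ M / n * (2 * energy n θ x) := mul_le_mul_of_nonneg_left h1 (by positivity)
    _ = _ := by ring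

lemma IsNoiseLaw.integrable_quadDev (h : IsNoiseLaw ξs μ) (σ : Fin n → ℝ) (lam : ℕ → ℝ) :
    Integrable (fun ξ => quadDev n (noiseCoeff n σ ξ) (noiseVar n σ) lam)
      (Measure.pi fun _ => μ) := by
  simp_rw [quadDev_eq_quadForm]; exact h.integrable_quadForm _

lemma IsNoiseLaw.integral_quadDev (h : IsNoiseLaw ξs μ) (σ : Fin n → ℝ) (lam : ℕ → ℝ) :
    ∫ ξ, quadDev n (noiseCoeff n σ ξ) (noiseVar n σ) lam ∂(Measure.pi fun _ => μ) = 0 := by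
  simp_rw [quadDev_eq_quadForm]; exact h.integral_quadForm _

lemma IsNoiseLaw.integrable_quadDev_sq (h : IsNoiseLaw ξs μ) (σ : Fin n → ℝ) (lam : ℕ → ℝ) :
    Integrable (fun ξ => quadDev n (noiseCoeff n σ ξ) (noiseVar n σ) lam ^ 2)
      (Measure.pi fun _ => μ) := by
  simp_rw [quadDev_eq_quadForm]; exact h.integrable_quadForm_sq _

/-- The proportionality to |λ|² is the point: the penalty is proportional to |λ|² as well, so the
ratio formed in the oracle inequality is uniform in λ. -/
lemma IsNoiseLaw.integral_quadDev_sq_le (h : IsNoiseLaw ξs μ) (hn : 0 < n) {σ : Fin n → ℝ} {M : ℝ}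
    (hσ : ∀ l, σ l ^ 2 ≤ M) (lam : ℕ → ℝ) :
    ∫ ξ, quadDev n (noiseCoeff n σ ξ) (noiseVar n σ) lam ^ 2 ∂(Measure.pi fun _ => μ)
      ≤ 8 * ξs * M ^ 2 / (n : ℝ) ^ 2 * ∑ j ∈ Finset.Icc 1 n, lam j ^ 2 := by
  have hξ : 1 ≤ ξs := h.one_le_fourth.trans h.fourth_moment
  simp_rw [quadDev_eq_quadForm]
  refine (h.integral_quadForm_sq_le _).trans ?_
  refine (mul_le_mul_of_nonneg_left (sum_quadMatrix_sq_le hn hσ lam) (by linarith)).trans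
    (le_of_eq ?_)
  ring

end Moments

/-! ### The noise level -/

lemma noiseVar_le {n : ℕ} (hn : 0 < n) {σ : Fin n → ℝ} {M : ℝ} (hσ : ∀ l, σ l ^ 2 ≤ M) (j : ℕ) :
    noiseVar n σ j ≤ 2 * M / n := by
  have hn' : (0 : ℝ) < n := by exact_mod_cast hn
  have hM : 0 ≤ M := (sq_nonneg _).trans (hσ ⟨0, hn⟩)
  have h1 : ∑ l, σ l ^ 2 * phi n j l ^ 2 ≤ n * (M * 2) := by
    calc _ ≤ ∑ _l : Fin n, M * 2 := Finset.sum_le_sum fun l _ =>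
          mul_le_mul (hσ l) (trigBasis_sq_le j _) (sq_nonneg _) hM
      _ = _ := by simp
  calc _ ≤ ((n : ℝ) ^ 2)⁻¹ * (n * (M * 2)) := mul_le_mul_of_nonneg_left h1 (by positivity)
    _ = _ := by field_simp

lemma noiseVar_nonneg (n : ℕ) (σ : Fin n → ℝ) (j : ℕ) : 0 ≤ noiseVar n σ j :=
  mul_nonneg (by positivity) (Finset.sum_nonneg fun l _ => by positivity)

/-- Heteroscedasticity is averaged out by monotone weights. -/
lemma abs_sum_mul_noiseVar_sub_le {n : ℕ} (hn : 0 < n) {σ : Fin n → ℝ} {M : ℝ}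
    (hσ : ∀ l, σ l ^ 2 ≤ M) {lam : ℕ → ℝ} (hanti : ∀ i j, 1 ≤ i → i ≤ j → lam j ≤ lam i)
    (hpos : ∀ j, 0 ≤ lam j) (hle : lam 1 ≤ 1) :
    |∑ j ∈ Finset.Icc 1 n, lam j * (noiseVar n σ j - meanVar n σ / n)| ≤ M / n := by
  have hn' : (0 : ℝ) < n := by exact_mod_cast hn
  -- After exchanging the sums, the weights at each design point are summed against φ_j² − 1.
  -- Partial sums of the latter are bounded by 1, so Abel's inequality gives O(1/n) however many
  -- weights are nonzero.
  have e : ∑ j ∈ Finset.Icc 1 n, lam j * (noiseVar n σ j - meanVar n σ / n)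
      = ((n : ℝ) ^ 2)⁻¹ * ∑ l, σ l ^ 2 *
          ∑ j ∈ Finset.Icc 1 n, lam j * (trigBasis j (design n l) ^ 2 - 1) := by
    have h1 : ∀ j, noiseVar n σ j - meanVar n σ / n
        = ((n : ℝ) ^ 2)⁻¹ * ∑ l, σ l ^ 2 * (trigBasis j (design n l) ^ 2 - 1) := by
      intro j
      simp only [noiseVar, meanVar, phi, mul_sub, Finset.sum_sub_distrib, mul_one]
      congr 1
      rw [sq, mul_inv]; field_simp
    simp only [h1, Finset.mul_sum]
    rw [Finset.sum_comm]
    exact Finset.sum_congr rfl fun l _ => Finset.sum_congr rfl fun j _ => by ring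
  rw [e, abs_mul, abs_of_pos (by positivity : (0 : ℝ) < ((n : ℝ) ^ 2)⁻¹)]
  have h2 : |∑ l, σ l ^ 2 * ∑ j ∈ Finset.Icc 1 n, lam j * (trigBasis j (design n l) ^ 2 - 1)|
      ≤ n * M := by
    calc _ ≤ ∑ l, |σ l ^ 2 * ∑ j ∈ Finset.Icc 1 n, lam j * (trigBasis j (design n l) ^ 2 - 1)| :=
          Finset.abs_sum_le_sum_abs _ _
      _ ≤ ∑ _l : Fin n, M := by
          refine Finset.sum_le_sum fun l _ => ?_
          rw [abs_mul, abs_of_nonneg (sq_nonneg (σ l))]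
          have h3 := abs_sum_mul_le_of_antitone (n := n) (lam := lam)
            (fun m => abs_sum_trigBasis_sq_sub_one_le m (design n l)) hanti hpos
          have h4 := (h3.trans_eq (one_mul _)).trans hle
          have := mul_le_mul (hσ l) h4 (abs_nonneg _) ((sq_nonneg _).trans (hσ l))
          linarith
      _ = n * M := by simp
  calc _ ≤ ((n : ℝ) ^ 2)⁻¹ * (n * M) := mul_le_mul_of_nonneg_left h2 (by positivity)
    _ = M / n := by field_simp

lemma le_meanVar {n : ℕ} (hn : 0 < n) {σ : Fin n → ℝ} {c : ℝ} (hσ : ∀ l, c ≤ σ l ^ 2) :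
    c ≤ meanVar n σ := by
  have hn' : (0 : ℝ) < n := by exact_mod_cast hn
  rw [meanVar, le_inv_mul_iff₀ hn']
  calc (n : ℝ) * c = ∑ _l : Fin n, c := by simp
    _ ≤ _ := Finset.sum_le_sum fun l _ => hσ l

/-! ### The pointwise oracle inequality -/

/-- Young's inequality. The hypothesis `h0` covers D = 0, where the quotient is 0 by convention, so
degenerate denominators need no separate treatment later. -/
lemma two_mul_le_add_div {D a δ : ℝ} (hD : 0 ≤ D) (h0 : D = 0 → a = 0) (hδ : 0 < δ) :
    2 * a ≤ δ * D + a ^ 2 / (δ * D) := by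
  rcases hD.eq_or_lt with h | h
  · rw [h0 h.symm, ← h]; simp
  · have h1 : 0 < δ * D := mul_pos hδ h
    have h2 : 0 ≤ (δ * D - a) ^ 2 / (δ * D) := div_nonneg (sq_nonneg _) h1.le
    have h3 : (δ * D - a) ^ 2 / (δ * D) = δ * D - 2 * a + a ^ 2 / (δ * D) := by
      field_simp; ring
    linarith

lemma mul_eq_zero_of_energy {n : ℕ} {θ x : ℕ → ℝ} (h : energy n θ x = 0) {j : ℕ}
    (hj : j ∈ Finset.Icc 1 n) : x j * θ j = 0 := by
  have := (Finset.sum_eq_zero_iff_of_nonneg (fun j _ => by positivity)).1 h j hj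
  rw [← mul_pow] at this
  exact pow_eq_zero_iff (two_ne_zero) |>.1 this

/-- Here `L1` and `L2` are the losses at the selected and at the comparison weight. The inequality
`hJ` between costs becomes one between losses; the remaining terms are arranged so that each has
mean zero or is a square divided by its natural size. -/
lemma oracle_pointwise {n : ℕ} {θ η v lam mu : ℕ → ℝ} {S2 ζ V ρ δ N c B L1 L2 : ℝ}
    (hn : 0 < n) (hδ : 0 < δ) (hρ : 0 < ρ) (hρ1 : ρ ≤ 1) (hc : 0 < c) (hcV : c ≤ V)
    (hL1 : L1 = ∑ j ∈ Finset.Icc 1 n, lam j ^ 2 * (θ j + η j) ^ 2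
      - 2 * ∑ j ∈ Finset.Icc 1 n, lam j * (θ j + η j) * θ j + S2)
    (hL2 : L2 = ∑ j ∈ Finset.Icc 1 n, mu j ^ 2 * (θ j + η j) ^ 2
      - 2 * ∑ j ∈ Finset.Icc 1 n, mu j * (θ j + η j) * θ j + S2)
    (hx : ∑ j ∈ Finset.Icc 1 n, (lam j - mu j) ^ 2 * (θ j + η j) ^ 2 ≤ 2 * L1 + 2 * L2)
    (hJ : ∑ j ∈ Finset.Icc 1 n, lam j ^ 2 * (θ j + η j) ^ 2
        - 2 * ∑ j ∈ Finset.Icc 1 n, lam j * ((θ j + η j) ^ 2 - 1 / (n : ℝ) * ζ)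
        + ρ * ((∑ j ∈ Finset.Icc 1 n, lam j ^ 2) * ζ / n)
      ≤ ∑ j ∈ Finset.Icc 1 n, mu j ^ 2 * (θ j + η j) ^ 2
        - 2 * ∑ j ∈ Finset.Icc 1 n, mu j * ((θ j + η j) ^ 2 - 1 / (n : ℝ) * ζ)
        + ρ * ((∑ j ∈ Finset.Icc 1 n, mu j ^ 2) * ζ / n))
    (hv1 : |∑ j ∈ Finset.Icc 1 n, lam j * (v j - V / n)| ≤ B)
    (hv2 : |∑ j ∈ Finset.Icc 1 n, mu j * (v j - V / n)| ≤ B)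
    (hN1 : ∑ j ∈ Finset.Icc 1 n, lam j ≤ N) (hN1' : 0 ≤ ∑ j ∈ Finset.Icc 1 n, lam j)
    (hN2 : ∑ j ∈ Finset.Icc 1 n, mu j ≤ N) (hN2' : 0 ≤ ∑ j ∈ Finset.Icc 1 n, mu j)
    (hN3 : ∑ j ∈ Finset.Icc 1 n, lam j ^ 2 ≤ N) (hN4 : ∑ j ∈ Finset.Icc 1 n, mu j ^ 2 ≤ N) :
    (1 - 4 * δ) * L1 ≤ (1 + 4 * δ) * L2 - 2 * quadDev n η v mu
      + ρ * (∑ j ∈ Finset.Icc 1 n, mu j ^ 2) * V / n + 4 * B + 6 * N * |V - ζ| / n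
      + n * quadDev n η v lam ^ 2 / (ρ * (∑ j ∈ Finset.Icc 1 n, lam j ^ 2) * c)
      + cross n θ η (lam - mu) ^ 2 / (δ * energy n θ (lam - mu))
      + 4 * δ * (cross n θ η ((lam - mu) ^ 2) ^ 2 / energy n θ (lam - mu)) := by
  have hn' : (0 : ℝ) < n := by exact_mod_cast hn
  -- The inner product Σ w ϑ̂ θ in the loss is unknown to the statistician; the cost replaces it by
  -- the left side. The last four terms on the right are the error of this replacement.
  have expand : ∀ w : ℕ → ℝ, ∑ j ∈ Finset.Icc 1 n, w j * ((θ j + η j) ^ 2 - 1 / (n : ℝ) * ζ)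
      = ∑ j ∈ Finset.Icc 1 n, w j * (θ j + η j) * θ j + cross n θ η w + quadDev n η v w
        + ∑ j ∈ Finset.Icc 1 n, w j * (v j - V / n)
        + (∑ j ∈ Finset.Icc 1 n, w j) * ((V - ζ) / n) := by
    intro w
    simp only [cross, quadDev, Finset.sum_mul, ← Finset.sum_add_distrib]
    refine Finset.sum_congr rfl fun j _ => ?_
    ring
  have hcr : cross n θ η (lam - mu) = cross n θ η lam - cross n θ η mu := by
    simp only [cross, ← Finset.sum_sub_distrib, Pi.sub_apply]
    exact Finset.sum_congr rfl fun j _ => by ring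
  rw [expand lam, expand mu] at hJ
  set D := energy n θ (lam - mu) with hD
  have hD0 : 0 ≤ D := energy_nonneg _ _ _
  have hz1 : D = 0 → cross n θ η (lam - mu) = 0 := fun h =>
    Finset.sum_eq_zero fun j hj => by rw [mul_eq_zero_of_energy h hj, zero_mul]
  have hz2 : D = 0 → -cross n θ η ((lam - mu) ^ 2) = 0 := fun h => neg_eq_zero.2 <|
    Finset.sum_eq_zero fun j hj => by
      have := mul_eq_zero_of_energy h hj
      rw [Pi.pow_apply, sq, mul_assoc, mul_assoc, ← mul_assoc _ (θ j), this]; ring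
  have b1 := two_mul_le_add_div hD0 hz1 hδ
  have b2 := two_mul_le_add_div hD0 hz2 (show (0 : ℝ) < 1 / 2 by norm_num)
  have hxe : ∑ j ∈ Finset.Icc 1 n, (lam j - mu j) ^ 2 * (θ j + η j) ^ 2
      = D + 2 * cross n θ η ((lam - mu) ^ 2)
        + ∑ j ∈ Finset.Icc 1 n, (lam j - mu j) ^ 2 * η j ^ 2 := by
    simp only [hD, energy, cross, Finset.mul_sum, ← Finset.sum_add_distrib]
    refine Finset.sum_congr rfl fun j _ => ?_
    simp only [Pi.sub_apply, Pi.pow_apply]; ring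
  have hx0 : 0 ≤ ∑ j ∈ Finset.Icc 1 n, (lam j - mu j) ^ 2 * η j ^ 2 :=
    Finset.sum_nonneg fun j _ => by positivity
  -- The energy `D` is itself controlled by the losses: expand `hx`, drop the noise energy, and
  -- absorb half of `D` through Young's inequality. This is the origin of the factors 1 ∓ 4δ.
  have b3 : δ * D ≤ δ * (4 * L1 + 4 * L2 + 4 * (cross n θ η ((lam - mu) ^ 2) ^ 2 / D)) := by
    refine mul_le_mul_of_nonneg_left ?_ hδ.le
    have e : (-cross n θ η ((lam - mu) ^ 2)) ^ 2 / (1 / 2 * D)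
        = 2 * (cross n θ η ((lam - mu) ^ 2) ^ 2 / D) := by
      rw [neg_sq]; field_simp
    rw [e] at b2
    linarith
  set P1 := ∑ j ∈ Finset.Icc 1 n, lam j ^ 2
  set P2 := ∑ j ∈ Finset.Icc 1 n, mu j ^ 2
  have hP1 : 0 ≤ P1 := Finset.sum_nonneg fun j _ => sq_nonneg _
  have hP2 : 0 ≤ P2 := Finset.sum_nonneg fun j _ => sq_nonneg _
  have hzq : ρ * P1 * c / n = 0 → quadDev n η v lam = 0 := fun h => by
    have hP : P1 = 0 := by
      by_contra hne
      have : 0 < P1 := lt_of_le_of_ne hP1 (Ne.symm hne)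
      have : 0 < ρ * P1 * c / n := by positivity
      linarith
    refine Finset.sum_eq_zero fun j hj => ?_
    have := (Finset.sum_eq_zero_iff_of_nonneg (fun j _ => sq_nonneg _)).1 hP j hj
    rw [pow_eq_zero_iff two_ne_zero |>.1 this, zero_mul]
  -- The quadratic fluctuation at the selected weight is paid for by its penalty, which is at least
  -- ρ P1 c/n up to the error of `ζ`.
  have b4 := two_mul_le_add_div (D := ρ * P1 * c / n) (by positivity) hzq one_pos
  have e4 : quadDev n η v lam ^ 2 / (1 * (ρ * P1 * c / n))
      = n * quadDev n η v lam ^ 2 / (ρ * P1 * c) := by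
    rw [one_mul, div_div_eq_mul_div, mul_comm]
  rw [e4, one_mul] at b4
  have b5 : ρ * P1 * c / n ≤ ρ * P1 * V / n := by gcongr
  set X := (V - ζ) / n with hX
  have habs : 6 * N * |V - ζ| / n = 6 * N * |X| := by
    rw [hX, abs_div, abs_of_pos hn']; ring
  have hζ : ∀ P, P * ζ / n = P * V / n - P * X := fun P => by rw [hX]; ring
  rw [hζ, hζ] at hJ
  rw [habs]
  -- The variance error enters twice with each of Σλ and Σμ, and once with each penalty since ρ ≤ 1;
  -- together this is the factor 6 N.
  have c1 : ∀ P, 0 ≤ P → P ≤ N → |P * X| ≤ N * |X| := fun P h0 h1 => by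
    rw [abs_mul, abs_of_nonneg h0]; exact mul_le_mul_of_nonneg_right h1 (abs_nonneg _)
  have d1 := abs_le.1 (c1 _ hN1' hN1)
  have d2 := abs_le.1 (c1 _ hN2' hN2)
  have c2 : ∀ P, 0 ≤ P → P ≤ N → |ρ * (P * X)| ≤ N * |X| := fun P h0 h1 => by
    rw [abs_mul, abs_of_pos hρ]
    calc ρ * |P * X| ≤ 1 * |P * X| := mul_le_mul_of_nonneg_right hρ1 (abs_nonneg _)
      _ ≤ _ := by rw [one_mul]; exact c1 P h0 h1
  have d3 := abs_le.1 (c2 _ hP1 hN3)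
  have d4 := abs_le.1 (c2 _ hP2 hN4)
  have d5 := abs_le.1 hv1
  have d6 := abs_le.1 hv2
  have f1 : ρ * (P1 * V / n - P1 * X) = ρ * P1 * V / n - ρ * (P1 * X) := by ring
  have f2 : ρ * (P2 * V / n - P2 * X) = ρ * P2 * V / n - ρ * (P2 * X) := by ring
  rw [f1, f2] at hJ
  have hNX : 0 ≤ N * |X| := (abs_nonneg _).trans (c1 _ hN1' hN1)
  rw [hcr] at b1 ⊢
  linarith

/-! ### The loss of weighted least squares estimators -/

lemma coeffHat_eq_add (n : ℕ) (s σ ξ : Fin n → ℝ) (j : ℕ) :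
    coeffHat n (fun l => s l + σ l * ξ l) j = dip n s (phi n j) + noiseCoeff n σ ξ j := by
  rw [coeffHat_eq_dip, noiseCoeff, ← dip_add_left]; rfl

lemma wls_design (n : ℕ) (lam : ℕ → ℝ) (y : Fin n → ℝ) :
    (fun l => wls n lam y (design n l)) = ∑ j ∈ Finset.Icc 1 n, (lam j * coeffHat n y j) • phi n j := by
  funext l
  simp [wls, Finset.sum_apply, phi]

/-- Vanishing from index n on removes the only index of the range where the basis may fail to be
normalised. -/
lemma dip_sum_phi_of_vanish {n : ℕ} {a : ℕ → ℝ} (ha : ∀ j, n ≤ j → a j = 0) :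
    dip n (∑ j ∈ Finset.Icc 1 n, a j • phi n j) (∑ j ∈ Finset.Icc 1 n, a j • phi n j)
      = ∑ j ∈ Finset.Icc 1 n, a j ^ 2 := by
  rw [dip_sum_phi (Finset.Subset.refl _)]
  refine Finset.sum_congr rfl fun j hj => ?_
  rcases lt_or_ge j n with h | h
  · rw [dip_phi_self (Finset.mem_Icc.1 hj).1 h]; ring
  · rw [ha j h]; ring

lemma empNormSq_wls_sub {n : ℕ} {lam : ℕ → ℝ} (hlam : ∀ j, n ≤ j → lam j = 0) (y : Fin n → ℝ)
    (S : ℝ → ℝ) : empNormSq n (fun x => wls n lam y x - S x)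
      = ∑ j ∈ Finset.Icc 1 n, lam j ^ 2 * coeffHat n y j ^ 2
        - 2 * ∑ j ∈ Finset.Icc 1 n, lam j * coeffHat n y j * dip n (fun l => S (design n l)) (phi n j)
        + dip n (fun l => S (design n l)) (fun l => S (design n l)) := by
  set s : Fin n → ℝ := fun l => S (design n l) with hs
  rw [empNormSq_eq_dip]
  have e : (fun l => wls n lam y (design n l) - S (design n l))
      = (∑ j ∈ Finset.Icc 1 n, (lam j * coeffHat n y j) • phi n j) - s := by
    rw [← wls_design]; rfl
  rw [e, dip_sub_left, dip_sub_right, dip_sub_right,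
    dip_sum_phi_of_vanish (fun j hj => by rw [hlam j hj, zero_mul]), dip_comm n s, dip_sum_left]
  simp only [dip_smul_left, mul_pow, dip_comm n (phi n _) s]
  ring

/-- The left side is the squared empirical distance between the two estimators; pass through S and
use ‖a + b‖² ≤ 2‖a‖² + 2‖b‖². -/
lemma sum_sub_sq_mul_coeffHat_le {n : ℕ} {lam mu : ℕ → ℝ} (hlam : ∀ j, n ≤ j → lam j = 0)
    (hmu : ∀ j, n ≤ j → mu j = 0) (y : Fin n → ℝ) (S : ℝ → ℝ) :
    ∑ j ∈ Finset.Icc 1 n, (lam j - mu j) ^ 2 * coeffHat n y j ^ 2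
      ≤ 2 * empNormSq n (fun x => wls n lam y x - S x)
        + 2 * empNormSq n (fun x => wls n mu y x - S x) := by
  set a : Fin n → ℝ := fun l => wls n lam y (design n l) - S (design n l) with ha
  set b : Fin n → ℝ := fun l => S (design n l) - wls n mu y (design n l) with hb
  have h1 : empNormSq n (fun x => wls n lam y x - S x) = dip n a a := empNormSq_eq_dip _ _
  have h2 : empNormSq n (fun x => wls n mu y x - S x) = dip n b b := by
    rw [empNormSq_eq_dip, dip, dip]
    congr 1
    exact Finset.sum_congr rfl fun l _ => by simp only [hb]; ring
  have h3 : a + b = ∑ j ∈ Finset.Icc 1 n, ((lam j - mu j) * coeffHat n y j) • phi n j := by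
    have e1 := wls_design n lam y
    have e2 := wls_design n mu y
    have e3 : ∑ j ∈ Finset.Icc 1 n, ((lam j - mu j) * coeffHat n y j) • phi n j
        = (fun l => wls n lam y (design n l)) - fun l => wls n mu y (design n l) := by
      rw [e1, e2, ← Finset.sum_sub_distrib]
      exact Finset.sum_congr rfl fun j _ => by rw [sub_mul, sub_smul]
    rw [e3]
    funext l
    simp [ha, hb]
  have h4 : ∑ j ∈ Finset.Icc 1 n, (lam j - mu j) ^ 2 * coeffHat n y j ^ 2 = dip n (a + b) (a + b) := by
    rw [h3, dip_sum_phi_of_vanish (fun j hj => by rw [hlam j hj, hmu j hj]; ring)]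
    simp only [mul_pow]
  have h5 := dip_add_self_le n a b one_pos
  rw [h1, h2, h4]
  linarith

/-- The loss of a fixed weighted least squares estimator splits into its mean and centered terms. -/
lemma loss_eq (n : ℕ) (s : Fin n → ℝ) (η v mu : ℕ → ℝ) :
    ∑ j ∈ Finset.Icc 1 n, mu j ^ 2 * (dip n s (phi n j) + η j) ^ 2
      - 2 * ∑ j ∈ Finset.Icc 1 n, mu j * (dip n s (phi n j) + η j) * dip n s (phi n j) + dip n s s
      = biasSq n s mu + ∑ j ∈ Finset.Icc 1 n, mu j ^ 2 * v j
        + cross n (fun j => dip n s (phi n j)) η (fun j => 2 * mu j ^ 2 - 2 * mu j)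
        + quadDev n η v (fun j => mu j ^ 2) := by
  have : ∑ j ∈ Finset.Icc 1 n, mu j ^ 2 * (dip n s (phi n j) + η j) ^ 2
      - 2 * ∑ j ∈ Finset.Icc 1 n, mu j * (dip n s (phi n j) + η j) * dip n s (phi n j)
      = ∑ j ∈ Finset.Icc 1 n, mu j ^ 2 * dip n s (phi n j) ^ 2
      - 2 * ∑ j ∈ Finset.Icc 1 n, mu j * dip n s (phi n j) ^ 2 +
       (∑ j ∈ Finset.Icc 1 n, mu j ^ 2 * v j
        + cross n (fun j => dip n s (phi n j)) η (fun j => 2 * mu j ^ 2 - 2 * mu j)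
        + quadDev n η v (fun j => mu j ^ 2)) := by
    simp only [cross, quadDev, Finset.mul_sum, ← Finset.sum_sub_distrib, ← Finset.sum_add_distrib]
    exact Finset.sum_congr rfl fun j _ => by ring
  rw [this, biasSq]
  ring

/-! ### The variance estimator -/

/-- The indicator of the indices above `l`. -/
def tailInd (l j : ℕ) : ℝ := if l < j then 1 else 0

lemma abs_meanVar_sub_sum_le {n l : ℕ} (hn : 0 < n) {σ : Fin n → ℝ} {M : ℝ}
    (hσ : ∀ l, σ l ^ 2 ≤ M) (θ η : ℕ → ℝ) :
    |meanVar n σ - ∑ j ∈ Finset.Icc (l + 1) n, (θ j + η j) ^ 2|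
      ≤ energy n θ (tailInd l) + M * (1 + 2 * l) / n + 2 * |cross n θ η (tailInd l)|
        + |quadDev n η (noiseVar n σ) (tailInd l)| := by
  have hn' : (0 : ℝ) < n := by exact_mod_cast hn
  have hM : 0 ≤ M := (sq_nonneg _).trans (hσ ⟨0, hn⟩)
  have e1 : ∑ j ∈ Finset.Icc (l + 1) n, (θ j + η j) ^ 2
      = ∑ j ∈ Finset.Icc 1 n, tailInd l j * (θ j + η j) ^ 2 := by
    have hf : Finset.Icc (l + 1) n = (Finset.Icc 1 n).filter (fun j => l < j) := by
      ext j; simp only [Finset.mem_Icc, Finset.mem_filter]; omega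
    rw [hf, Finset.sum_filter]
    exact Finset.sum_congr rfl fun j _ => by simp [tailInd]
  have e2 : ∑ j ∈ Finset.Icc 1 n, tailInd l j * (θ j + η j) ^ 2
      = energy n θ (tailInd l) + 2 * cross n θ η (tailInd l)
        + quadDev n η (noiseVar n σ) (tailInd l)
        + ∑ j ∈ Finset.Icc 1 n, tailInd l j * noiseVar n σ j := by
    simp only [energy, cross, quadDev, Finset.mul_sum, ← Finset.sum_add_distrib]
    refine Finset.sum_congr rfl fun j _ => ?_
    have : tailInd l j ^ 2 = tailInd l j := by unfold tailInd; split_ifs <;> norm_num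
    rw [this]; ring
  -- The tail indicator increases in j, so Abel's bound is applied to the constant weight 1. The
  -- first l variances, each at most 2M/n, are removed by hand.
  have h3 := abs_sum_mul_noiseVar_sub_le hn hσ (lam := fun _ => 1) (fun _ _ _ _ => le_rfl)
    (fun _ => zero_le_one) le_rfl
  have e3 : ∑ j ∈ Finset.Icc 1 n, (1 : ℝ) * (noiseVar n σ j - meanVar n σ / n)
      = ∑ j ∈ Finset.Icc 1 n, noiseVar n σ j - meanVar n σ := by
    simp only [one_mul, Finset.sum_sub_distrib, Finset.sum_const, Nat.card_Icc, nsmul_eq_mul]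
    rw [show n + 1 - 1 = n by omega, mul_div_cancel₀ _ hn'.ne']
  rw [e3] at h3
  have e4 : ∑ j ∈ Finset.Icc 1 n, noiseVar n σ j = ∑ j ∈ Finset.Icc 1 n, tailInd l j * noiseVar n σ j
      + ∑ j ∈ (Finset.Icc 1 n).filter (fun j => j ≤ l), noiseVar n σ j := by
    rw [Finset.sum_filter, ← Finset.sum_add_distrib]
    refine Finset.sum_congr rfl fun j _ => ?_
    unfold tailInd
    by_cases h : l < j
    · simp [h, Nat.not_le.2 h]
    · simp [h, Nat.not_lt.1 h]
  have h4 : ∑ j ∈ (Finset.Icc 1 n).filter (fun j => j ≤ l), noiseVar n σ j ≤ 2 * M * l / n := by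
    calc _ ≤ ((Finset.Icc 1 n).filter (fun j => j ≤ l)).card • (2 * M / n) :=
          Finset.sum_le_card_nsmul _ _ _ fun j _ => noiseVar_le hn hσ j
      _ ≤ (l : ℝ) * (2 * M / n) := by
          rw [nsmul_eq_mul]
          refine mul_le_mul_of_nonneg_right ?_ (by positivity)
          have : ((Finset.Icc 1 n).filter (fun j => j ≤ l)).card ≤ (Finset.Icc 1 l).card :=
            Finset.card_le_card fun j => by
              simp only [Finset.mem_filter, Finset.mem_Icc]; omega
          rw [Nat.card_Icc] at this
          exact_mod_cast this
      _ = _ := by ring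
  have h4' : 0 ≤ ∑ j ∈ (Finset.Icc 1 n).filter (fun j => j ≤ l), noiseVar n σ j :=
    Finset.sum_nonneg fun j _ => noiseVar_nonneg _ _ _
  have h5 := energy_nonneg n θ (tailInd l)
  have h6 : M * (1 + 2 * l) / n = M / n + 2 * M * l / n := by ring
  have h7 := abs_le.1 h3
  rw [e1, e2, h6]
  have a1 := le_abs_self (cross n θ η (tailInd l))
  have a2 := neg_abs_le (cross n θ η (tailInd l))
  have a3 := le_abs_self (quadDev n η (noiseVar n σ) (tailInd l))
  have a4 := neg_abs_le (quadDev n η (noiseVar n σ) (tailInd l))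
  rw [abs_le]
  constructor <;> linarith

/-! ### Functions with bounded mean -/

/-- `f` is integrable with mean at most `B`. -/
def MeanLE {Ω : Type*} [MeasurableSpace Ω] (P : Measure Ω) (f : Ω → ℝ) (B : ℝ) : Prop :=
  Integrable f P ∧ ∫ ω, f ω ∂P ≤ B

namespace MeanLE
variable {Ω : Type*} [MeasurableSpace Ω] {P : Measure Ω} {f g : Ω → ℝ} {A B : ℝ}

lemma add (hf : MeanLE P f A) (hg : MeanLE P g B) : MeanLE P (fun ω => f ω + g ω) (A + B) :=
  ⟨hf.1.add hg.1, by rw [integral_add hf.1 hg.1]; exact add_le_add hf.2 hg.2⟩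

lemma const [IsProbabilityMeasure P] (c : ℝ) : MeanLE P (fun _ => c) c :=
  ⟨integrable_const _, by simp⟩

lemma const_mul {c : ℝ} (hc : 0 ≤ c) (hf : MeanLE P f A) : MeanLE P (fun ω => c * f ω) (c * A) :=
  ⟨hf.1.const_mul c, by rw [integral_const_mul]; exact mul_le_mul_of_nonneg_left hf.2 hc⟩

lemma of_eq_zero (hf : Integrable f P) (h : ∫ ω, f ω ∂P = 0) (c : ℝ) :
    MeanLE P (fun ω => c * f ω) 0 :=
  ⟨hf.const_mul c, by rw [integral_const_mul, h, mul_zero]⟩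

lemma sum {ι : Type*} {s : Finset ι} {f : ι → Ω → ℝ} {A : ι → ℝ}
    (h : ∀ i ∈ s, MeanLE P (f i) (A i)) :
    MeanLE P (fun ω => ∑ i ∈ s, f i ω) (∑ i ∈ s, A i) :=
  ⟨integrable_finsetSum _ fun i hi => (h i hi).1, by
    rw [integral_finsetSum _ fun i hi => (h i hi).1]
    exact Finset.sum_le_sum fun i hi => (h i hi).2⟩

lemma mono (hf : MeanLE P f A) (h : A ≤ B) : MeanLE P f B := ⟨hf.1, hf.2.trans h⟩

lemma div {D K : ℝ} (hD : 0 ≤ D) (hK : 0 ≤ K) (hf : MeanLE P f (K * D)) :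
    MeanLE P (fun ω => f ω / D) K :=
  ⟨hf.1.div_const D, by rw [integral_div]; exact div_le_of_le_mul₀ hD hK hf.2⟩

/-- Only the majorant has to be integrable; the dominated loss at a data-driven weight may be an
arbitrary nonnegative function. -/
lemma lintegral_le (hf : MeanLE P f A) {h : Ω → ℝ} (h0 : ∀ ω, 0 ≤ h ω) (hle : ∀ ω, h ω ≤ f ω) :
    ∫⁻ ω, ENNReal.ofReal (h ω) ∂P ≤ ENNReal.ofReal A := by
  calc ∫⁻ ω, ENNReal.ofReal (h ω) ∂P ≤ ∫⁻ ω, ENNReal.ofReal (f ω) ∂P :=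
        lintegral_mono fun ω => ENNReal.ofReal_le_ofReal (hle ω)
    _ = ENNReal.ofReal (∫ ω, f ω ∂P) :=
        (ofReal_integral_eq_lintegral_ofReal hf.1
          (Eventually.of_forall fun ω => (h0 ω).trans (hle ω))).symm
    _ ≤ _ := ENNReal.ofReal_le_ofReal hf.2

end MeanLE

/-! ### The oracle inequality in mean -/

/-- The properties of the Pinsker weights used in the oracle inequality. -/
structure IsMonotoneWeight (n : ℕ) (N : ℝ) (lam : ℕ → ℝ) : Prop where
  nonneg : ∀ j, 0 ≤ lam j
  le_one : ∀ j, lam j ≤ 1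
  antitone : ∀ i j, 1 ≤ i → i ≤ j → lam j ≤ lam i
  vanish : ∀ j, n ≤ j → lam j = 0
  sum_le : ∑ j ∈ Finset.Icc 1 n, lam j ≤ N

lemma IsMonotoneWeight.sum_sq_le {n : ℕ} {N : ℝ} {lam : ℕ → ℝ} (h : IsMonotoneWeight n N lam) :
    ∑ j ∈ Finset.Icc 1 n, lam j ^ 2 ≤ N :=
  (Finset.sum_le_sum fun j _ => by nlinarith [h.nonneg j, h.le_one j]).trans h.sum_le

/-- The mean bound for the error of the variance estimator. -/
def zetaBound (ξs M T b : ℝ) (n l : ℕ) : ℝ :=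
  T + M * (1 + 2 * l) / n + 2 * b + (2 * M * T + 8 * ξs * M ^ 2) * b

/-- The absolute values of the noise terms are linearised by 2|a| ≤ b + a²/b. With b = n^{-1/2}, the
order of their standard deviations, both parts are of order n^{-1/2}. -/
lemma meanLE_zeta {ξs : ℝ} {μ : Measure ℝ} (h : IsNoiseLaw ξs μ) {n l : ℕ} (hn : 0 < n)
    {σ : Fin n → ℝ} {M : ℝ} (hσ : ∀ l, σ l ^ 2 ≤ M) {θ : ℕ → ℝ} {T b : ℝ}
    (hT : energy n θ (tailInd l) ≤ T) (hb : 0 < b) (hb2 : b ^ 2 = 1 / n) :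
    MeanLE (Measure.pi fun _ : Fin n => μ) (fun ξ => (T + M * (1 + 2 * l) / n + 2 * b)
      + (cross n θ (noiseCoeff n σ ξ) (tailInd l) ^ 2 / b
      + quadDev n (noiseCoeff n σ ξ) (noiseVar n σ) (tailInd l) ^ 2 / b))
      (zetaBound ξs M T b n l) := by
  have hp := h.isProb
  have hn' : (0 : ℝ) < n := by exact_mod_cast hn
  have hM : 0 ≤ M := (sq_nonneg _).trans (hσ ⟨0, hn⟩)
  have hξ : 1 ≤ ξs := h.one_le_fourth.trans h.fourth_moment
  have hT0 : 0 ≤ T := (energy_nonneg _ _ _).trans hT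
  have hb3 : (n : ℝ)⁻¹ = b * b := by rw [← sq, hb2, one_div]
  have m1 : MeanLE (Measure.pi fun _ : Fin n => μ)
      (fun ξ => cross n θ (noiseCoeff n σ ξ) (tailInd l) ^ 2 / b) (2 * M * T * b) := by
    refine MeanLE.div hb.le (by positivity) ⟨h.integrable_cross_sq σ θ _, ?_⟩
    refine (h.integral_cross_sq_le hn hσ θ _).trans ?_
    rw [div_eq_mul_inv, hb3]
    calc 2 * M * (b * b) * energy n θ (tailInd l) ≤ 2 * M * (b * b) * T :=
          mul_le_mul_of_nonneg_left hT (by positivity)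
      _ = _ := by ring
  have m2 : MeanLE (Measure.pi fun _ : Fin n => μ)
      (fun ξ => quadDev n (noiseCoeff n σ ξ) (noiseVar n σ) (tailInd l) ^ 2 / b)
      (8 * ξs * M ^ 2 * b) := by
    refine MeanLE.div hb.le (by positivity) ⟨h.integrable_quadDev_sq σ _, ?_⟩
    refine (h.integral_quadDev_sq_le hn hσ _).trans ?_
    have : ∑ j ∈ Finset.Icc 1 n, tailInd l j ^ 2 ≤ n := by
      calc _ ≤ ∑ _j ∈ Finset.Icc 1 n, (1 : ℝ) := Finset.sum_le_sum fun j _ => by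
            unfold tailInd; split_ifs <;> norm_num
        _ = n := by simp
    calc _ ≤ 8 * ξs * M ^ 2 / (n : ℝ) ^ 2 * n := mul_le_mul_of_nonneg_left this (by positivity)
      _ = 8 * ξs * M ^ 2 * (n : ℝ)⁻¹ := by field_simp
      _ = _ := by rw [hb3]; ring
  refine (((MeanLE.const _).add (m1.add m2))).mono (le_of_eq ?_)
  rw [zetaBound]; ring

/-- The remainder of the oracle inequality, multiplied by `n`. -/
def oracleRem (ξs M c ρ δ N Z : ℝ) (card : ℕ) : ℝ :=
  4 * M + 6 * N * Z + card * (8 * ξs * M ^ 2 / (ρ * c) + 2 * M / δ + 8 * δ * M)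

/-- Integrate `oracle_pointwise`. The comparison index `i₀` is deterministic, so its linear and
quadratic noise terms average to zero; terms involving the random index are majorised by sums over
all of `W`. -/
theorem oracle_inequality {ι : Type*} {ξs : ℝ} {μ : Measure ℝ} (h : IsNoiseLaw ξs μ) {n : ℕ}
    (hn : 0 < n) {σ : Fin n → ℝ} {M c : ℝ} (hc : 0 < c) (hσ : ∀ l, σ l ^ 2 ≤ M)
    (hσc : ∀ l, c ≤ σ l ^ 2) {S : ℝ → ℝ} {T b N δ γ : ℝ}
    (hT : energy n (fun j => dip n (fun l => S (design n l)) (phi n j)) (tailInd (lInt n)) ≤ T)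
    (hb : 0 < b) (hb2 : b ^ 2 = 1 / n) (hδ : 0 < δ) (hδ4 : 4 * δ < 1)
    (hρ : 0 < rho γ n) (hρ1 : rho γ n ≤ 1)
    {W : Finset ι} {w : ι → ℕ → ℝ} (hw : ∀ i ∈ W, IsMonotoneWeight n N (w i)) {i₀ : ι} (hi₀ : i₀ ∈ W)
    {lamHat : (Fin n → ℝ) → ℕ → ℝ} (hmem : ∀ y, ∃ i ∈ W, lamHat y = w i)
    (hmin : ∀ y, cost γ n y (lamHat y) ≤ cost γ n y (w i₀)) :
    ∫⁻ ξ, ENNReal.ofReal (empNormSq n fun x =>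
        wls n (lamHat fun l => S (design n l) + σ l * ξ l)
          (fun l => S (design n l) + σ l * ξ l) x - S x) ∂(Measure.pi fun _ : Fin n => μ)
      ≤ ENNReal.ofReal ((1 - 4 * δ)⁻¹ * ((1 + 4 * δ) * (biasSq n (fun l => S (design n l)) (w i₀)
        + ∑ j ∈ Finset.Icc 1 n, w i₀ j ^ 2 * noiseVar n σ j)
        + rho γ n * (∑ j ∈ Finset.Icc 1 n, w i₀ j ^ 2) * meanVar n σ / n
        + oracleRem ξs M c (rho γ n) δ N (zetaBound ξs M T b n (lInt n)) W.card / n)) := by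
  have hp := h.isProb
  have hn' : (0 : ℝ) < n := by exact_mod_cast hn
  have hM : 0 ≤ M := (sq_nonneg _).trans (hσ ⟨0, hn⟩)
  have hξ : 1 ≤ ξs := h.one_le_fourth.trans h.fourth_moment
  have hδ1 : 0 < 1 - 4 * δ := by linarith
  set s : Fin n → ℝ := fun l => S (design n l) with hs
  set θ : ℕ → ℝ := fun j => dip n s (phi n j) with hθ
  set mu := w i₀ with hmu
  set v := noiseVar n σ with hv
  set ρ := rho γ n with hρdef
  set V := meanVar n σ with hV
  have hmuW := hw i₀ hi₀
  have hN0 : 0 ≤ N := (Finset.sum_nonneg fun j _ => hmuW.nonneg j).trans hmuW.sum_le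
  set P := Measure.pi fun _ : Fin n => μ with hP
  -- the majorant
  set Z : (Fin n → ℝ) → ℝ := fun ξ => (T + M * (1 + 2 * lInt n) / n + 2 * b)
      + (cross n θ (noiseCoeff n σ ξ) (tailInd (lInt n)) ^ 2 / b
      + quadDev n (noiseCoeff n σ ξ) v (tailInd (lInt n)) ^ 2 / b) with hZ
  set R : ι → (Fin n → ℝ) → ℝ := fun i ξ =>
      n * quadDev n (noiseCoeff n σ ξ) v (w i) ^ 2 / (ρ * (∑ j ∈ Finset.Icc 1 n, w i j ^ 2) * c)
      + cross n θ (noiseCoeff n σ ξ) (w i - mu) ^ 2 / (δ * energy n θ (w i - mu))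
      + 4 * δ * (cross n θ (noiseCoeff n σ ξ) ((w i - mu) ^ 2) ^ 2 / energy n θ (w i - mu)) with hR
  set K : ℝ := (1 + 4 * δ) * (biasSq n s mu + ∑ j ∈ Finset.Icc 1 n, mu j ^ 2 * v j)
      + ρ * (∑ j ∈ Finset.Icc 1 n, mu j ^ 2) * V / n + 4 * M / n with hK
  set G : (Fin n → ℝ) → ℝ := fun ξ => (1 - 4 * δ)⁻¹ * (K
      + (1 + 4 * δ) * cross n θ (noiseCoeff n σ ξ) (fun j => 2 * mu j ^ 2 - 2 * mu j)
      + (1 + 4 * δ) * quadDev n (noiseCoeff n σ ξ) v (fun j => mu j ^ 2)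
      + (-2) * quadDev n (noiseCoeff n σ ξ) v mu
      + 6 * N / n * Z ξ + ∑ i ∈ W, R i ξ) with hG
  have mZ : MeanLE P Z (zetaBound ξs M T b n (lInt n)) := meanLE_zeta h hn hσ hT hb hb2
  have mR : ∀ i ∈ W, MeanLE P (R i)
      ((8 * ξs * M ^ 2 / (ρ * c) + 2 * M / δ + 8 * δ * M) / n) := by
    intro i hi
    have hPi : 0 ≤ ∑ j ∈ Finset.Icc 1 n, w i j ^ 2 := Finset.sum_nonneg fun j _ => sq_nonneg _
    have hE := energy_nonneg n θ (w i - mu)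
    have a1 : MeanLE P (fun ξ => n * quadDev n (noiseCoeff n σ ξ) v (w i) ^ 2 /
        (ρ * (∑ j ∈ Finset.Icc 1 n, w i j ^ 2) * c)) (8 * ξs * M ^ 2 / (ρ * c) / n) := by
      refine MeanLE.div (by positivity) (by positivity) ?_
      have := MeanLE.const_mul hn'.le
        ⟨h.integrable_quadDev_sq σ (w i), h.integral_quadDev_sq_le hn hσ (w i)⟩
      refine this.mono (le_of_eq ?_)
      field_simp
    have a2 : MeanLE P (fun ξ => cross n θ (noiseCoeff n σ ξ) (w i - mu) ^ 2 /
        (δ * energy n θ (w i - mu))) (2 * M / δ / n) := by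
      refine MeanLE.div (by positivity) (by positivity) ?_
      have : MeanLE P (fun ξ => cross n θ (noiseCoeff n σ ξ) (w i - mu) ^ 2) _ :=
        ⟨h.integrable_cross_sq σ θ _, h.integral_cross_sq_le hn hσ θ _⟩
      refine this.mono (le_of_eq ?_)
      field_simp
    have a3 : MeanLE P (fun ξ => cross n θ (noiseCoeff n σ ξ) ((w i - mu) ^ 2) ^ 2 /
        energy n θ (w i - mu)) (2 * M / n) := by
      refine MeanLE.div hE (by positivity) ⟨h.integrable_cross_sq σ θ _, ?_⟩
      refine (h.integral_cross_sq_le hn hσ θ _).trans ?_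
      refine mul_le_mul_of_nonneg_left (Finset.sum_le_sum fun j _ => ?_) (by positivity)
      refine mul_le_mul_of_nonneg_right ?_ (sq_nonneg _)
      have h1 : (w i - mu) j ^ 2 ≤ 1 := by
        have b1 := (hw i hi).nonneg j
        have b2 := (hw i hi).le_one j
        have b3 := hmuW.nonneg j
        have b4 := hmuW.le_one j
        simp only [Pi.sub_apply]
        nlinarith
      rw [Pi.pow_apply]
      nlinarith [sq_nonneg ((w i - mu) j)]
    refine ((a1.add a2).add (a3.const_mul (by positivity : 0 ≤ 4 * δ))).mono (le_of_eq ?_)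
    ring
  have mG : MeanLE P G ((1 - 4 * δ)⁻¹ * (K + 0 + 0 + 0
      + 6 * N / n * zetaBound ξs M T b n (lInt n)
      + ∑ _i ∈ W, (8 * ξs * M ^ 2 / (ρ * c) + 2 * M / δ + 8 * δ * M) / n)) := by
    refine MeanLE.const_mul (by positivity) ?_
    exact (((((MeanLE.const K).add (MeanLE.of_eq_zero (h.integrable_cross σ θ _)
      (h.integral_cross σ θ _) _)).add (MeanLE.of_eq_zero (h.integrable_quadDev σ _)
      (h.integral_quadDev σ _) _)).add (MeanLE.of_eq_zero (h.integrable_quadDev σ _)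
      (h.integral_quadDev σ _) _)).add (mZ.const_mul (by positivity))).add (MeanLE.sum mR)
  refine le_trans (mG.lintegral_le (fun ξ => ?_) fun ξ => ?_) (ENNReal.ofReal_le_ofReal (le_of_eq ?_))
  · rw [empNormSq_eq_dip]; exact dip_self_nonneg _ _
  · set y : Fin n → ℝ := fun l => s l + σ l * ξ l with hy
    obtain ⟨i, hi, hli⟩ := hmem y
    have hiW := hw i hi
    have hcoef : ∀ j, coeffHat n y j = θ j + noiseCoeff n σ ξ j := coeffHat_eq_add n s σ ξ
    rw [hli]
    have hmin' := hmin y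
    rw [hli] at hmin'
    set η := noiseCoeff n σ ξ with hη
    have hzeta : zetaHat n y = ∑ j ∈ Finset.Icc (lInt n + 1) n, (θ j + η j) ^ 2 := by
      simp only [zetaHat, hcoef]
    have hL1 := empNormSq_wls_sub hiW.vanish y S
    have hL2 := empNormSq_wls_sub hmuW.vanish y S
    have hxx := sum_sub_sq_mul_coeffHat_le hiW.vanish hmuW.vanish y S
    simp only [hcoef] at hL1 hL2 hxx
    simp only [cost, penalty, coeffTilde, weightSq, hcoef] at hmin'
    have key := oracle_pointwise (n := n) (θ := θ) (η := η) (v := v) (lam := w i) (mu := mu)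
      (S2 := dip n s s) (ζ := zetaHat n y) (V := V) (ρ := ρ) (δ := δ) (N := N) (c := c) (B := M / n)
      hn hδ hρ hρ1 hc (le_meanVar hn hσc) hL1 hL2 hxx hmin'
      (abs_sum_mul_noiseVar_sub_le hn hσ hiW.antitone hiW.nonneg (hiW.le_one 1))
      (abs_sum_mul_noiseVar_sub_le hn hσ hmuW.antitone hmuW.nonneg (hmuW.le_one 1))
      hiW.sum_le (Finset.sum_nonneg fun j _ => hiW.nonneg j) hmuW.sum_le
      (Finset.sum_nonneg fun j _ => hmuW.nonneg j) hiW.sum_sq_le hmuW.sum_sq_le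
    have hzb : |V - zetaHat n y| ≤ Z ξ := by
      rw [hzeta]
      refine (abs_meanVar_sub_sum_le hn hσ θ η).trans ?_
      have t1 := two_mul_le_add_div (D := b) (a := |cross n θ η (tailInd (lInt n))|) (δ := 1) hb.le
        (fun h => absurd h hb.ne') one_pos
      have t2 := two_mul_le_add_div (D := b) (a := |quadDev n η v (tailInd (lInt n))|) (δ := 1) hb.le
        (fun h => absurd h hb.ne') one_pos
      rw [one_mul, sq_abs] at t1 t2
      have t3 := abs_nonneg (quadDev n η v (tailInd (lInt n)))
      simp only [hZ]
      linarith
    -- The index `i` depends on the data. All summands are nonnegative, so the maximum over the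
    -- family is bounded by the sum, at the cost of the factor `W.card`.
    have hRi : R i ξ ≤ ∑ i ∈ W, R i ξ := by
      refine Finset.single_le_sum (f := fun i => R i ξ) (fun i _ => ?_) hi
      have hPi : 0 ≤ ∑ j ∈ Finset.Icc 1 n, w i j ^ 2 := Finset.sum_nonneg fun j _ => sq_nonneg _
      have hE := energy_nonneg n θ (w i - mu)
      simp only [hR]
      positivity
    have hL2' : empNormSq n (fun x => wls n mu y x - S x) = _ :=
      hL2.trans (loss_eq n s η v mu)
    have hNZ : 6 * N * |V - zetaHat n y| / n ≤ 6 * N / n * Z ξ := by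
      rw [show 6 * N * |V - zetaHat n y| / n = 6 * N / n * |V - zetaHat n y| by ring]
      exact mul_le_mul_of_nonneg_left hzb (by positivity)
    simp only [hG]
    rw [le_inv_mul_iff₀ hδ1]
    rw [hL2'] at key
    simp only [hR] at hRi
    simp only [hK]
    have hM4 : 4 * (M / n) = 4 * M / n := by ring
    linarith
  · rw [Finset.sum_const, nsmul_eq_mul, hK, oracleRem]
    ring

/-! ### The Pinsker weights -/

lemma one_le_log_nat {n : ℕ} (hn : 3 ≤ n) : 1 ≤ Real.log n := by
  have h3 : (3 : ℝ) ≤ n := by exact_mod_cast hn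
  rw [Real.le_log_iff_exp_le (by linarith)]
  have := Real.exp_one_lt_d9
  linarith

lemma aConst_pos {β : ℕ} (hβ : 1 ≤ β) : 0 < aConst β := by
  have h : (1 : ℝ) ≤ β := by exact_mod_cast hβ
  have := Real.pi_pos
  unfold aConst; positivity

/-- Bernoulli's inequality together with π² ≥ 9 gives π^{2β} ≥ 1 + 8β. -/
lemma aConst_le_one {β : ℕ} (hβ : 1 ≤ β) : aConst β ≤ 1 := by
  have h : (1 : ℝ) ≤ β := by exact_mod_cast hβ
  have hpi := Real.pi_gt_three
  unfold aConst
  rw [div_le_one (by positivity)]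
  have h1 : 1 + (β : ℝ) * 8 ≤ Real.pi ^ (2 * β) := by
    have h9 : 1 + (β : ℝ) * 8 ≤ (1 + 8) ^ β := one_add_mul_le_pow (by norm_num) β
    refine h9.trans ?_
    rw [pow_mul]
    exact pow_le_pow_left₀ (by norm_num) (by nlinarith) β
  have h2 : ((β : ℝ) + 1) * (2 * β + 1) ≤ (1 + (β : ℝ) * 8) * β := by nlinarith
  exact h2.trans (mul_le_mul_of_nonneg_right h1 (by linarith))

/-- The bound `(n ln n)^{1/3}` for the bandwidths. -/
def maxBandwidth (n : ℕ) : ℝ := ((n : ℝ) * Real.log n) ^ (1 / 3 : ℝ)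

section Weights
variable {n β : ℕ} {t : ℝ}

lemma omega_pos (hn : 3 ≤ n) (hβ : 1 ≤ β) (ht : 0 < t) : 0 < omega n β t := by
  have : (0 : ℝ) < n := by exact_mod_cast (show 0 < n by omega)
  exact Real.rpow_pos_of_pos (mul_pos (mul_pos (aConst_pos hβ) ht) this) _

/-- The base n ln n is at least 1, so the exponent 1/(2β + 1) is worst at β = 1. -/
lemma omega_le_maxBandwidth (hn : 3 ≤ n) (hβ : 1 ≤ β) (ht : 0 < t) (htn : t ≤ Real.log n) :
    omega n β t ≤ maxBandwidth n := by
  have hn' : (3 : ℝ) ≤ n := by exact_mod_cast hn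
  have hL := one_le_log_nat hn
  have hb : (1 : ℝ) ≤ β := by exact_mod_cast hβ
  have hA := aConst_pos hβ
  have h1 : aConst β * t * n ≤ n * Real.log n := by
    have : aConst β * t ≤ 1 * Real.log n := mul_le_mul (aConst_le_one hβ) htn ht.le zero_le_one
    nlinarith
  have h2 : (1 : ℝ) ≤ n * Real.log n := by nlinarith
  calc omega n β t ≤ (n * Real.log n) ^ (1 / (2 * (β : ℝ) + 1)) :=
        Real.rpow_le_rpow (by positivity) h1 (by positivity)
    _ ≤ maxBandwidth n := by
        refine Real.rpow_le_rpow_of_exponent_le h2 ?_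
        rw [div_le_div_iff₀ (by positivity) (by norm_num)]
        linarith

lemma maxBandwidth_nonneg (hn : 3 ≤ n) : 0 ≤ maxBandwidth n := by
  have hL := one_le_log_nat hn
  exact Real.rpow_nonneg (by positivity) _

lemma maxBandwidth_lt (hn : 3 ≤ n) : maxBandwidth n < n := by
  have hn' : (3 : ℝ) ≤ n := by exact_mod_cast hn
  have hL := one_le_log_nat hn
  have hlog : Real.log n ≤ n := (Real.log_le_sub_one_of_pos (by linarith)).trans (by linarith)
  have h3 : maxBandwidth n ^ 3 = n * Real.log n := by
    rw [maxBandwidth, ← Real.rpow_natCast, ← Real.rpow_mul (by positivity)]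
    norm_num
  refine lt_of_pow_lt_pow_left₀ 3 (by linarith) ?_
  rw [h3]
  nlinarith [mul_pos (show (0 : ℝ) < n by linarith) (show (0 : ℝ) < n by linarith)]

lemma jZero_le_omega (hn : 3 ≤ n) (hβ : 1 ≤ β) (ht : 0 < t) : (jZero n β t : ℝ) ≤ omega n β t := by
  have hL := one_le_log_nat hn
  have hω := omega_pos hn hβ ht
  exact (Nat.floor_le (by positivity)).trans (div_le_self hω.le hL)

lemma pinskerWeight_of_le {j : ℕ} (hj : 1 ≤ j) (h : j ≤ jZero n β t) : pinskerWeight n β t j = 1 := by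
  simp [pinskerWeight, hj, h, Nat.not_lt.2 h]

lemma pinskerWeight_of_mid {j : ℕ} (h : jZero n β t < j) (hj : (j : ℝ) ≤ omega n β t) :
    pinskerWeight n β t j = 1 - ((j : ℝ) / omega n β t) ^ β := by
  simp [pinskerWeight, h, hj]

lemma pinskerWeight_of_lt {j : ℕ} (hn : 3 ≤ n) (hβ : 1 ≤ β) (ht : 0 < t)
    (h : omega n β t < j) : pinskerWeight n β t j = 0 := by
  have h0 : jZero n β t < j := by exact_mod_cast (jZero_le_omega hn hβ ht).trans_lt h
  simp [pinskerWeight, Nat.not_le.2 h0, not_le.2 h]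

lemma pinskerWeight_zero : pinskerWeight n β t 0 = 0 := by simp [pinskerWeight]

lemma div_pow_le_one {j : ℕ} (hω : 0 < omega n β t) (hj : (j : ℝ) ≤ omega n β t) :
    ((j : ℝ) / omega n β t) ^ β ≤ 1 :=
  pow_le_one₀ (by positivity) ((div_le_one hω).2 hj)

lemma pinskerWeight_mem (hn : 3 ≤ n) (hβ : 1 ≤ β) (ht : 0 < t) (j : ℕ) :
    0 ≤ pinskerWeight n β t j ∧ pinskerWeight n β t j ≤ 1 := by
  have hω := omega_pos hn hβ ht
  rcases Nat.eq_zero_or_pos j with rfl | hj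
  · simp [pinskerWeight_zero]
  rcases le_or_gt j (jZero n β t) with h | h
  · simp [pinskerWeight_of_le hj h]
  rcases le_or_gt (j : ℝ) (omega n β t) with h2 | h2
  · rw [pinskerWeight_of_mid h h2]
    have h3 := div_pow_le_one hω h2
    have h4 : 0 ≤ ((j : ℝ) / omega n β t) ^ β := by positivity
    constructor <;> linarith
  · simp [pinskerWeight_of_lt hn hβ ht h2]

lemma isMonotoneWeight_pinskerWeight (hn : 3 ≤ n) (hβ : 1 ≤ β) (ht : 0 < t)
    (htn : t ≤ Real.log n) : IsMonotoneWeight n (maxBandwidth n) (pinskerWeight n β t) where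
  nonneg j := (pinskerWeight_mem hn hβ ht j).1
  le_one j := (pinskerWeight_mem hn hβ ht j).2
  antitone i j hi hij := by
    have hω := omega_pos hn hβ ht
    rcases le_or_gt i (jZero n β t) with h | h
    · rw [pinskerWeight_of_le hi h]; exact (pinskerWeight_mem hn hβ ht j).2
    rcases le_or_gt (j : ℝ) (omega n β t) with h2 | h2
    · have hij' : (i : ℝ) ≤ j := by exact_mod_cast hij
      rw [pinskerWeight_of_mid (h.trans_le hij) h2, pinskerWeight_of_mid h (hij'.trans h2)]
      gcongr
    · rw [pinskerWeight_of_lt hn hβ ht h2]; exact (pinskerWeight_mem hn hβ ht i).1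
  vanish j hj := by
    refine pinskerWeight_of_lt hn hβ ht ?_
    have hj' : (n : ℝ) ≤ j := by exact_mod_cast hj
    exact (omega_le_maxBandwidth hn hβ ht htn).trans_lt ((maxBandwidth_lt hn).trans_le hj')
  sum_le := by
    have hω := omega_pos hn hβ ht
    calc ∑ j ∈ Finset.Icc 1 n, pinskerWeight n β t j
        ≤ ∑ j ∈ Finset.Icc 1 n, if j ≤ ⌊omega n β t⌋₊ then (1 : ℝ) else 0 := by
          refine Finset.sum_le_sum fun j _ => ?_
          split_ifs with h
          · exact (pinskerWeight_mem hn hβ ht j).2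
          · rw [pinskerWeight_of_lt hn hβ ht (Nat.lt_of_floor_lt (not_le.1 h))]
      _ = ((Finset.Icc 1 n).filter fun j => j ≤ ⌊omega n β t⌋₊).card := by
          rw [← Finset.sum_filter]; simp
      _ ≤ (Finset.Icc 1 ⌊omega n β t⌋₊).card := by
          refine Nat.cast_le.2 (Finset.card_le_card fun j => ?_)
          simp only [Finset.mem_filter, Finset.mem_Icc]; omega
      _ = ⌊omega n β t⌋₊ := by simp
      _ ≤ omega n β t := Nat.floor_le hω.le
      _ ≤ maxBandwidth n := omega_le_maxBandwidth hn hβ ht htn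

lemma one_sub_pinskerWeight_le (hn : 3 ≤ n) (hβ : 1 ≤ β) (ht : 0 < t) {j : ℕ}
    (hj : jZero n β t < j) : 1 - pinskerWeight n β t j ≤ ((j : ℝ) / omega n β t) ^ β := by
  have hω := omega_pos hn hβ ht
  rcases le_or_gt (j : ℝ) (omega n β t) with h2 | h2
  · rw [pinskerWeight_of_mid hj h2]; linarith
  · rw [pinskerWeight_of_lt hn hβ ht h2, sub_zero]
    exact one_le_pow₀ ((one_le_div hω).2 h2.le)

lemma integral_one_sub_pow_sq {ω : ℝ} (hω : 0 < ω) (hβ : 1 ≤ β) :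
    ∫ x in (0 : ℝ)..ω, (1 - (x / ω) ^ β) ^ 2
      = ω * (2 * (β : ℝ) ^ 2 / (((β : ℝ) + 1) * (2 * β + 1))) := by
  have e : ∀ x : ℝ, (1 - (x / ω) ^ β) ^ 2 = 1 - 2 / ω ^ β * x ^ β + 1 / ω ^ (2 * β) * x ^ (2 * β) := by
    intro x
    rw [div_pow]; field_simp; ring
  simp_rw [e]
  rw [intervalIntegral.integral_add (Continuous.intervalIntegrable (by fun_prop) _ _)
    (Continuous.intervalIntegrable (by fun_prop) _ _),
    intervalIntegral.integral_sub (Continuous.intervalIntegrable (by fun_prop) _ _)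
    (Continuous.intervalIntegrable (by fun_prop) _ _), intervalIntegral.integral_const_mul,
    intervalIntegral.integral_const_mul, integral_pow, integral_pow]
  simp only [intervalIntegral.integral_const, sub_zero, smul_eq_mul, mul_one]
  rw [zero_pow (by omega), zero_pow (by omega), sub_zero, sub_zero, pow_succ, pow_succ]
  have : ((2 * β : ℕ) : ℝ) = 2 * β := by push_cast; ring
  rw [this]
  field_simp
  ring

/-- The summand decreases on [0, ω], so the sum is bounded by the integral; the constant obtained is
the variance share of the Pinsker constant. -/
lemma sum_one_sub_pow_sq_le {ω : ℝ} (hω : 0 < ω) (hβ : 1 ≤ β) :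
    ∑ j ∈ Finset.Icc 1 ⌊ω⌋₊, (1 - ((j : ℝ) / ω) ^ β) ^ 2
      ≤ ω * (2 * (β : ℝ) ^ 2 / (((β : ℝ) + 1) * (2 * β + 1))) := by
  have hfl : (⌊ω⌋₊ : ℝ) ≤ ω := Nat.floor_le hω.le
  set f : ℝ → ℝ := fun x => (1 - (x / ω) ^ β) ^ 2 with hf
  have hfc : Continuous f := by fun_prop
  have hanti : AntitoneOn f (Set.Icc (0 : ℝ) (0 + (⌊ω⌋₊ : ℕ))) := by
    intro x hx y hy hxy
    rw [zero_add] at hx hy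
    have h1 : (x / ω) ^ β ≤ (y / ω) ^ β :=
      pow_le_pow_left₀ (div_nonneg hx.1 hω.le) (div_le_div_of_nonneg_right hxy hω.le) _
    have h2 : (y / ω) ^ β ≤ 1 :=
      pow_le_one₀ (div_nonneg hy.1 hω.le) ((div_le_one hω).2 (hy.2.trans hfl))
    exact pow_le_pow_left₀ (by linarith) (by linarith) 2
  have h1 := hanti.sum_le_integral
  rw [sum_Icc_one_eq_sum_range (fun j => (1 - ((j : ℝ) / ω) ^ β) ^ 2),
    ← integral_one_sub_pow_sq hω hβ]
  have h2 : ∫ x in (0 : ℝ)..(⌊ω⌋₊ : ℝ), f x ≤ ∫ x in (0 : ℝ)..ω, f x :=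
    intervalIntegral.integral_mono_interval le_rfl (by positivity) hfl
      (Eventually.of_forall fun x => sq_nonneg _) (hfc.intervalIntegrable _ _)
  simp only [zero_add] at h1
  exact h1.trans h2

/-- The flat part up to j₀ contributes at most ω/ln n, a lower-order addition to the sum of the
squared decaying weights. -/
lemma sum_pinskerWeight_sq_le (hn : 3 ≤ n) (hβ : 1 ≤ β) (ht : 0 < t) :
    ∑ j ∈ Finset.Icc 1 n, pinskerWeight n β t j ^ 2
      ≤ omega n β t * (2 * (β : ℝ) ^ 2 / (((β : ℝ) + 1) * (2 * β + 1)) + 1 / Real.log n) := by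
  have hω := omega_pos hn hβ ht
  have hL := one_le_log_nat hn
  have hterm : ∀ j ∈ Finset.Icc 1 n, pinskerWeight n β t j ^ 2
      ≤ (if j ≤ jZero n β t then 1 else 0)
        + if j ≤ ⌊omega n β t⌋₊ then (1 - ((j : ℝ) / omega n β t) ^ β) ^ 2 else 0 := by
    intro j hj
    have hj1 := (Finset.mem_Icc.1 hj).1
    rcases le_or_gt j (jZero n β t) with h | h
    · rw [pinskerWeight_of_le hj1 h, if_pos h, one_pow]
      have : (0 : ℝ) ≤ if j ≤ ⌊omega n β t⌋₊ then (1 - ((j : ℝ) / omega n β t) ^ β) ^ 2 else 0 := by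
        split_ifs <;> positivity
      linarith
    rcases le_or_gt (j : ℝ) (omega n β t) with h2 | h2
    · rw [pinskerWeight_of_mid h h2, if_neg (not_le.2 h), if_pos (Nat.le_floor h2), zero_add]
    · rw [pinskerWeight_of_lt hn hβ ht h2, if_neg (not_le.2 h),
        if_neg (not_le.2 ((Nat.floor_lt hω.le).2 h2))]; norm_num
  have h1 : ∑ j ∈ Finset.Icc 1 n, (if j ≤ jZero n β t then (1 : ℝ) else 0)
      ≤ omega n β t / Real.log n := by
    calc _ = (((Finset.Icc 1 n).filter fun j => j ≤ jZero n β t).card : ℝ) := by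
          rw [← Finset.sum_filter]; simp
      _ ≤ ((Finset.Icc 1 (jZero n β t)).card : ℝ) := by
          refine Nat.cast_le.2 (Finset.card_le_card fun j => ?_)
          simp only [Finset.mem_filter, Finset.mem_Icc]; omega
      _ = jZero n β t := by simp
      _ ≤ _ := Nat.floor_le (by positivity)
  have h2 : ∑ j ∈ Finset.Icc 1 n,
      (if j ≤ ⌊omega n β t⌋₊ then (1 - ((j : ℝ) / omega n β t) ^ β) ^ 2 else 0)
      ≤ omega n β t * (2 * (β : ℝ) ^ 2 / (((β : ℝ) + 1) * (2 * β + 1))) := by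
    rw [← Finset.sum_filter]
    refine le_trans (Finset.sum_le_sum_of_subset_of_nonneg (fun j => ?_) fun j _ _ => sq_nonneg _)
      (sum_one_sub_pow_sq_le hω hβ)
    simp only [Finset.mem_filter, Finset.mem_Icc]; omega
  calc _ ≤ _ := Finset.sum_le_sum hterm
    _ ≤ omega n β t / Real.log n
        + omega n β t * (2 * (β : ℝ) ^ 2 / (((β : ℝ) + 1) * (2 * β + 1))) := by
        rw [Finset.sum_add_distrib]; exact add_le_add h1 h2
    _ = _ := by ring

end Weights

/-! ### Bias bounds on the Sobolev class -/

section Bias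
variable {k : ℕ} {r : ℝ} {S : ℝ → ℝ}

lemma dip_sub_partialSum_le (hS : S ∈ sobolevClass k r) (hk : 1 ≤ k) (hr : 0 ≤ r) (n : ℕ) {K : ℕ}
    (hK : 1 ≤ K) : dip n (fun l => S (design n l) - partialSum S K (design n l))
      (fun l => S (design n l) - partialSum S K (design n l)) ≤ 2 * r / K := by
  rcases Nat.eq_zero_or_pos n with rfl | hn
  · simp [dip]; positivity
  have hn' : (0 : ℝ) < n := by exact_mod_cast hn
  rw [dip, inv_mul_le_iff₀ hn']
  calc _ ≤ ∑ _l : Fin n, 2 * r / K := Finset.sum_le_sum fun l _ => by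
        rw [← sq]; exact sq_sub_partialSum_le hS hk hr hK _
    _ = _ := by simp

lemma partialSum_design (S : ℝ → ℝ) (n K : ℕ) :
    (fun l => partialSum S K (design n l)) = ∑ j ∈ Finset.Icc 1 K, trigCoeff S j • phi n j := by
  funext l; simp [partialSum, phi, Finset.sum_apply]

/-- The empirical coefficients of high order are small. -/
lemma energy_tailInd_le (hS : S ∈ sobolevClass k r) (hk : 1 ≤ k) (hr : 0 ≤ r) (n : ℕ) {l : ℕ}
    (hl : 1 ≤ l) :
    energy n (fun j => dip n (fun l => S (design n l)) (phi n j)) (tailInd l) ≤ 4 * r / l := by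
  set R : Fin n → ℝ := fun i => S (design n i) - partialSum S l (design n i) with hR
  have h1 := dip_sub_partialSum_le hS hk hr n hl
  have h2 := sum_sq_dip_phi_le (Finset.Icc_subset_Icc_left (show 1 ≤ l + 1 by omega) :
    Finset.Icc (l + 1) n ⊆ Finset.Icc 1 n) R
  have h3 : energy n (fun j => dip n (fun l => S (design n l)) (phi n j)) (tailInd l)
      = ∑ j ∈ Finset.Icc (l + 1) n, dip n R (phi n j) ^ 2 := by
    have hf : Finset.Icc (l + 1) n = (Finset.Icc 1 n).filter (fun j => l < j) := by
      ext j; simp only [Finset.mem_Icc, Finset.mem_filter]; omega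
    rw [hf, Finset.sum_filter, energy]
    refine Finset.sum_congr rfl fun j hj => ?_
    unfold tailInd
    split_ifs with hlj
    · have hz : dip n (fun i => partialSum S l (design n i)) (phi n j) = 0 := by
        rw [partialSum_design, dip_sum_left]
        refine Finset.sum_eq_zero fun i hi => ?_
        rw [dip_smul_left, dip_phi_phi_of_lt (Finset.mem_Icc.1 hi).1
          (lt_of_le_of_lt (Finset.mem_Icc.1 hi).2 hlj) (Finset.mem_Icc.1 hj).2, mul_zero]
      have : R = (fun i => S (design n i)) - fun i => partialSum S l (design n i) := rfl
      rw [this, dip_sub_left, hz, sub_zero]; ring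
    · ring
  rw [h3]
  calc _ ≤ _ := h2
    _ ≤ 2 * (2 * r / l) := mul_le_mul_of_nonneg_left h1 (by norm_num)
    _ = _ := by ring

/-- Comparison of the empirical bias with its counterpart for the continuous coefficients. -/
lemma biasSq_le (hS : S ∈ sobolevClass k r) (hk : 1 ≤ k) (hr : 0 ≤ r) {n : ℕ} (hn : 2 ≤ n)
    {N : ℝ} {lam : ℕ → ℝ} (hlam : IsMonotoneWeight n N lam) {δ : ℝ} (hδ : 0 < δ) :
    biasSq n (fun l => S (design n l)) lam
      ≤ (1 + δ) * ∑ j ∈ Finset.Icc 1 (n - 1), (1 - lam j) ^ 2 * trigCoeff S j ^ 2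
        + (1 + 1 / δ) * (24 * r / n) := by
  set s : Fin n → ℝ := fun l => S (design n l) with hs
  -- Truncation at n − 1 keeps exactly the orthonormal indices, so the empirical coefficients of the
  -- truncated series `T` are the true Fourier coefficients.
  set R : Fin n → ℝ := fun i => S (design n i) - partialSum S (n - 1) (design n i) with hR
  set T : Fin n → ℝ := fun i => partialSum S (n - 1) (design n i) with hT
  have hsTR : s = T + R := by funext i; simp [hs, hT, hR]
  have hTs : T = ∑ j ∈ Finset.Icc 1 (n - 1), trigCoeff S j • phi n j := partialSum_design S n (n - 1)
  have hsub : Finset.Icc 1 (n - 1) ⊆ Finset.Icc 1 n := Finset.Icc_subset_Icc_right (by omega)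
  have hTphi : ∀ j ∈ Finset.Icc 1 (n - 1), dip n T (phi n j) = trigCoeff S j := by
    intro j hj
    rw [hTs, dip_sum_left, Finset.sum_eq_single j]
    · have := Finset.mem_Icc.1 hj
      rw [dip_smul_left, dip_phi_self this.1 (by omega), mul_one]
    · intro i hi hij
      rw [dip_smul_left, dip_phi_phi_of_ne (hsub hi) (hsub hj) hij, mul_zero]
    · exact fun h => absurd hj h
  have hsumlam : ∀ f : ℕ → (Fin n → ℝ), ∑ j ∈ Finset.Icc 1 n, (lam j) • f j
      = ∑ j ∈ Finset.Icc 1 (n - 1), (lam j) • f j := by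
    intro f
    symm
    refine Finset.sum_subset hsub fun j hj hj' => ?_
    have h1 := Finset.mem_Icc.1 hj
    rw [hlam.vanish j (by
      by_contra hlt
      exact hj' (Finset.mem_Icc.2 ⟨h1.1, by omega⟩)), zero_smul]
  set U : Fin n → ℝ := ∑ j ∈ Finset.Icc 1 n, (lam j * dip n s (phi n j)) • phi n j with hU
  set a : Fin n → ℝ := ∑ j ∈ Finset.Icc 1 (n - 1), ((1 - lam j) * trigCoeff S j) • phi n j with ha
  set Q : Fin n → ℝ := ∑ j ∈ Finset.Icc 1 (n - 1), (lam j * dip n R (phi n j)) • phi n j with hQ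
  -- The error of the noiseless estimator splits into the sequence-space bias `a` and the part due
  -- to `R`, where `Q` is the weighted projection of `R`.
  have hdec : s - U = a + (R - Q) := by
    have e1 : U = ∑ j ∈ Finset.Icc 1 (n - 1), (lam j * trigCoeff S j) • phi n j + Q := by
      rw [hU, hQ, ← Finset.sum_add_distrib]
      simp only [mul_smul]
      rw [hsumlam]
      refine Finset.sum_congr rfl fun j hj => ?_
      rw [hsTR, dip_add_left, hTphi j hj, add_smul, smul_add]
    have e2 : a = T - ∑ j ∈ Finset.Icc 1 (n - 1), (lam j * trigCoeff S j) • phi n j := by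
      rw [hTs, ha, ← Finset.sum_sub_distrib]
      exact Finset.sum_congr rfl fun j _ => by rw [sub_mul, one_mul, sub_smul]
    rw [e1, e2, hsTR]; abel
  have hbias : biasSq n s lam = dip n (s - U) (s - U) := by
    have hUU : dip n U U = ∑ j ∈ Finset.Icc 1 n, (lam j * dip n s (phi n j)) ^ 2 :=
      dip_sum_phi_of_vanish fun j hj => by rw [hlam.vanish j hj, zero_mul]
    have hsU : dip n s U = ∑ j ∈ Finset.Icc 1 n, lam j * dip n s (phi n j) ^ 2 := by
      rw [hU, dip_sum_right]
      exact Finset.sum_congr rfl fun j _ => by rw [dip_smul_right]; ring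
    rw [dip_sub_left, dip_sub_right, dip_sub_right, dip_comm n U s, hUU, hsU, biasSq]
    simp only [mul_pow]; ring
  have haa : dip n a a = ∑ j ∈ Finset.Icc 1 (n - 1), (1 - lam j) ^ 2 * trigCoeff S j ^ 2 := by
    rw [ha, dip_sum_phi hsub]
    refine Finset.sum_congr rfl fun j hj => ?_
    have := Finset.mem_Icc.1 hj
    rw [dip_phi_self this.1 (by omega)]; ring
  have hRR : dip n R R ≤ 2 * r / (n - 1 : ℕ) := dip_sub_partialSum_le hS hk hr n (by omega)
  have hRR' : dip n R R ≤ 4 * r / n := by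
    refine hRR.trans ?_
    have h1 : (0 : ℝ) < (n - 1 : ℕ) := by exact_mod_cast (show 0 < n - 1 by omega)
    have h2 : (0 : ℝ) < n := by exact_mod_cast (show 0 < n by omega)
    rw [div_le_div_iff₀ h1 h2]
    have h3 : (n : ℝ) ≤ 2 * (n - 1 : ℕ) := by exact_mod_cast (show n ≤ 2 * (n - 1) by omega)
    nlinarith
  have hQQ : dip n Q Q ≤ 2 * dip n R R := by
    rw [hQ, dip_sum_phi hsub]
    refine le_trans (Finset.sum_le_sum fun j hj => ?_) (sum_sq_dip_phi_le hsub R)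
    have h1 := Finset.mem_Icc.1 hj
    rw [dip_phi_self h1.1 (by omega), mul_one, ← sq, mul_pow]
    have h2 := hlam.nonneg j
    have h3 := hlam.le_one j
    have h4 : lam j ^ 2 ≤ 1 := by nlinarith
    nlinarith [sq_nonneg (dip n R (phi n j))]
  -- ‖R − Q‖² ≤ 2‖R‖² + 2‖Q‖² ≤ 6‖R‖², with ‖R‖² ≤ 4r/n.
  have hRQ : dip n (R - Q) (R - Q) ≤ 24 * r / n := by
    have h1 := dip_add_self_le n R ((-1 : ℝ) • Q) one_pos
    rw [dip_smul_left, dip_smul_right] at h1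
    have e : R + (-1 : ℝ) • Q = R - Q := by rw [neg_one_smul, sub_eq_add_neg]
    rw [e] at h1
    have : 24 * r / n = 6 * (4 * r / n) := by ring
    linarith
  rw [hbias, hdec, ← haa]
  refine (dip_add_self_le n a (R - Q) hδ).trans ?_
  have : 0 ≤ 1 + 1 / δ := by positivity
  linarith [mul_le_mul_of_nonneg_left hRQ this]

/-- The sharp bias bound. -/
lemma sum_one_sub_sq_mul_trigCoeff_sq_le (hS : S ∈ sobolevClass k r) (hk : 1 ≤ k) (hr : 0 ≤ r)
    {n : ℕ} (hn : 3 ≤ n) {t : ℝ} (ht : 0 < t) (hj0 : 1 ≤ jZero n k t) (K : ℕ) :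
    ∑ j ∈ Finset.Icc 1 K, (1 - pinskerWeight n k t j) ^ 2 * trigCoeff S j ^ 2
      ≤ r * (((jZero n k t : ℝ) + 1) / (jZero n k t * (Real.pi * omega n k t))) ^ (2 * k) := by
  have hω := omega_pos hn hk ht
  have hpi := Real.pi_pos
  set J := jZero n k t with hJ
  have hJ' : (0 : ℝ) < J := by exact_mod_cast hj0
  set D := (((J : ℝ) + 1) / (J * (Real.pi * omega n k t))) with hD
  have hD0 : 0 ≤ D := by positivity
  have hterm : ∀ j ∈ Finset.Icc 1 K, (1 - pinskerWeight n k t j) ^ 2 * trigCoeff S j ^ 2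
      ≤ D ^ (2 * k) * ((2 * Real.pi * ((j / 2 : ℕ) : ℝ)) ^ (2 * k) * trigCoeff S j ^ 2) := by
    intro j hj
    rw [← mul_assoc]
    refine mul_le_mul_of_nonneg_right ?_ (sq_nonneg _)
    rcases le_or_gt j J with h | h
    · rw [pinskerWeight_of_le (Finset.mem_Icc.1 hj).1 h]
      rw [sub_self, zero_pow two_ne_zero]; positivity
    · have h1 := one_sub_pinskerWeight_le hn hk ht h
      have h2 : 0 ≤ 1 - pinskerWeight n k t j := sub_nonneg.2 (pinskerWeight_mem hn hk ht j).2
      rw [← mul_pow]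
      calc (1 - pinskerWeight n k t j) ^ 2 ≤ (((j : ℝ) / omega n k t) ^ k) ^ 2 :=
            pow_le_pow_left₀ h2 h1 2
        _ = ((j : ℝ) / omega n k t) ^ (2 * k) := by rw [← pow_mul, mul_comm]
        _ ≤ _ := by
            refine pow_le_pow_left₀ (by positivity) ?_ _
            -- For odd j the frequency weight uses j − 1 in place of j. Beyond j₀ = J the ratio is
            -- at most (J + 1)/J, which tends to 1: the unit weights up to j₀ are what makes the
            -- constant sharp.
            have h3 : (j : ℝ) * J ≤ 2 * ((j / 2 : ℕ) : ℝ) * (J + 1) := by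
              have h4 : j ≤ 2 * (j / 2) + 1 := by omega
              have h5 : (j : ℝ) ≤ 2 * ((j / 2 : ℕ) : ℝ) + 1 := by exact_mod_cast h4
              have h6 : (J : ℝ) + 1 ≤ j := by exact_mod_cast h
              nlinarith
            have e : D * (2 * Real.pi * ((j / 2 : ℕ) : ℝ))
                = (2 * ((j / 2 : ℕ) : ℝ) * (J + 1)) / (J * omega n k t) := by
              rw [hD]; field_simp
            rw [e, div_le_div_iff₀ hω (by positivity)]
            calc (j : ℝ) * (J * omega n k t) = (j * J) * omega n k t := by ring
              _ ≤ _ := mul_le_mul_of_nonneg_right h3 hω.le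
  calc _ ≤ ∑ j ∈ Finset.Icc 1 K,
        D ^ (2 * k) * ((2 * Real.pi * ((j / 2 : ℕ) : ℝ)) ^ (2 * k) * trigCoeff S j ^ 2) :=
        Finset.sum_le_sum hterm
    _ ≤ D ^ (2 * k) * r := by
        rw [← Finset.mul_sum]
        exact mul_le_mul_of_nonneg_left (sum_pow_mul_trigCoeff_sq_le hS hk hr hk le_rfl K)
          (by positivity)
    _ = _ := mul_comm _ _

end Bias

/-! ### The oracle inequality for the adaptive estimator -/

/-- The indices `(β, i)` of the weight family. -/
def weightIndex (n : ℕ) : Finset (ℕ × ℕ) :=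
  Finset.Icc 1 ⌊1 / √(eps n)⌋₊ ×ˢ Finset.Icc 1 ⌊1 / (eps n) ^ 2⌋₊

/-- The weight vector with index `(β, i)`. -/
def indexedWeight (n : ℕ) (a : ℕ × ℕ) : ℕ → ℝ := pinskerWeight n a.1 (a.2 * eps n)

lemma mem_weightFamily_iff {n : ℕ} {lam : ℕ → ℝ} :
    lam ∈ weightFamily n ↔ ∃ a ∈ weightIndex n, lam = indexedWeight n a := by
  constructor
  · rintro ⟨β, i, h1, h2, h3, h4, rfl⟩
    exact ⟨(β, i), Finset.mem_product.2 ⟨Finset.mem_Icc.2 ⟨h1, h2⟩, Finset.mem_Icc.2 ⟨h3, h4⟩⟩, rfl⟩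
  · rintro ⟨⟨β, i⟩, ha, rfl⟩
    simp only [weightIndex, Finset.mem_product, Finset.mem_Icc] at ha
    exact ⟨β, i, ha.1.1, ha.1.2, ha.2.1, ha.2.2, rfl⟩

lemma eps_pos {n : ℕ} (hn : 3 ≤ n) : 0 < eps n := by
  have := one_le_log_nat hn
  unfold eps; positivity

lemma isMonotoneWeight_indexedWeight {n : ℕ} (hn : 3 ≤ n) {a : ℕ × ℕ} (ha : a ∈ weightIndex n) :
    IsMonotoneWeight n (maxBandwidth n) (indexedWeight n a) := by
  simp only [weightIndex, Finset.mem_product, Finset.mem_Icc] at ha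
  have he := eps_pos hn
  have hL := one_le_log_nat hn
  have hi : (0 : ℝ) < a.2 := by exact_mod_cast (show 0 < a.2 by omega)
  refine isMonotoneWeight_pinskerWeight hn ha.1.1 (by positivity) ?_
  have h1 : (a.2 : ℝ) ≤ 1 / eps n ^ 2 := (Nat.le_floor_iff (by positivity)).1 ha.2.2
  rw [le_div_iff₀ (by positivity)] at h1
  have h2 : Real.log n * eps n = 1 := by
    unfold eps; field_simp
  refine le_of_mul_le_mul_right ?_ he
  rw [h2]; nlinarith

lemma card_weightIndex_le {n : ℕ} (hn : 3 ≤ n) : ((weightIndex n).card : ℝ) ≤ Real.log n ^ 3 := by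
  have hL := one_le_log_nat hn
  have he := eps_pos hn
  have h1 : 1 / eps n ^ 2 = Real.log n ^ 2 := by unfold eps; field_simp
  have h2 : 1 / √(eps n) ≤ Real.log n := by
    have : 1 / √(eps n) = √(Real.log n) := by
      rw [eps, Real.sqrt_div zero_le_one, Real.sqrt_one, one_div_one_div]
    rw [this, Real.sqrt_le_left (by linarith)]
    nlinarith
  rw [weightIndex, Finset.card_product, Nat.card_Icc, Nat.card_Icc, Nat.add_sub_cancel,
    Nat.add_sub_cancel, Nat.cast_mul,
    show Real.log n ^ 3 = Real.log n * Real.log n ^ 2 by ring]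
  refine mul_le_mul ((Nat.floor_le (by positivity)).trans h2) ?_ (by positivity) (by linarith)
  rw [← h1]
  exact Nat.floor_le (by positivity)

lemma rho_pos (γ : ℝ) {n : ℕ} (hn : 3 ≤ n) : 0 < rho γ n := by
  have hL := one_le_log_nat hn
  have : 0 ≤ Real.log n ^ γ := Real.rpow_nonneg (by linarith) _
  unfold rho; positivity

lemma rho_le_one (γ : ℝ) {n : ℕ} (hn : 3 ≤ n) : rho γ n ≤ 1 := by
  have hL := one_le_log_nat hn
  have : 0 ≤ Real.log n ^ γ := Real.rpow_nonneg (by linarith) _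
  unfold rho
  rw [div_le_one (by linarith)]; linarith

/-- The data of the heteroscedastic model with uniform bounds on the scales. -/
structure ScaleBounds (k : ℕ) (r : ℝ) (g : unitInterval → L1 → ℝ≥0) (c M B : ℝ) : Prop where
  pos : 0 < c
  lower : ∀ x : unitInterval, ∀ S ∈ sobolevClass k r, c ≤ (g x (toL1 S) : ℝ) ^ 2
  upper : ∀ S ∈ sobolevClass k r, ∀ (n : ℕ) (l : Fin n), scale g n S l ^ 2 ≤ M
  varsigma_le : ∀ S ∈ sobolevClass k r, varsigma g S ≤ B

lemma lInt_bounds {n : ℕ} (hn : 3 ≤ n) : (n : ℝ) ^ (1 / 3 : ℝ) ≤ lInt n ∧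
    (lInt n : ℝ) ≤ (n : ℝ) ^ (1 / 3 : ℝ) + 1 ∧ 1 ≤ lInt n ∧ 1 ≤ (n : ℝ) ^ (1 / 3 : ℝ) := by
  have h1 : (1 : ℝ) ≤ n := by exact_mod_cast (show 1 ≤ n by omega)
  have hx : 1 ≤ (n : ℝ) ^ (1 / 3 : ℝ) := Real.one_le_rpow h1 (by norm_num)
  refine ⟨?_, Nat.floor_le (by linarith), Nat.le_floor (by push_cast; linarith), hx⟩
  have := Nat.lt_floor_add_one ((n : ℝ) ^ (1 / 3 : ℝ) + 1)
  unfold lInt; linarith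

/-- The cut-off l_n of order n^{1/3} makes the signal left in the tail O(n^{-1/3}), while the
discarded variances and the fluctuations are no larger. This compensates the n^{1/3} in the
bandwidth bound. -/
lemma maxBandwidth_mul_zetaBound_le {ξs M r : ℝ} (hξ : 0 ≤ ξs) (hM : 0 ≤ M) (hr : 0 ≤ r) {n : ℕ}
    (hn : 3 ≤ n) :
    maxBandwidth n * zetaBound ξs M (4 * r / lInt n) (1 / √(n : ℝ)) n (lInt n)
      ≤ (4 * r + 5 * M + 2 + (8 * M * r + 8 * ξs * M ^ 2)) * Real.log n := by
  obtain ⟨hl1, hl2, hl3, hx⟩ := lInt_bounds hn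
  have hL := one_le_log_nat hn
  have hn0 : (1 : ℝ) ≤ n := by exact_mod_cast (show 1 ≤ n by omega)
  set x := (n : ℝ) ^ (1 / 3 : ℝ) with hxd
  have hx0 : 0 < x := by linarith
  have hx3 : x ^ 3 = n := by
    rw [hxd, ← Real.rpow_natCast, ← Real.rpow_mul (by linarith)]; norm_num
  have hl0 : (0 : ℝ) < lInt n := by linarith
  have hT : 4 * r / lInt n ≤ 4 * r / x := div_le_div_of_nonneg_left (by linarith) hx0 hl1
  have hT2 : 4 * r / lInt n ≤ 4 * r :=
    hT.trans (div_le_self (by linarith) hx)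
  have hb : 1 / √(n : ℝ) ≤ 1 / x := by
    refine one_div_le_one_div_of_le hx0 (Real.le_sqrt_of_sq_le ?_)
    rw [← hx3]; nlinarith [sq_nonneg x, mul_nonneg (sq_nonneg x) (sub_nonneg.2 hx)]
  have hm : M * (1 + 2 * lInt n) / n ≤ 5 * M / x := by
    rw [← hx3, div_le_div_iff₀ (by positivity) hx0]
    have h1 : 1 + 2 * (lInt n : ℝ) ≤ 5 * x := by linarith
    have h2 : (1 + 2 * (lInt n : ℝ)) * x ≤ 5 * x ^ 3 := by
      calc (1 + 2 * (lInt n : ℝ)) * x ≤ 5 * x * x := mul_le_mul_of_nonneg_right h1 hx0.le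
        _ ≤ 5 * x * x * x := le_mul_of_one_le_right (by positivity) hx
        _ = _ := by ring
    nlinarith
  have hb0 : 0 ≤ 1 / √(n : ℝ) := by positivity
  have hZ : zetaBound ξs M (4 * r / lInt n) (1 / √(n : ℝ)) n (lInt n)
      ≤ (4 * r + 5 * M + 2 + (8 * M * r + 8 * ξs * M ^ 2)) / x := by
    unfold zetaBound
    have h1 : (2 * M * (4 * r / lInt n) + 8 * ξs * M ^ 2) * (1 / √(n : ℝ))
        ≤ (8 * M * r + 8 * ξs * M ^ 2) * (1 / x) := by
      refine mul_le_mul ?_ hb hb0 (by positivity)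
      nlinarith [mul_le_mul_of_nonneg_left hT2 hM]
    have e : (4 * r + 5 * M + 2 + (8 * M * r + 8 * ξs * M ^ 2)) / x
        = 4 * r / x + 5 * M / x + 2 * (1 / x) + (8 * M * r + 8 * ξs * M ^ 2) * (1 / x) := by ring
    rw [e]; linarith
  have hN : maxBandwidth n ≤ x * Real.log n := by
    rw [maxBandwidth, Real.mul_rpow (by linarith) (by linarith)]
    refine mul_le_mul_of_nonneg_left ?_ hx0.le
    calc Real.log n ^ (1 / 3 : ℝ) ≤ Real.log n ^ (1 : ℝ) :=
          Real.rpow_le_rpow_of_exponent_le hL (by norm_num)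
      _ = _ := Real.rpow_one _
  calc _ ≤ maxBandwidth n * ((4 * r + 5 * M + 2 + (8 * M * r + 8 * ξs * M ^ 2)) / x) :=
        mul_le_mul_of_nonneg_left hZ (maxBandwidth_nonneg hn)
    _ ≤ x * Real.log n * ((4 * r + 5 * M + 2 + (8 * M * r + 8 * ξs * M ^ 2)) / x) :=
        mul_le_mul_of_nonneg_right hN (by positivity)
    _ = _ := by field_simp

/-- The remainder constant of the oracle inequality. -/
def remConst (ξs M c r δ : ℝ) : ℝ :=
  4 * M + 6 * (4 * r + 5 * M + 2 + (8 * M * r + 8 * ξs * M ^ 2))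
    + (32 * ξs * M ^ 2 / c + 2 * M / δ + 8 * δ * M)

/-- Here 1/ρ = 3 + (ln n)^γ ≤ 4 (ln n)^γ, which turns 8 into 32 in `remConst`, and the family has at
most (ln n)³ members. -/
lemma oracleRem_le {ξs M c r δ γ : ℝ} (hξ : 0 ≤ ξs) (hM : 0 ≤ M) (hr : 0 ≤ r) (hc : 0 < c)
    (hδ : 0 < δ) (hγ : 0 < γ) {n : ℕ} (hn : 3 ≤ n) :
    oracleRem ξs M c (rho γ n) δ (maxBandwidth n)
        (zetaBound ξs M (4 * r / lInt n) (1 / √(n : ℝ)) n (lInt n)) (weightIndex n).card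
      ≤ remConst ξs M c r δ * Real.log n ^ (3 + γ) := by
  have hL := one_le_log_nat hn
  have hL0 : 0 < Real.log n := by linarith
  set L := Real.log n with hLd
  have hZ := maxBandwidth_mul_zetaBound_le hξ hM hr hn
  have hcard := card_weightIndex_le hn
  set C1 := 4 * r + 5 * M + 2 + (8 * M * r + 8 * ξs * M ^ 2) with hC1
  have hC1' : 0 ≤ C1 := by positivity
  have hLγ : 1 ≤ L ^ γ := Real.one_le_rpow hL hγ.le
  have hsplit : L ^ (3 + γ) = L ^ 3 * L ^ γ := by
    rw [Real.rpow_add hL0]; congr 1; exact_mod_cast Real.rpow_natCast L 3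
  have hL3 : L ≤ L ^ 3 := by nlinarith [sq_nonneg L, mul_nonneg (sq_nonneg L) (sub_nonneg.2 hL)]
  have hρ : 8 * ξs * M ^ 2 / (rho γ n * c) ≤ 32 * ξs * M ^ 2 / c * L ^ γ := by
    have : 8 * ξs * M ^ 2 / (rho γ n * c) = 8 * ξs * M ^ 2 / c * (3 + L ^ γ) := by
      rw [rho, ← hLd]; field_simp
    rw [this]
    have h1 : 0 ≤ 8 * ξs * M ^ 2 / c := by positivity
    have h2 : 32 * ξs * M ^ 2 / c = 4 * (8 * ξs * M ^ 2 / c) := by ring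
    rw [h2]; nlinarith
  have hA : 0 ≤ 32 * ξs * M ^ 2 / c := by positivity
  have hB : 0 ≤ 2 * M / δ + 8 * δ * M := by positivity
  have hin : 8 * ξs * M ^ 2 / (rho γ n * c) + 2 * M / δ + 8 * δ * M
      ≤ (32 * ξs * M ^ 2 / c + 2 * M / δ + 8 * δ * M) * L ^ γ := by nlinarith
  have hin0 : 0 ≤ 8 * ξs * M ^ 2 / (rho γ n * c) + 2 * M / δ + 8 * δ * M := by
    have := rho_pos γ hn
    positivity
  have h3 : ((weightIndex n).card : ℝ) * (8 * ξs * M ^ 2 / (rho γ n * c) + 2 * M / δ + 8 * δ * M)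
      ≤ (32 * ξs * M ^ 2 / c + 2 * M / δ + 8 * δ * M) * (L ^ 3 * L ^ γ) := by
    calc _ ≤ L ^ 3 * ((32 * ξs * M ^ 2 / c + 2 * M / δ + 8 * δ * M) * L ^ γ) :=
          mul_le_mul hcard hin hin0 (by positivity)
      _ = _ := by ring
  have hLL : L ≤ L ^ 3 * L ^ γ := hL3.trans (le_mul_of_one_le_right (by positivity) hLγ)
  have h4 : 4 * M ≤ 4 * M * (L ^ 3 * L ^ γ) := le_mul_of_one_le_right (by positivity) (hL.trans hLL)
  have h5 : 6 * (maxBandwidth n * zetaBound ξs M (4 * r / lInt n) (1 / √(n : ℝ)) n (lInt n))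
      ≤ 6 * (C1 * (L ^ 3 * L ^ γ)) :=
    mul_le_mul_of_nonneg_left (hZ.trans (mul_le_mul_of_nonneg_left hLL hC1')) (by norm_num)
  rw [oracleRem, remConst, hsplit, ← hC1]
  linarith

/-- The right side of `oracle_inequality` depends on the noise law only through `ξs`, so the
supremum over densities costs nothing. -/
theorem risk_le {k : ℕ} (hk : 1 ≤ k) {r : ℝ} (hr : 0 ≤ r) {γ ξs : ℝ} (hγ : 0 < γ) (hξs : 0 ≤ ξs)
    {g : unitInterval → L1 → ℝ≥0} {c M B : ℝ} (hg : ScaleBounds k r g c M B) {n : ℕ} (hn : 3 ≤ n)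
    {Shat : (Fin n → ℝ) → ℝ → ℝ} (hShat : IsAdaptiveEstimator γ n Shat) {S : ℝ → ℝ}
    (hS : S ∈ sobolevClass k r) {δ : ℝ} (hδ : 0 < δ) (hδ4 : 4 * δ < 1)
    {a : ℕ × ℕ} (ha : a ∈ weightIndex n) :
    risk g ξs n Shat S ≤ ENNReal.ofReal ((1 - 4 * δ)⁻¹ * ((1 + 4 * δ) *
        (biasSq n (fun l => S (design n l)) (indexedWeight n a)
          + ∑ j ∈ Finset.Icc 1 n, indexedWeight n a j ^ 2 * noiseVar n (scale g n S) j)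
        + rho γ n * (∑ j ∈ Finset.Icc 1 n, indexedWeight n a j ^ 2) * meanVar n (scale g n S) / n
        + remConst ξs M c r δ * Real.log n ^ (3 + γ) / n)) := by
  have hn0 : 0 < n := by omega
  have hn' : (0 : ℝ) < n := by exact_mod_cast hn0
  obtain ⟨lamHat, -, hlam⟩ := hShat
  have hM : 0 ≤ M := (sq_nonneg _).trans (hg.upper S hS n ⟨0, hn0⟩)
  refine iSup_le fun p => ?_
  have hlaw := p.2.isNoiseLaw hξs
  have key := oracle_inequality (ι := ℕ × ℕ) hlaw hn0 (σ := scale g n S) (M := M) (c := c)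
    (S := S) (T := 4 * r / lInt n) (b := 1 / √(n : ℝ)) (N := maxBandwidth n) (δ := δ) (γ := γ)
    hg.pos (hg.upper S hS n) (fun l => hg.lower (design n l) S hS)
    (energy_tailInd_le hS hk hr n (lInt_bounds hn).2.2.1) (by positivity)
    (by rw [div_pow, Real.sq_sqrt hn'.le, one_pow]) hδ hδ4 (rho_pos γ hn) (rho_le_one γ hn)
    (W := weightIndex n) (w := indexedWeight n) (fun i hi => isMonotoneWeight_indexedWeight hn hi) ha
    (lamHat := lamHat) (fun y => mem_weightFamily_iff.1 (hlam y).1)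
    (fun y => (hlam y).2.1 _ (mem_weightFamily_iff.2 ⟨a, ha, rfl⟩))
  rw [obsLaw]
  refine (lintegral_map_le _ _).trans ?_
  simp only [fun y => (hlam y).2.2]
  refine key.trans (ENNReal.ofReal_le_ofReal ?_)
  have := oracleRem_le (c := c) hξs hM hr hg.pos hδ hγ hn
  have h1 : 0 < 1 - 4 * δ := by linarith
  gcongr

/-! ### The Pinsker constant -/

/-- The optimal bandwidth `(A_k r n / ς)^{1/(2k+1)}`. -/
def optBandwidth (k : ℕ) (r : ℝ) (n : ℕ) (v : ℝ) : ℝ := omega n k (r / v)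

lemma omega_pow {k : ℕ} {n : ℕ} {t : ℝ} (hn : 3 ≤ n) (hk : 1 ≤ k) (ht : 0 < t) :
    omega n k t ^ (2 * k + 1) = aConst k * t * n := by
  have hA := aConst_pos hk
  rw [omega, ← Real.rpow_natCast, ← Real.rpow_mul (by positivity)]
  push_cast
  rw [one_div_mul_cancel (by positivity), Real.rpow_one]

/-- The constant A_k is what makes the worst-case bias at this bandwidth equal to 1/(2k) times the
leading variance term. -/
lemma bias_main_eq {k : ℕ} {n : ℕ} {r v : ℝ} (hn : 3 ≤ n) (hk : 1 ≤ k) (hr : 0 < r) (hv : 0 < v) :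
    r * (1 / (Real.pi * optBandwidth k r n v)) ^ (2 * k)
      = optBandwidth k r n v * v / n * ((k : ℝ) / (((k : ℝ) + 1) * (2 * k + 1))) := by
  have hn' : (0 : ℝ) < n := by exact_mod_cast (show 0 < n by omega)
  have ht : 0 < r / v := by positivity
  have hω := omega_pos hn hk ht
  have hpow := omega_pow hn hk ht
  have hpi := Real.pi_pos
  have hk' : (0 : ℝ) < k := by exact_mod_cast hk
  unfold optBandwidth
  set ω := omega n k (r / v)
  rw [pow_succ] at hpow
  rw [one_div, inv_pow, mul_pow]
  have hA : aConst k = ((k : ℝ) + 1) * (2 * k + 1) / (Real.pi ^ (2 * k) * k) := rfl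
  rw [hA] at hpow
  field_simp at hpow ⊢
  linear_combination -hpow

/-- Both sides are positive products of powers; taking logarithms reduces the identity to a linear
one. -/
lemma pinskerConst_eq {k : ℕ} {n : ℕ} {r : ℝ} {g : unitInterval → L1 → ℝ≥0} {S : ℝ → ℝ}
    (hn : 3 ≤ n) (hk : 1 ≤ k) (hr : 0 < r) (hv : 0 < varsigma g S) :
    optBandwidth k r n (varsigma g S) * varsigma g S / n * ((k : ℝ) / ((k : ℝ) + 1))
      = pinskerConst k r g S * (n : ℝ) ^ (-(2 * (k : ℝ) / (2 * (k : ℝ) + 1))) := by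
  have hn' : (0 : ℝ) < n := by exact_mod_cast (show 0 < n by omega)
  have hk' : (0 : ℝ) < k := by exact_mod_cast hk
  have hpi := Real.pi_pos
  set v := varsigma g S with hvd
  have hA := aConst_pos hk
  unfold optBandwidth omega pinskerConst
  rw [← hvd]
  have hq : (2 * (k : ℝ) + 1) ≠ 0 := by positivity
  refine Real.log_injOn_pos (Set.mem_Ioi.2 (by positivity)) (Set.mem_Ioi.2 (by positivity)) ?_
  have hlA : Real.log (aConst k) = Real.log ((k : ℝ) + 1) + Real.log (2 * k + 1)
      - (2 * k * Real.log Real.pi + Real.log k) := by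
    unfold aConst
    rw [Real.log_div (by positivity) (by positivity), Real.log_mul (by positivity) (by positivity),
      Real.log_mul (by positivity) (by positivity), Real.log_pow]
    push_cast; ring
  rw [Real.log_mul (by positivity) (by positivity), Real.log_div (by positivity) (by positivity),
    Real.log_mul (by positivity) (by positivity), Real.log_rpow (by positivity),
    Real.log_mul (by positivity) (by positivity), Real.log_mul (by positivity) (by positivity),
    Real.log_div (by positivity) (by positivity), Real.log_div (by positivity) (by positivity), hlA,
    Real.log_mul (by positivity) (by positivity), Real.log_mul (by positivity) (by positivity),
    Real.log_mul (by positivity) (by positivity), Real.log_mul (by positivity) (by positivity),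
    Real.log_rpow (by positivity), Real.log_rpow (by positivity), Real.log_rpow (by positivity),
    Real.log_rpow (by positivity), Real.log_rpow (by positivity),
    Real.log_div (by positivity) (by positivity), Real.log_mul (by positivity) (by positivity)]
  field_simp
  ring

/-! ### Sharp upper bound -/

lemma omega_mono {k n : ℕ} (hk : 1 ≤ k) {t u : ℝ} (ht : 0 ≤ t) (htu : t ≤ u) :
    omega n k t ≤ omega n k u := by
  have hA := aConst_pos hk
  unfold omega
  refine Real.rpow_le_rpow (by positivity) ?_ (by positivity)
  gcongr

/-- The exponent 1/(2k + 1) is at most 1, so a relative error of t does not grow when passing to ω.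
-/
lemma mul_omega_le {k n : ℕ} (hk : 1 ≤ k) {t u δ : ℝ} (ht : 0 ≤ t) (hδ0 : 0 < δ) (hδ : δ < 1)
    (htu : (1 - δ) * t ≤ u) : (1 - δ) * omega n k t ≤ omega n k u := by
  have hA := aConst_pos hk
  have h1 : 0 < 1 - δ := by linarith
  refine le_trans ?_ (omega_mono hk (by positivity) htu)
  unfold omega
  rw [show aConst k * ((1 - δ) * t) * n = (1 - δ) * (aConst k * t * n) by ring,
    Real.mul_rpow h1.le (by positivity)]
  refine mul_le_mul_of_nonneg_right ?_ (by positivity)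
  calc (1 - δ) = (1 - δ) ^ (1 : ℝ) := (Real.rpow_one _).symm
    _ ≤ _ := Real.rpow_le_rpow_of_exponent_ge h1 (by linarith) (by
        rw [div_le_one (by positivity)]
        have : (0 : ℝ) ≤ k := by positivity
        linarith)

/-- The variance of a weighted least squares estimator. -/
lemma IsMonotoneWeight.sum_sq_mul_noiseVar_le {n : ℕ} {N M : ℝ} {w : ℕ → ℝ}
    (hw : IsMonotoneWeight n N w) (hn : 0 < n) {σ : Fin n → ℝ} (hσ : ∀ l, σ l ^ 2 ≤ M) :
    ∑ j ∈ Finset.Icc 1 n, w j ^ 2 * noiseVar n σ j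
      ≤ (∑ j ∈ Finset.Icc 1 n, w j ^ 2) * meanVar n σ / n + M / n := by
  have h1 := abs_sum_mul_noiseVar_sub_le hn hσ (lam := fun j => w j ^ 2)
    (fun i j h h' => pow_le_pow_left₀ (hw.nonneg j) (hw.antitone i j h h') 2)
    (fun j => sq_nonneg _) (by nlinarith [hw.nonneg 1, hw.le_one 1])
  have h2 : ∑ j ∈ Finset.Icc 1 n, w j ^ 2 * (noiseVar n σ j - meanVar n σ / n)
      = ∑ j ∈ Finset.Icc 1 n, w j ^ 2 * noiseVar n σ j
        - (∑ j ∈ Finset.Icc 1 n, w j ^ 2) * meanVar n σ / n := by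
    rw [mul_div_assoc, Finset.sum_mul, ← Finset.sum_sub_distrib]
    exact Finset.sum_congr rfl fun j _ => by ring
  have h3 := (abs_le.1 h1).2
  rw [h2] at h3
  linarith

lemma le_varsigma {k : ℕ} {r : ℝ} {g : unitInterval → L1 → ℝ≥0} {c M B : ℝ}
    (hg : ScaleBounds k r g c M B) (hH1 : ConditionH1 k r g) {S : ℝ → ℝ}
    (hS : S ∈ sobolevClass k r) : c ≤ varsigma g S := by
  have hint := (hH1.square_integrable S hS).integrable_sq
  calc c = ∫ _x : unitInterval, c := by simp
    _ ≤ varsigma g S := integral_mono (integrable_const _) hint fun x => hg.lower x S hS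

/-- The factor by which the risk bound exceeds the Pinsker bound. -/
def excess (k : ℕ) (δ : ℝ) : ℝ :=
  (1 - 4 * δ)⁻¹ * ((1 + 4 * δ) * (1 + δ) ^ 2 * ((1 + δ) / (1 - δ)) ^ (2 * k)
    + δ * (1 + δ) ^ 2 + δ)

/-- The properties of `n` under which the nonasymptotic bound holds. -/
structure LargeSample (k : ℕ) (r γ ξs : ℝ) (g : unitInterval → L1 → ℝ≥0) (c M B δ : ℝ) (n : ℕ) :
    Prop where
  three_le : 3 ≤ n
  smoothness : k ≤ ⌊1 / √(eps n)⌋₊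
  grid_fine : 1 / Real.log n ≤ δ * (r / B)
  grid_range : r / c ≤ Real.log n
  meanVar_close : ∀ S ∈ sobolevClass k r, meanVar n (scale g n S) ≤ varsigma g S + δ * c
  log_large : 1 / Real.log n ≤ δ * (2 * (k : ℝ) ^ 2 / (((k : ℝ) + 1) * (2 * k + 1)))
  bandwidth_large : (1 / δ + 1) * Real.log n ≤ (1 - δ) * omega n k (r / B)
  rho_small : rho γ n ≤ δ
  rem_small : (1 + 4 * δ) * ((1 + 1 / δ) * (24 * r) + M)
    + remConst ξs M c r δ * Real.log n ^ (3 + γ)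
    ≤ δ * (omega n k (r / B) * c * ((k : ℝ) / ((k : ℝ) + 1)))

-- The comparison weight has β = k and t equal to the grid point just below r/ς(S). Bias, variance,
-- penalty and remainder are each compared with E = ω₀ς/n, where ω₀ is the optimal bandwidth, and a
-- single δ bounds all relative errors.
set_option maxHeartbeats 400000 in
theorem risk_le_of_largeSample {k : ℕ} (hk : 1 ≤ k) {r : ℝ} (hr : 0 < r) {γ ξs : ℝ} (hγ : 0 < γ)
    (hξs : 0 ≤ ξs) {g : unitInterval → L1 → ℝ≥0} {c M B : ℝ} (hg : ScaleBounds k r g c M B)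
    (hH1 : ConditionH1 k r g) {δ : ℝ} (hδ : 0 < δ) (hδ4 : 4 * δ < 1) {n : ℕ}
    (hn : LargeSample k r γ ξs g c M B δ n)
    {Shat : (Fin n → ℝ) → ℝ → ℝ} (hShat : IsAdaptiveEstimator γ n Shat) {S : ℝ → ℝ}
    (hS : S ∈ sobolevClass k r) :
    risk g ξs n Shat S ≤ ENNReal.ofReal (excess k δ *
      (pinskerConst k r g S * (n : ℝ) ^ (-(2 * (k : ℝ) / (2 * (k : ℝ) + 1))))) := by
  have hn3 := hn.three_le
  have hn0 : 0 < n := by omega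
  have hn' : (0 : ℝ) < n := by exact_mod_cast hn0
  have hk' : (0 : ℝ) < k := by exact_mod_cast hk
  have hc := hg.pos
  have hpi := Real.pi_pos
  set v := varsigma g S with hv
  have hcv : c ≤ v := le_varsigma hg hH1 hS
  have hvB : v ≤ B := hg.varsigma_le S hS
  have hv0 : 0 < v := hc.trans_le hcv
  have hB0 : 0 < B := hv0.trans_le hvB
  have hM : 0 ≤ M := (sq_nonneg _).trans (hg.upper S hS n ⟨0, hn0⟩)
  have hL := one_le_log_nat hn3
  set L := Real.log n with hLd
  have hL0 : 0 < L := by linarith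
  have hδ1 : δ < 1 := by linarith
  -- discretisation of `r / v`
  set t := r / v with ht
  have ht0 : 0 < t := by positivity
  have htB : r / B ≤ t := div_le_div_of_nonneg_left hr.le hv0 hvB
  have htc : t ≤ r / c := div_le_div_of_nonneg_left hr.le hc hcv
  have hrB : 0 < r / B := by positivity
  have hfine : 1 / L ≤ δ * t := hn.grid_fine.trans (mul_le_mul_of_nonneg_left htB hδ.le)
  set i := ⌊t * L⌋₊ with hi
  have hi1 : 1 ≤ i := by
    refine Nat.le_floor ?_
    rw [Nat.cast_one]
    rw [div_le_iff₀ hL0] at hfine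
    have : 0 ≤ t * L := by positivity
    nlinarith
  have hiu : (i : ℝ) ≤ t * L := Nat.floor_le (by positivity)
  have hil : t * L < i + 1 := Nat.lt_floor_add_one _
  have heps : eps n = 1 / L := rfl
  have ha : ((k, i) : ℕ × ℕ) ∈ weightIndex n := by
    refine Finset.mem_product.2 ⟨Finset.mem_Icc.2 ⟨hk, hn.smoothness⟩, Finset.mem_Icc.2 ⟨hi1, ?_⟩⟩
    refine Nat.le_floor ?_
    have e : 1 / eps n ^ 2 = L ^ 2 := by rw [heps]; field_simp
    rw [e, sq]
    exact hiu.trans (mul_le_mul_of_nonneg_right (htc.trans hn.grid_range) hL0.le)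
  set u := (i : ℝ) * eps n with hu
  have hi0 : (0 : ℝ) < i := by exact_mod_cast hi1
  have hu0 : 0 < u := mul_pos hi0 (eps_pos hn3)
  have hut : u ≤ t := by
    rw [hu, heps, mul_one_div, div_le_iff₀ hL0]; exact hiu
  have htu : (1 - δ) * t ≤ u := by
    have h1 : t - 1 / L ≤ u := by
      rw [hu, heps, mul_one_div, le_div_iff₀ hL0, sub_mul, one_div_mul_cancel hL0.ne']
      linarith
    linarith
  set ω := omega n k u with hω
  set ω₀ := omega n k t with hω₀
  have hω0 : 0 < ω := omega_pos hn3 hk hu0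
  have hω₀0 : 0 < ω₀ := omega_pos hn3 hk ht0
  have hωle : ω ≤ ω₀ := omega_mono hk hu0.le hut
  have hωge : (1 - δ) * ω₀ ≤ ω := mul_omega_le hk ht0.le hδ hδ1 htu
  have hωB : omega n k (r / B) ≤ ω₀ := omega_mono hk hrB.le htB
  set w := indexedWeight n (k, i) with hw
  have hwW := isMonotoneWeight_indexedWeight hn3 ha
  rw [← hw] at hwW
  -- the bias
  set J := jZero n k u with hJ
  have hδ10 : 0 < 1 - δ := by linarith
  -- J ≥ 1/δ gives (J + 1)/J ≤ 1 + δ, so the parity correction in the sharp bias bound is within the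
  -- allowed error.
  have hJδ : 1 / δ ≤ J := by
    have h1 : ω / L < J + 1 := Nat.lt_floor_add_one _
    have h2 : 1 / δ + 1 ≤ ω / L := by
      rw [le_div_iff₀ hL0]
      refine hn.bandwidth_large.trans (le_trans ?_ hωge)
      exact mul_le_mul_of_nonneg_left hωB hδ10.le
    linarith
  have hJ0 : (0 : ℝ) < J := lt_of_lt_of_le (by positivity) hJδ
  have hJ1 : 1 ≤ J := by exact_mod_cast hJ0
  set κ := 2 * (k : ℝ) ^ 2 / (((k : ℝ) + 1) * (2 * k + 1)) with hκ
  set κ' := (k : ℝ) / (((k : ℝ) + 1) * (2 * k + 1)) with hκ'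
  have hκ0 : 0 ≤ κ := by positivity
  have hκ'0 : 0 ≤ κ' := by positivity
  have hκsum : κ' + κ = (k : ℝ) / ((k : ℝ) + 1) := by
    rw [hκ, hκ']; field_simp; ring
  set E := ω₀ * v / n with hE
  have hE0 : 0 < E := by positivity
  set Q := ((1 + δ) / (1 - δ)) ^ (2 * k) with hQ
  have hQ1 : 1 ≤ Q := one_le_pow₀ ((one_le_div hδ10).2 (by linarith))
  have hbias : biasSq n (fun l => S (design n l)) w
      ≤ (1 + δ) * (Q * (E * κ')) + (1 + 1 / δ) * (24 * r / n) := by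
    refine (biasSq_le hS hk hr.le (by omega) hwW hδ).trans ?_
    have h1 : ∑ j ∈ Finset.Icc 1 (n - 1), (1 - w j) ^ 2 * trigCoeff S j ^ 2
        ≤ r * (((J : ℝ) + 1) / (J * (Real.pi * ω))) ^ (2 * k) :=
      sum_one_sub_sq_mul_trigCoeff_sq_le hS hk hr.le hn3 hu0 hJ1 (n - 1)
    have h2 : ((J : ℝ) + 1) / (J * (Real.pi * ω)) ≤ (1 + δ) / (1 - δ) * (1 / (Real.pi * ω₀)) := by
      rw [div_mul_div_comm, mul_one, div_le_div_iff₀ (by positivity) (by positivity)]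
      have h3 : (J : ℝ) + 1 ≤ (1 + δ) * J := by
        have : 1 ≤ J * δ := (div_le_iff₀ hδ).1 hJδ
        linarith
      calc ((J : ℝ) + 1) * ((1 - δ) * (Real.pi * ω₀))
          = ((J : ℝ) + 1) * Real.pi * ((1 - δ) * ω₀) := by ring
        _ ≤ ((1 + δ) * J) * Real.pi * ω := by gcongr
        _ = _ := by ring
    have h4 : r * (((J : ℝ) + 1) / (J * (Real.pi * ω))) ^ (2 * k) ≤ Q * (E * κ') := by
      calc _ ≤ r * ((1 + δ) / (1 - δ) * (1 / (Real.pi * ω₀))) ^ (2 * k) := by gcongr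
        _ = Q * (r * (1 / (Real.pi * ω₀)) ^ (2 * k)) := by rw [mul_pow]; ring
        _ = _ := by
          have := bias_main_eq hn3 hk hr hv0
          rw [optBandwidth] at this
          rw [this]
    have h5 : 0 ≤ 1 + δ := by linarith
    linarith [mul_le_mul_of_nonneg_left (h1.trans h4) h5]
  -- the variance
  set σ := scale g n S with hσ
  set P2 := ∑ j ∈ Finset.Icc 1 n, w j ^ 2 with hP2
  have hV : meanVar n σ ≤ (1 + δ) * v := by
    have := hn.meanVar_close S hS
    nlinarith
  have hV0 : 0 ≤ meanVar n σ := hc.le.trans (le_meanVar hn0 fun l => hg.lower (design n l) S hS)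
  have hP2le : P2 ≤ ω₀ * (κ * (1 + δ)) := by
    have h1 : P2 ≤ ω * (κ + 1 / L) := sum_pinskerWeight_sq_le hn3 hk hu0
    have h2 := hn.log_large
    calc P2 ≤ ω * (κ + 1 / L) := h1
      _ ≤ ω₀ * (κ * (1 + δ)) := by
        refine mul_le_mul hωle ?_ (by positivity) hω₀0.le
        linarith
  have hmain : P2 * meanVar n σ / n ≤ (1 + δ) ^ 2 * (E * κ) := by
    have h1 : P2 * meanVar n σ ≤ ω₀ * (κ * (1 + δ)) * ((1 + δ) * v) :=
      mul_le_mul hP2le hV hV0 (by positivity)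
    calc _ ≤ ω₀ * (κ * (1 + δ)) * ((1 + δ) * v) / n := div_le_div_of_nonneg_right h1 hn'.le
      _ = _ := by rw [hE]; ring
  have hvar : ∑ j ∈ Finset.Icc 1 n, w j ^ 2 * noiseVar n σ j
      ≤ (1 + δ) ^ 2 * (E * κ) + M / n := by
    exact (hwW.sum_sq_mul_noiseVar_le hn0 (hg.upper S hS n)).trans (by linarith)
  -- conclusion
  refine (risk_le hk hr.le hγ hξs hg hn3 hShat hS hδ hδ4 ha).trans (ENNReal.ofReal_le_ofReal ?_)
  have hΓ := pinskerConst_eq (S := S) (g := g) hn3 hk hr hv0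
  rw [optBandwidth] at hΓ
  rw [← hΓ, ← hκsum, excess, mul_assoc (1 - 4 * δ)⁻¹]
  have hδ40 : 0 < 1 - 4 * δ := by linarith
  refine mul_le_mul_of_nonneg_left ?_ (by positivity)
  have hrem : ((1 + 4 * δ) * ((1 + 1 / δ) * (24 * r) + M)
      + remConst ξs M c r δ * L ^ (3 + γ)) / n ≤ δ * (E * (κ' + κ)) := by
    have h1 : omega n k (r / B) * c * ((k : ℝ) / ((k : ℝ) + 1))
        ≤ ω₀ * v * ((k : ℝ) / ((k : ℝ) + 1)) :=
      mul_le_mul_of_nonneg_right (mul_le_mul hωB hcv hc.le hω₀0.le) (by positivity)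
    rw [div_le_iff₀ hn', hκsum]
    refine hn.rem_small.trans ?_
    calc _ ≤ δ * (ω₀ * v * ((k : ℝ) / ((k : ℝ) + 1))) := mul_le_mul_of_nonneg_left h1 hδ.le
      _ = _ := by rw [hE]; field_simp
  have hpen : rho γ n * P2 * meanVar n σ / n ≤ δ * ((1 + δ) ^ 2 * (E * κ)) := by
    have h0 : 0 ≤ P2 * meanVar n σ / n := by positivity
    calc rho γ n * P2 * meanVar n σ / n = rho γ n * (P2 * meanVar n σ / n) := by ring
      _ ≤ δ * ((1 + δ) ^ 2 * (E * κ)) := mul_le_mul hn.rho_small hmain h0 hδ.le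
  have hx : 0 ≤ E * κ := by positivity
  have hx' : 0 ≤ E * κ' := by positivity
  have b1 : (1 + δ) * (Q * (E * κ')) ≤ (1 + δ) ^ 2 * Q * (E * κ') := by
    rw [sq, mul_assoc, mul_assoc]
    refine mul_le_mul_of_nonneg_left ?_ (by linarith)
    exact le_mul_of_one_le_left (by positivity) (by linarith)
  -- The variance is given the factor `Q` ≥ 1 that only the bias needs, so that `κ'` and `κ` can be
  -- added to k/(k + 1).
  have b2 : (1 + δ) ^ 2 * (E * κ) ≤ (1 + δ) ^ 2 * Q * (E * κ) := by
    rw [mul_assoc]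
    exact mul_le_mul_of_nonneg_left (le_mul_of_one_le_left hx hQ1) (by positivity)
  have b3 : δ * ((1 + δ) ^ 2 * (E * κ)) ≤ δ * (1 + δ) ^ 2 * (E * (κ' + κ)) := by
    rw [mul_assoc]
    have : (1 + δ) ^ 2 * (E * κ) ≤ (1 + δ) ^ 2 * (E * (κ' + κ)) :=
      mul_le_mul_of_nonneg_left (by linarith [mul_add E κ' κ]) (by positivity)
    exact mul_le_mul_of_nonneg_left this hδ.le
  have hsum : biasSq n (fun l => S (design n l)) w + ∑ j ∈ Finset.Icc 1 n, w j ^ 2 * noiseVar n σ j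
      ≤ (1 + δ) ^ 2 * Q * (E * (κ' + κ)) + ((1 + 1 / δ) * (24 * r) + M) / n := by
    have e : ((1 + 1 / δ) * (24 * r) + M) / n = (1 + 1 / δ) * (24 * r / n) + M / n := by ring
    have e2 : (1 + δ) ^ 2 * Q * (E * (κ' + κ))
      = (1 + δ) ^ 2 * Q * (E * κ') + (1 + δ) ^ 2 * Q * (E * κ) := by ring
    rw [e, e2]; linarith
  have hsum' := mul_le_mul_of_nonneg_left hsum (show 0 ≤ 1 + 4 * δ by linarith)
  have e3 : ((1 + 4 * δ) * ((1 + 1 / δ) * (24 * r) + M)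
      + remConst ξs M c r δ * L ^ (3 + γ)) / n
      = (1 + 4 * δ) * (((1 + 1 / δ) * (24 * r) + M) / n) + remConst ξs M c r δ * L ^ (3 + γ) / n := by
    ring
  rw [e3] at hrem
  linarith

/-! ### Large samples and the limit of the error factor. -/

lemma eventually_log_rpow_le (s : ℝ) {τ : ℝ} (hτ : 0 < τ) {a : ℝ} (ha : 0 < a) :
    ∀ᶠ n : ℕ in atTop, Real.log n ^ s ≤ a * (n : ℝ) ^ τ := by
  have h := ((isLittleO_log_rpow_rpow_atTop s hτ).comp_tendsto
    (tendsto_natCast_atTop_atTop (R := ℝ))).bound ha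
  filter_upwards [h, eventually_ge_atTop 3] with n hn h3
  have hL := one_le_log_nat h3
  simp only [Function.comp, Real.norm_eq_abs] at hn
  rw [abs_of_nonneg (Real.rpow_nonneg (by linarith) _),
    abs_of_nonneg (Real.rpow_nonneg (by positivity) _)] at hn
  exact hn

/-- The bandwidth ω grows like n^{1/(2k+1)} and beats every power of ln n; the remaining
requirements say that ln n is large or that the Riemann sums in `ConditionH1` are uniformly close.
-/
lemma eventually_largeSample {k : ℕ} (hk : 1 ≤ k) {r : ℝ} (hr : 0 < r) {γ ξs : ℝ} (hγ : 0 < γ)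
    {g : unitInterval → L1 → ℝ≥0} {c M B : ℝ} (hc : 0 < c) (hB : 0 < B)
    (hH1 : ConditionH1 k r g) {δ : ℝ} (hδ : 0 < δ) (hδ4 : 4 * δ < 1) :
    ∀ᶠ n : ℕ in atTop, LargeSample k r γ ξs g c M B δ n := by
  have hk' : (0 : ℝ) < k := by exact_mod_cast hk
  have hA := aConst_pos hk
  have hδ1 : 0 < 1 - δ := by linarith
  set τ := 1 / (2 * (k : ℝ) + 1) with hτd
  have hτ : 0 < τ := by positivity
  set a := (aConst k * (r / B)) ^ τ with ha
  have ha0 : 0 < a := by positivity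
  have hω : ∀ n : ℕ, omega n k (r / B) = a * (n : ℝ) ^ τ := fun n => by
    rw [omega, Real.mul_rpow (by positivity) (by positivity)]
  have hlog : Tendsto (fun n : ℕ => Real.log n) atTop atTop :=
    Real.tendsto_log_atTop.comp tendsto_natCast_atTop_atTop
  have hinv : Tendsto (fun n : ℕ => 1 / Real.log n) atTop (𝓝 0) := by
    simp only [one_div]; exact hlog.inv_tendsto_atTop
  have hmv := Metric.tendstoUniformlyOn_iff.1 hH1.riemann_sums (δ * c) (by positivity)
  set C := |(1 + 4 * δ) * ((1 + 1 / δ) * (24 * r) + M)| + |remConst ξs M c r δ| + 1 with hC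
  have hC0 : 0 < C := by positivity
  have e1 := eventually_log_rpow_le (3 + γ) hτ
    (a := (1 - δ) * a / (1 / δ + 1)) (by positivity)
  have e2 := eventually_log_rpow_le (3 + γ) hτ
    (a := δ * (a * c * ((k : ℝ) / ((k : ℝ) + 1))) / C) (by positivity)
  filter_upwards [eventually_ge_atTop 3, hlog.eventually_ge_atTop ((k : ℝ) ^ 2),
    hinv.eventually_le_const (show 0 < δ * (r / B) by positivity),
    hlog.eventually_ge_atTop (r / c), hmv,
    hinv.eventually_le_const (show 0 < δ * (2 * (k : ℝ) ^ 2 / (((k : ℝ) + 1) * (2 * k + 1))) by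
      positivity), e1, e2,
    ((tendsto_rpow_atTop hγ).comp hlog).eventually_ge_atTop (1 / δ)]
    with n h3 h4 h5 h6 h7 h8 h9 h10 h11
  have hL := one_le_log_nat h3
  have hLs : Real.log n ≤ Real.log n ^ (3 + γ) := by
    calc Real.log n = Real.log n ^ (1 : ℝ) := (Real.rpow_one _).symm
      _ ≤ _ := Real.rpow_le_rpow_of_exponent_le hL (by linarith)
  refine ⟨h3, ?_, h5, h6, ?_, h8, ?_, ?_, ?_⟩
  · refine Nat.le_floor ?_
    rw [eps, Real.sqrt_div zero_le_one, Real.sqrt_one, one_div_one_div]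
    exact Real.le_sqrt_of_sq_le h4
  · intro S hS
    have := h7 S hS
    rw [Real.dist_eq, abs_sub_comm] at this
    have h12 := (abs_lt.1 this).2
    unfold meanVar
    linarith
  · rw [hω]
    have h12 := hLs.trans h9
    calc (1 / δ + 1) * Real.log n ≤ (1 / δ + 1) * ((1 - δ) * a / (1 / δ + 1) * (n : ℝ) ^ τ) :=
          mul_le_mul_of_nonneg_left h12 (by positivity)
      _ = _ := by field_simp
  · rw [rho, one_div_le (by positivity) hδ]
    simp only [Function.comp] at h11
    linarith
  · rw [hω]
    have h12 : (1 + 4 * δ) * ((1 + 1 / δ) * (24 * r) + M)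
        + remConst ξs M c r δ * Real.log n ^ (3 + γ) ≤ C * Real.log n ^ (3 + γ) := by
      have h13 : 1 ≤ Real.log n ^ (3 + γ) := hL.trans hLs
      have h14 := le_abs_self ((1 + 4 * δ) * ((1 + 1 / δ) * (24 * r) + M))
      have h15 := le_abs_self (remConst ξs M c r δ)
      have h16 := abs_nonneg ((1 + 4 * δ) * ((1 + 1 / δ) * (24 * r) + M))
      rw [hC]
      nlinarith
    refine h12.trans ?_
    calc C * Real.log n ^ (3 + γ)
        ≤ C * (δ * (a * c * ((k : ℝ) / ((k : ℝ) + 1))) / C * (n : ℝ) ^ τ) :=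
          mul_le_mul_of_nonneg_left h10 hC0.le
      _ = _ := by field_simp

lemma tendsto_excess (k : ℕ) : Tendsto (excess k) (𝓝[>] 0) (𝓝 1) := by
  have : ContinuousAt (excess k) 0 := by
    unfold excess
    refine ContinuousAt.mul (ContinuousAt.inv₀ (by fun_prop) (by norm_num)) ?_
    refine ContinuousAt.add (ContinuousAt.add (ContinuousAt.mul (by fun_prop) ?_) (by fun_prop))
      continuousAt_id
    exact (ContinuousAt.div (by fun_prop) (by fun_prop) (by norm_num)).pow _
  have h0 : excess k 0 = 1 := by simp [excess]
  have h1 := this.tendsto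
  rw [h0] at h1
  exact h1.mono_left nhdsWithin_le_nhds

lemma pinskerConst_pos {k : ℕ} (hk : 1 ≤ k) {r : ℝ} (hr : 0 < r) {g : unitInterval → L1 → ℝ≥0}
    {S : ℝ → ℝ} (hv : 0 < varsigma g S) : 0 < pinskerConst k r g S := by
  have hk' : (0 : ℝ) < k := by exact_mod_cast hk
  have hpi := Real.pi_pos
  unfold pinskerConst
  positivity

end
end HeteroReg

open HeteroReg
theorem theorem4p2 (k : ℕ) (hk : 1 ≤ k) (r : ℝ) (hr : 0 < r) (γ : ℝ) (hγ : 0 < γ)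
    (ξs : ℝ) (hξs : 3 ≤ ξs) (g : unitInterval → L1 → ℝ≥0)
    (hH1 : ConditionH1 k r g) (hbdd : BoundedScales k r g)
    (Sstar : (n : ℕ) → (Fin n → ℝ) → ℝ → ℝ)
    (hSstar : ∀ n, 3 ≤ n → IsAdaptiveEstimator γ n (Sstar n)) :
    limsup (fun n : ℕ =>
      ENNReal.ofReal ((n : ℝ) ^ (2 * (k : ℝ) / (2 * (k : ℝ) + 1))) *
        ⨆ S ∈ sobolevClass k r,
          risk g ξs n (Sstar n) S / ENNReal.ofReal (pinskerConst k r g S)) atTop ≤ 1 := by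
  obtain ⟨c, hc, hlower⟩ := hH1.lower_bound
  obtain ⟨M, hM⟩ := hbdd
  obtain ⟨B₀, hB₀⟩ := hH1.varsigma_bounded
  -- Enlarging the bound makes it positive, as is needed to divide r by it.
  set B := max B₀ 1 with hBd
  have hB : 0 < B := lt_of_lt_of_le one_pos (le_max_right _ _)
  have hg : ScaleBounds k r g c M B :=
    ⟨hc, hlower, hM, fun S hS => (hB₀ ⟨S, hS, rfl⟩).trans (le_max_left _ _)⟩
  have key : ∀ δ : ℝ, 0 < δ → 4 * δ < 1 → limsup (fun n : ℕ =>
      ENNReal.ofReal ((n : ℝ) ^ (2 * (k : ℝ) / (2 * (k : ℝ) + 1))) *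
        ⨆ S ∈ sobolevClass k r,
          risk g ξs n (Sstar n) S / ENNReal.ofReal (pinskerConst k r g S)) atTop
      ≤ ENNReal.ofReal (excess k δ) := by
    intro δ hδ hδ4
    refine limsup_le_of_le (by isBoundedDefault) ?_
    filter_upwards [eventually_largeSample (ξs := ξs) (M := M) hk hr hγ hc hB hH1 hδ hδ4] with n hn
    have hn' : (0 : ℝ) < n := by
      have := hn.three_le
      exact_mod_cast (show 0 < n by omega)
    set q := 2 * (k : ℝ) / (2 * (k : ℝ) + 1) with hq
    have hsup : (⨆ S ∈ sobolevClass k r,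
        risk g ξs n (Sstar n) S / ENNReal.ofReal (pinskerConst k r g S))
        ≤ ENNReal.ofReal (excess k δ * (n : ℝ) ^ (-q)) := by
      refine iSup₂_le fun S hS => ?_
      have hpc := pinskerConst_pos hk hr (hc.trans_le (le_varsigma hg hH1 hS))
      refine ENNReal.div_le_of_le_mul ?_
      rw [← ENNReal.ofReal_mul' hpc.le]
      refine (risk_le_of_largeSample hk hr hγ (by linarith) hg hH1 hδ hδ4 hn
        (hSstar n hn.three_le) hS).trans (ENNReal.ofReal_le_ofReal (le_of_eq ?_))
      ring
    calc _ ≤ ENNReal.ofReal ((n : ℝ) ^ q) * ENNReal.ofReal (excess k δ * (n : ℝ) ^ (-q)) := by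
          gcongr
      _ = ENNReal.ofReal (excess k δ) := by
          rw [← ENNReal.ofReal_mul (by positivity)]
          congr 1
          rw [mul_left_comm, ← Real.rpow_add hn', add_neg_cancel, Real.rpow_zero, mul_one]
  have hlim : Tendsto (fun δ => ENNReal.ofReal (excess k δ)) (𝓝[>] 0) (𝓝 1) := by
    have := (ENNReal.continuous_ofReal.tendsto 1).comp (tendsto_excess k)
    rw [ENNReal.ofReal_one] at this
    exact this
  -- The limsup does not depend on δ, so δ may tend to 0 from the right after n has gone to
  -- infinity.
  refine ge_of_tendsto hlim ?_
  have : Set.Ioo (0 : ℝ) (1 / 4) ∈ 𝓝[>] (0 : ℝ) := Ioo_mem_nhdsGT (by norm_num)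
  filter_upwards [this] with δ hδ
  exact key δ hδ.1 (by linarith [hδ.2])
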